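/- Let $k$ be an algebraically closed field of characteristic zero, let $n\ge 1$, and let $X=X^{n,n+1}_{n+2}$ be the blow-up of $\mathbb P^n\times\mathbb P^{n+1}$ at $n+2$ points $p_1,\dots,p_{n+2}$ in general position, meaning that any $n+1$ of the projections of the $p_i$ to $\mathbb P^n$ are linearly independent and that the $n+2$ projections of the $p_i$ to $\mathbb P^{n+1}$ are linearly independent. Let $H_1,H_2$ be the pullbacks to $X$ of the hyperplane classes of $\mathbb P^n$ and $\mathbb P^{n+1}$, and let $E_i$ be the class of the exceptional divisor over $p_i$. Every divisor class on $X$ (modulo linear equivalence) can be written uniquely as $d_1H_1+d_2H_2-\sum_{i=1}^{n+2}m_iE_i$ with integers $d_1,d_2,m_i$. The monoid of effective divisor classes on $X$ is generated by the following classes: - $E_i$, for every $i\in\{1,\dots,n+2\}$; - $H_1-\sum_{i\in I}E_i$, for every $I\subset\{1,\dots,n+2\}$ with $|I|=n$; - $H_2-\sum_{i\in I}E_i$, for every $I\subset\{1,\dots,n+2\}$ with $|I|=n+1$. Moreover, for integers $d_1,d_2,m_i$, the class $d_1H_1+d_2H_2-\sum_i m_iE_i$ is effective if and only if - $d_1\ge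 0$ and $d_2\ge 0$; - $d_1+d_2\ge m_i$ for every $i\in\{1,\dots,n+2\}$; - $nd_1+(n+1)d_2\ge\sum_{i\in I}m_i$ for every $I\subseteq\{1,\dots,n+2\}$ with $|I|\in\{n+1,n+2\}$; and, for real $d_1,d_2,m_i$, the same inequalities characterize the classes $d_1H_1+d_2H_2-\sum_i m_iE_i$ that lie in the effective cone $\operatorname{Eff}(X)$, the convex cone generated by the effective classes in the real vector space of divisor classes of $X$. -/

import Mathlib

/-!
Divisors on the blow-up `X` of `ℙⁿ × ℙᵐ` at finitely many points `p i`, over a field `k`.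

`X` is an integral separated scheme, and it is built as a model of its function field `K`: a point
of `X` is its local ring, a local subring of `K`, and `X` is the union of the affine pieces
`Spec R[I/f]`, where `Spec R` runs over the standard affine charts of `ℙⁿ × ℙᵐ`, `I` is the ideal
of `R` of the centres lying in that chart, and `0 ≠ f ∈ I`.
-/

namespace BlowupProd

open Projectivization
open scoped LinearAlgebra.Projectivization TensorProduct

noncomputable section

/-- Rational functions in the homogeneous coordinates `x_0, …, x_n, y_0, …, y_m`. -/
abbrev CoordField (k : Type*) [Field k] (n m : ℕ) : Type _ :=
  FractionRing (MvPolynomial (Fin (n + 1) ⊕ Fin (m + 1)) k)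

/-- The homogeneous coordinate `x_i` on the first factor. -/
def xCoord (k : Type*) [Field k] (n m : ℕ) (i : Fin (n + 1)) : CoordField k n m :=
  algebraMap (MvPolynomial (Fin (n + 1) ⊕ Fin (m + 1)) k) _ (MvPolynomial.X (Sum.inl i))

/-- The homogeneous coordinate `y_j` on the second factor. -/
def yCoord (k : Type*) [Field k] (n m : ℕ) (j : Fin (m + 1)) : CoordField k n m :=
  algebraMap (MvPolynomial (Fin (n + 1) ⊕ Fin (m + 1)) k) _ (MvPolynomial.X (Sum.inr j))

/-- All quotients `x_i / x_a` and `y_j / y_b`. -/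
def ratios (k : Type*) [Field k] (n m : ℕ) : Set (CoordField k n m) :=
  Set.range (fun q : Fin (n + 1) × Fin (n + 1) => xCoord k n m q.1 / xCoord k n m q.2) ∪
    Set.range (fun q : Fin (m + 1) × Fin (m + 1) => yCoord k n m q.1 / yCoord k n m q.2)

/-- The function field of `ℙⁿ × ℙᵐ`: the field generated over `k` by the quotients `x_i / x_a`
and `y_j / y_b`. -/
def FunField (k : Type*) [Field k] (n m : ℕ) : Type _ :=
  ↥(IntermediateField.adjoin k (ratios k n m))

instance (k : Type*) [Field k] (n m : ℕ) : Field (FunField k n m) :=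
  inferInstanceAs (Field ↥(IntermediateField.adjoin k (ratios k n m)))

instance (k : Type*) [Field k] (n m : ℕ) : Algebra k (FunField k n m) :=
  inferInstanceAs (Algebra k ↥(IntermediateField.adjoin k (ratios k n m)))

/-- The inclusion of the function field of `ℙⁿ × ℙᵐ` into the field of rational functions in the
homogeneous coordinates. -/
def FunField.val (k : Type*) [Field k] (n m : ℕ) : FunField k n m →ₐ[k] CoordField k n m :=
  (IntermediateField.adjoin k (ratios k n m)).val

/-- The rational function `x_i / x_a` on `ℙⁿ × ℙᵐ`. -/
def xRatio (k : Type*) [Field k] (n m : ℕ) (i a : Fin (n + 1)) : FunField k n m :=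
  ⟨xCoord k n m i / xCoord k n m a,
    IntermediateField.subset_adjoin k _ (Or.inl ⟨(i, a), rfl⟩)⟩

/-- The rational function `y_j / y_b` on `ℙⁿ × ℙᵐ`. -/
def yRatio (k : Type*) [Field k] (n m : ℕ) (j b : Fin (m + 1)) : FunField k n m :=
  ⟨yCoord k n m j / yCoord k n m b,
    IntermediateField.subset_adjoin k _ (Or.inr ⟨(j, b), rfl⟩)⟩

/-- The coordinate ring of the affine chart `x_a ≠ 0`, `y_b ≠ 0` of `ℙⁿ × ℙᵐ`. -/
def baseChart (k : Type*) [Field k] (n m : ℕ) (a : Fin (n + 1)) (b : Fin (m + 1)) :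
    Subalgebra k (FunField k n m) :=
  Algebra.adjoin k
    (Set.range (fun i => xRatio k n m i a) ∪ Set.range (fun j => yRatio k n m j b))

theorem xRatio_mem {k : Type*} [Field k] {n m : ℕ} (i a : Fin (n + 1)) (b : Fin (m + 1)) :
    xRatio k n m i a ∈ baseChart k n m a b :=
  Algebra.subset_adjoin (Or.inl ⟨i, rfl⟩)

theorem yRatio_mem {k : Type*} [Field k] {n m : ℕ} (a : Fin (n + 1)) (j b : Fin (m + 1)) :
    yRatio k n m j b ∈ baseChart k n m a b :=
  Algebra.subset_adjoin (Or.inr ⟨j, rfl⟩)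

/-- The `k`-points of `ℙⁿ × ℙᵐ`. -/
abbrev Pt (k : Type*) [Field k] (n m : ℕ) : Type _ :=
  ℙ k (Fin (n + 1) → k) × ℙ k (Fin (m + 1) → k)

/-- The point `q` lies in the chart `x_a ≠ 0`, `y_b ≠ 0`. -/
def InChart {k : Type*} [Field k] {n m : ℕ} (q : Pt k n m) (a : Fin (n + 1)) (b : Fin (m + 1)) :
    Prop :=
  q.1.rep a ≠ 0 ∧ q.2.rep b ≠ 0

/-- The maximal ideal of a point `q` of the chart `x_a ≠ 0`, `y_b ≠ 0`. -/
def pointIdeal {k : Type*} [Field k] {n m : ℕ} (q : Pt k n m) (a : Fin (n + 1))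
    (b : Fin (m + 1)) : Ideal (baseChart k n m a b) :=
  Ideal.span
    (Set.range (fun i => (⟨xRatio k n m i a, xRatio_mem i a b⟩ : baseChart k n m a b) -
        algebraMap k _ (q.1.rep i / q.1.rep a)) ∪
      Set.range (fun j => (⟨yRatio k n m j b, yRatio_mem a j b⟩ : baseChart k n m a b) -
        algebraMap k _ (q.2.rep j / q.2.rep b)))

/-- The ideal, in the chart `x_a ≠ 0`, `y_b ≠ 0`, of the set of those `p i` that lie in the
chart. -/
def centerIdeal {k : Type*} [Field k] {n m s : ℕ} (p : Fin s → Pt k n m) (a : Fin (n + 1))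
    (b : Fin (m + 1)) : Ideal (baseChart k n m a b) :=
  ⨅ (i : Fin s) (_ : InChart (p i) a b), pointIdeal (p i) a b

/-- The coordinate ring `R[I/f]` of an affine chart of the blow-up of `Spec R` along `I`, where `R`
is the coordinate ring of the chart `x_a ≠ 0`, `y_b ≠ 0` and `I` is the ideal of the centres. -/
def blowupChart {k : Type*} [Field k] {n m s : ℕ} (p : Fin s → Pt k n m) (a : Fin (n + 1))
    (b : Fin (m + 1)) (f : baseChart k n m a b) : Subalgebra k (FunField k n m) :=
  Algebra.adjoin k ((baseChart k n m a b : Set (FunField k n m)) ∪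
    {h | ∃ g ∈ centerIdeal p a b, h = (g : FunField k n m) / (f : FunField k n m)})

/-- The blow-up of `ℙⁿ × ℙᵐ` at the points `p i`, as the set of its local rings: the localizations
of the rings `R[I/f]`, `0 ≠ f ∈ I`, at their prime ideals. -/
def blowup {k : Type*} [Field k] {n m s : ℕ} (p : Fin s → Pt k n m) :
    Set (LocalSubring (FunField k n m)) :=
  {A | ∃ (a : Fin (n + 1)) (b : Fin (m + 1)), ∃ f ∈ centerIdeal p a b, f ≠ 0 ∧
    ∃ (P : Ideal (blowupChart p a b f).toSubring) (_ : P.IsPrime),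
      A = LocalSubring.ofPrime (blowupChart p a b f).toSubring P}

/-- Every point of the blow-up lies over some chart of `ℙⁿ × ℙᵐ`. -/
theorem exists_baseChart_le {k : Type*} [Field k] {n m s : ℕ} {p : Fin s → Pt k n m}
    {A : LocalSubring (FunField k n m)} (hA : A ∈ blowup p) :
    ∃ ab : Fin (n + 1) × Fin (m + 1), (baseChart k n m ab.1 ab.2).toSubring ≤ A.toSubring := by
  obtain ⟨a, b, f, -, -, P, hP, rfl⟩ := hA
  refine ⟨(a, b), fun z hz => ?_⟩
  exact LocalSubring.le_ofPrime _ P (Algebra.subset_adjoin (Or.inl hz))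

/-- The fraction field of every local ring of the blow-up is the function field. -/
theorem isFractionRing_of_mem {k : Type*} [Field k] {n m s : ℕ} {p : Fin s → Pt k n m}
    {A : LocalSubring (FunField k n m)} (hA : A ∈ blowup p) :
    IsFractionRing A.toSubring (FunField k n m) := by
  obtain ⟨⟨a, b⟩, hab⟩ := exists_baseChart_le hA
  refine IsFractionRing.of_field _ _ fun z => ?_
  let T : Subring (CoordField k n m) :=
    A.toSubring.map (FunField.val k n m).toRingHom
  have hx : ∀ i, xCoord k n m i / xCoord k n m a ∈ T := fun i =>
    ⟨xRatio k n m i a, hab (xRatio_mem i a b), rfl⟩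
  have hy : ∀ j, yCoord k n m j / yCoord k n m b ∈ T := fun j =>
    ⟨yRatio k n m j b, hab (yRatio_mem a j b), rfl⟩
  have hx0 : ∀ i, xCoord k n m i ≠ 0 := fun i => by simp [xCoord]
  have hy0 : ∀ i, yCoord k n m i ≠ 0 := fun i => by simp [yCoord]
  have hle : (IntermediateField.adjoin k (ratios k n m)).toSubfield ≤ Subfield.closure T := by
    refine IntermediateField.adjoin_le_subfield _ _ ?_ ?_
    · rintro _ ⟨c, rfl⟩
      exact Subfield.subset_closure ⟨algebraMap k _ c,
        hab ((baseChart k n m a b).algebraMap_mem c), rfl⟩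
    · rintro _ (⟨⟨i, j⟩, rfl⟩ | ⟨⟨i, j⟩, rfl⟩)
      · have := div_mem (Subfield.subset_closure (hx i)) (Subfield.subset_closure (hx j))
        rwa [div_div_div_cancel_right₀ (hx0 a)] at this
      · have := div_mem (Subfield.subset_closure (hy i)) (Subfield.subset_closure (hy j))
        rwa [div_div_div_cancel_right₀ (hy0 b)] at this
  obtain ⟨u, hu, v, hv, huv⟩ := Subfield.mem_closure_iff.1 (hle z.2)
  rw [Subring.closure_eq] at hu hv
  obtain ⟨u, hu, rfl⟩ := hu
  obtain ⟨v, hv, rfl⟩ := hv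
  exact ⟨⟨u, hu⟩, ⟨v, hv⟩, Subtype.ext huv.symm⟩

/-- The prime divisors of the blow-up, given by their generic points. These are the points of
codimension one, that is, as `X` is regular, those whose local ring is a discrete valuation ring. -/
structure PrimeDivisor {k : Type*} [Field k] {n m s : ℕ} (p : Fin s → Pt k n m) where
  localRing : LocalSubring (FunField k n m)
  mem : localRing ∈ blowup p
  isDVR : IsDiscreteValuationRing localRing.toSubring

/-- The order of vanishing along a prime divisor of a rational function (with value `0` at the
function `0`). -/
def PrimeDivisor.ord {k : Type*} [Field k] {n m s : ℕ} {p : Fin s → Pt k n m}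
    (Y : PrimeDivisor p) (f : FunField k n m) : ℤ :=
  haveI := Y.isDVR
  haveI := isFractionRing_of_mem Y.mem
  WithZero.log (Ring.ordFrac Y.localRing.toSubring f)

theorem PrimeDivisor.ord_mul {k : Type*} [Field k] {n m s : ℕ} {p : Fin s → Pt k n m}
    (Y : PrimeDivisor p) {f g : FunField k n m} (hf : f ≠ 0) (hg : g ≠ 0) :
    Y.ord (f * g) = Y.ord f + Y.ord g := by
  have := Y.isDVR
  have := isFractionRing_of_mem Y.mem
  simp only [PrimeDivisor.ord, map_mul]
  exact WithZero.log_mul ((map_ne_zero _).2 hf) ((map_ne_zero _).2 hg)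

theorem PrimeDivisor.ord_one {k : Type*} [Field k] {n m s : ℕ} {p : Fin s → Pt k n m}
    (Y : PrimeDivisor p) : Y.ord 1 = 0 := by
  simp [PrimeDivisor.ord]

/-- Weil divisors on the blow-up. -/
abbrev Divisor {k : Type*} [Field k] {n m s : ℕ} (p : Fin s → Pt k n m) : Type _ :=
  PrimeDivisor p →₀ ℤ

/-- The principal divisors: those of the form `div f` with `f ≠ 0` a rational function. -/
def principal {k : Type*} [Field k] {n m s : ℕ} (p : Fin s → Pt k n m) :
    AddSubgroup (Divisor p) where
  carrier := {D | ∃ f : FunField k n m, f ≠ 0 ∧ ∀ Y : PrimeDivisor p, D Y = Y.ord f}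
  zero_mem' := ⟨1, one_ne_zero, fun Y => by simp [Y.ord_one]⟩
  add_mem' := by
    rintro D D' ⟨f, hf, h⟩ ⟨g, hg, h'⟩
    exact ⟨f * g, mul_ne_zero hf hg, fun Y => by simp [h, h', Y.ord_mul hf hg]⟩
  neg_mem' := by
    rintro D ⟨f, hf, h⟩
    refine ⟨f⁻¹, inv_ne_zero hf, fun Y => ?_⟩
    have := Y.ord_mul hf (inv_ne_zero hf)
    rw [mul_inv_cancel₀ hf, Y.ord_one] at this
    rw [Finsupp.neg_apply, h]
    omega

/-- The group of divisor classes (divisors modulo linear equivalence) on the blow-up. -/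
abbrev ClassGrp {k : Type*} [Field k] {n m s : ℕ} (p : Fin s → Pt k n m) : Type _ :=
  Divisor p ⧸ principal p

/-- The class of a divisor. -/
def divisorClass {k : Type*} [Field k] {n m s : ℕ} (p : Fin s → Pt k n m) :
    Divisor p →+ ClassGrp p :=
  QuotientAddGroup.mk' (principal p)

/-- The monoid of effective divisor classes: the classes of effective divisors. -/
def effMonoid {k : Type*} [Field k] {n m s : ℕ} (p : Fin s → Pt k n m) :
    AddSubmonoid (ClassGrp p) :=
  (AddSubmonoid.nonneg (Divisor p)).map (divisorClass p)

/-- The effective cone: the convex cone generated by the effective classes in the real vector space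
of divisor classes. -/
def effCone {k : Type*} [Field k] {n m s : ℕ} (p : Fin s → Pt k n m) :
    PointedCone ℝ (ℝ ⊗[ℤ] ClassGrp p) :=
  PointedCone.hull ℝ ((fun c : ClassGrp p => (1 : ℝ) ⊗ₜ[ℤ] c) '' (effMonoid p : Set (ClassGrp p)))

/-- A chart `x_a ≠ 0`, `y_b ≠ 0` of `ℙⁿ × ℙᵐ` which contains the generic point of the image of the
prime divisor `Y`. -/
def PrimeDivisor.chart {k : Type*} [Field k] {n m s : ℕ} {p : Fin s → Pt k n m}
    (Y : PrimeDivisor p) : Fin (n + 1) × Fin (m + 1) :=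
  (exists_baseChart_le Y.mem).choose

/-- `H₁`: the class of the pullback to the blow-up of the hyperplane `x_0 = 0` of `ℙⁿ`. A local
equation of this pullback over the chart `x_a ≠ 0`, `y_b ≠ 0` is `x_0 / x_a`. -/
def H₁ {k : Type*} [Field k] {n m s : ℕ} (p : Fin s → Pt k n m) : ClassGrp p :=
  divisorClass p (∑ᶠ Y : PrimeDivisor p, Finsupp.single Y (Y.ord (xRatio k n m 0 Y.chart.1)))

/-- `H₂`: the class of the pullback to the blow-up of the hyperplane `y_0 = 0` of `ℙᵐ`. -/
def H₂ {k : Type*} [Field k] {n m s : ℕ} (p : Fin s → Pt k n m) : ClassGrp p :=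
  divisorClass p (∑ᶠ Y : PrimeDivisor p, Finsupp.single Y (Y.ord (yRatio k n m 0 Y.chart.2)))

/-- The prime divisor `Y` is contracted to the point `q` of `ℙⁿ × ℙᵐ`: its local ring dominates the
local ring of `q`. -/
def PrimeDivisor.LiesOver {k : Type*} [Field k] {n m s : ℕ} {p : Fin s → Pt k n m}
    (Y : PrimeDivisor p) (q : Pt k n m) : Prop :=
  ∃ (a : Fin (n + 1)) (b : Fin (m + 1)), InChart q a b ∧
    ∃ h : (baseChart k n m a b).toSubring ≤ Y.localRing.toSubring,
      ∀ g ∈ pointIdeal q a b,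
        (⟨g, h g.2⟩ : Y.localRing.toSubring) ∈ IsLocalRing.maximalIdeal Y.localRing.toSubring

/-- The class `E i` of the exceptional divisor, the (reduced) preimage of the point `p i`. -/
def E {k : Type*} [Field k] {n m s : ℕ} (p : Fin s → Pt k n m) (i : Fin s) : ClassGrp p :=
  divisorClass p (∑ᶠ (Y : PrimeDivisor p) (_ : Y.LiesOver (p i)), Finsupp.single Y 1)

/-- The points `p i` are in general position: in each factor, any subset of the projected points,
of cardinality at most the number of homogeneous coordinates, is linearly independent. -/
def GeneralPosition {k : Type*} [Field k] {n m s : ℕ} (p : Fin s → Pt k n m) : Prop :=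
  (∀ T : Finset (Fin s), T.card ≤ n + 1 → Independent (fun i : T => (p i).1)) ∧
    ∀ T : Finset (Fin s), T.card ≤ m + 1 → Independent (fun i : T => (p i).2)

end

end BlowupProd

/-!
Bihomogeneous polynomials `F` in the coordinates of `ℙⁿ × ℙᵐ` control the divisors of the blow-up.
The discrete valuation rings among the local rings of the blow-up are classified: each is the ring
of an irreducible bihomogeneous polynomial (`primeForm`, a strict transform) or of the multiplicity
at a centre (`pointForm`, an exceptional divisor); see `PrimeDivisor.liesOver_or_exists_primeForm`
and `toSubring_eq_of_liesOver`. As the coordinate ring is factorial, it follows that `H₁`, `H₂` and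
the `E i` generate the class group (`combination_surjective`), and that the class
`d₁ H₁ + d₂ H₂ - ∑ mᵢ Eᵢ` is effective exactly when some `F ≠ 0` of bidegree `(d₁, d₂)` has
multiplicity at least `mᵢ` at each centre `p i` (`mem_effMonoid_of_form`,
`exists_form_of_mem_effMonoid`).

*The inequalities are necessary.* The multiplicity of `F` at a point is at most its total degree.
Moreover, through the `n + 2` points in general position passes a family of rational curves of
bidegree `(n, n + 1)`, whose members cover a dense subset of `ℙⁿ × ℙⁿ⁺¹`. One of them is not
contained in the hypersurface `F = 0`, and the restriction of `F` to it is a nonzero polynomial in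
one variable, of degree at most `n d₁ + (n + 1) d₂`, which vanishes at the `i`-th point to order at
least the multiplicity of `F` there (`sum_le_of_X_pow_dvd_taylor`). A linear relation between `H₁`,
`H₂` and the `E i` must satisfy the inequalities together with its opposite, and is therefore
trivial (`combination_bijective`).

*The inequalities are sufficient.* There are linear forms in the `x` through any `n` of the points
and linear forms in the `y` through any `n + 1` of them, so that the generators are effective. With
`cᵢ = d₁ + d₂ - mᵢ`, the inequalities become `c ≥ 0`, `∑ c ≥ 2 d₁ + d₂` and `∑_{j ≠ l} c_j ≥ d₁`,
and a greedy subtraction of generators decomposes every solution (`mem_of_inequalities`). This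
argument works over any ordered abelian group, and hence both for the monoid of effective classes
and for the effective cone.
-/

/-! ### Bihomogeneous polynomials -/

open MvPolynomial in
/-- The substitution `x_i ↦ x_i T ^ w i`, whose coefficient at `T ^ j` is the component of weighted
degree `j`. -/
noncomputable def MvPolynomial.spread {σ k : Type*} [CommRing k] (w : σ → ℕ) :
    MvPolynomial σ k →ₐ[k] Polynomial (MvPolynomial σ k) :=
  aeval fun i => Polynomial.C (X i) * Polynomial.X ^ w i

theorem MvPolynomial.spread_monomial {σ k : Type*} [CommRing k] (w : σ → ℕ) (d : σ →₀ ℕ) (c : k) :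
    spread w (monomial d c) = Polynomial.monomial (Finsupp.weight w d) (monomial d c) := by
  classical
  rw [spread, aeval_monomial, Finsupp.weight_apply]
  simp only [mul_pow, ← pow_mul]
  rw [Finsupp.prod_mul, ← Polynomial.C_mul_X_pow_eq_monomial, monomial_eq]
  simp only [Finsupp.prod, Finsupp.sum, Polynomial.C_mul, map_prod, map_pow, smul_eq_mul]
  rw [Finset.prod_pow_eq_pow_sum]
  simp only [mul_comm (w _)]
  rw [mul_assoc]
  rfl

theorem MvPolynomial.coeff_spread {σ k : Type*} [CommRing k] (w : σ → ℕ) (G : MvPolynomial σ k)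
    (j : ℕ) : (spread w G).coeff j = weightedHomogeneousComponent w j G := by
  classical
  induction G using MvPolynomial.induction_on' with
  | monomial d c =>
    rw [spread_monomial, Polynomial.coeff_monomial]
    split_ifs with h
    · exact ((isWeightedHomogeneous_monomial w d c h).weightedHomogeneousComponent_same).symm
    · exact ((isWeightedHomogeneous_monomial w d c rfl).weightedHomogeneousComponent_ne _
        (Ne.symm h)).symm
  | add p q hp hq => rw [map_add, map_add, Polynomial.coeff_add, hp, hq]

theorem MvPolynomial.spread_injective {σ k : Type*} [CommRing k] (w : σ → ℕ) :
    Function.Injective (spread (k := k) w) := by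
  intro F G h
  rw [← sum_weightedHomogeneousComponent w F, ← sum_weightedHomogeneousComponent w G]
  simp only [← coeff_spread, h]

/-- A factor of a nonzero weighted homogeneous polynomial is weighted homogeneous: the lowest and
the highest degrees in `T` of `spread w F` add up over a product. -/
theorem MvPolynomial.IsWeightedHomogeneous.of_mul_left {σ k : Type*} [CommRing k] [IsDomain k]
    {w : σ → ℕ} {G H : MvPolynomial σ k} {d : ℕ} (h : IsWeightedHomogeneous w (G * H) d)
    (h0 : G * H ≠ 0) : ∃ e, IsWeightedHomogeneous w G e := by
  have hG : spread w G ≠ 0 := (map_ne_zero_iff _ (spread_injective w)).2 (left_ne_zero_of_mul h0)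
  have hH : spread w H ≠ 0 := (map_ne_zero_iff _ (spread_injective w)).2 (right_ne_zero_of_mul h0)
  have hGH : spread w (G * H) = Polynomial.monomial d (G * H) := by
    ext1 j
    rw [coeff_spread, Polynomial.coeff_monomial]
    split_ifs with hj
    · exact hj ▸ h.weightedHomogeneousComponent_same
    · exact h.weightedHomogeneousComponent_ne _ (Ne.symm hj)
  have h1 := Polynomial.natDegree_mul hG hH
  have h2 := Polynomial.natTrailingDegree_mul hG hH
  rw [← map_mul, hGH, Polynomial.natDegree_monomial_eq _ h0] at h1
  rw [← map_mul, hGH, Polynomial.natTrailingDegree_monomial h0] at h2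
  have h3 := Polynomial.natTrailingDegree_le_natDegree (spread w G)
  have h4 := Polynomial.natTrailingDegree_le_natDegree (spread w H)
  have h5 : (spread w G).natTrailingDegree = (spread w G).natDegree := by omega
  refine ⟨(spread w G).natDegree, ?_⟩
  classical
  intro c hc
  have hc' : (spread w G).coeff (Finsupp.weight w c) ≠ 0 := by
    intro h
    rw [coeff_spread] at h
    refine hc ?_
    rw [← coeff_zero c, ← h, coeff_weightedHomogeneousComponent, if_pos rfl]
  exact le_antisymm (Polynomial.le_natDegree_of_ne_zero hc')
    (h5 ▸ Polynomial.natTrailingDegree_le_of_ne_zero hc')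

namespace BlowupProd

open Projectivization
open scoped LinearAlgebra.Projectivization TensorProduct

noncomputable section

/-- The bidegrees of the homogeneous coordinates. -/
def biweight (n m : ℕ) : Fin (n + 1) ⊕ Fin (m + 1) → ℕ × ℕ :=
  Sum.elim (fun _ => (1, 0)) (fun _ => (0, 1))

/-- The bihomogeneous polynomials of bidegree `d` in the homogeneous coordinates. -/
abbrev IsBihom {k : Type*} [Field k] {n m : ℕ} (F : MvPolynomial (Fin (n + 1) ⊕ Fin (m + 1)) k)
    (d : ℕ × ℕ) : Prop :=
  F.IsWeightedHomogeneous (biweight n m) d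

section
variable {k : Type*} [Field k] {n m : ℕ}

theorem weight_biweight (c : Fin (n + 1) ⊕ Fin (m + 1) →₀ ℕ) :
    Finsupp.weight (biweight n m) c = (∑ i, c (Sum.inl i), ∑ j, c (Sum.inr j)) := by
  rw [Finsupp.weight_apply, Finsupp.sum_fintype _ _ (fun i => zero_nsmul (biweight n m i)),
    Fintype.sum_sum_type]
  ext <;> simp [biweight, Prod.fst_sum, Prod.snd_sum]

theorem isBihom_iff {F : MvPolynomial (Fin (n + 1) ⊕ Fin (m + 1)) k} {d : ℕ × ℕ} :
    IsBihom F d ↔ F.IsWeightedHomogeneous (fun s => (biweight n m s).1) d.1 ∧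
      F.IsWeightedHomogeneous (fun s => (biweight n m s).2) d.2 := by
  have h1 (c : Fin (n + 1) ⊕ Fin (m + 1) →₀ ℕ) : Finsupp.weight (fun s => (biweight n m s).1) c =
      (Finsupp.weight (biweight n m) c).1 := by
    simp [Finsupp.weight_apply, Finsupp.sum, Prod.fst_sum]
  have h2 (c : Fin (n + 1) ⊕ Fin (m + 1) →₀ ℕ) : Finsupp.weight (fun s => (biweight n m s).2) c =
      (Finsupp.weight (biweight n m) c).2 := by
    simp [Finsupp.weight_apply, Finsupp.sum, Prod.snd_sum]
  simp only [IsBihom, MvPolynomial.IsWeightedHomogeneous, h1, h2, Prod.ext_iff]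
  exact ⟨fun h => ⟨fun _ hc => (h hc).1, fun _ hc => (h hc).2⟩, fun h _ hc => ⟨h.1 hc, h.2 hc⟩⟩

theorem IsBihom.of_dvd {F G : MvPolynomial (Fin (n + 1) ⊕ Fin (m + 1)) k} {d : ℕ × ℕ}
    (hF : IsBihom F d) (h0 : F ≠ 0) (h : G ∣ F) : ∃ e, IsBihom G e := by
  obtain ⟨H, rfl⟩ := h
  obtain ⟨e, he⟩ := (isBihom_iff.1 hF).1.of_mul_left h0
  obtain ⟨e', he'⟩ := (isBihom_iff.1 hF).2.of_mul_left h0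
  exact ⟨(e, e'), isBihom_iff.2 ⟨he, he'⟩⟩

theorem IsBihom.of_mul {G H : MvPolynomial (Fin (n + 1) ⊕ Fin (m + 1)) k} {d : ℕ × ℕ}
    (hF : IsBihom (G * H) d) (h0 : G * H ≠ 0) :
    ∃ e e', IsBihom G e ∧ IsBihom H e' ∧ e + e' = d := by
  obtain ⟨e, he⟩ := IsBihom.of_dvd hF h0 (dvd_mul_right _ _)
  obtain ⟨e', he'⟩ := IsBihom.of_dvd hF h0 (dvd_mul_left _ _)
  exact ⟨e, e', he, he', (he.mul he').inj_right h0 hF⟩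

theorem isBihom_x (i : Fin (n + 1)) :
    IsBihom (MvPolynomial.X (Sum.inl i) : MvPolynomial (Fin (n + 1) ⊕ Fin (m + 1)) k) (1, 0) :=
  MvPolynomial.isWeightedHomogeneous_X _ _ _

theorem isBihom_y (j : Fin (m + 1)) :
    IsBihom (MvPolynomial.X (Sum.inr j) : MvPolynomial (Fin (n + 1) ⊕ Fin (m + 1)) k) (0, 1) :=
  MvPolynomial.isWeightedHomogeneous_X _ _ _

theorem IsBihom.aeval_scale {A : Type*} [CommRing A] [Algebra k A]
    {F : MvPolynomial (Fin (n + 1) ⊕ Fin (m + 1)) k} {d : ℕ × ℕ} (hF : IsBihom F d) (a b : A)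
    (g : Fin (n + 1) ⊕ Fin (m + 1) → A) :
    MvPolynomial.aeval (fun s => Sum.elim (fun _ => a) (fun _ => b) s * g s) F =
      a ^ d.1 * b ^ d.2 * MvPolynomial.aeval g F := by
  rw [MvPolynomial.aeval_def, MvPolynomial.aeval_def, MvPolynomial.eval₂_eq',
    MvPolynomial.eval₂_eq', Finset.mul_sum]
  refine Finset.sum_congr rfl fun c hc => ?_
  have hd := hF (MvPolynomial.mem_support_iff.1 hc)
  rw [weight_biweight] at hd
  subst hd
  simp only [mul_pow, Finset.prod_mul_distrib, Fintype.prod_sum_type, Sum.elim_inl, Sum.elim_inr,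
    Finset.prod_pow_eq_pow_sum]
  ring

theorem IsBihom.natDegree_aeval_le {A : Type*} [CommRing A] [Algebra k A]
    {F : MvPolynomial (Fin (n + 1) ⊕ Fin (m + 1)) k} {d : ℕ × ℕ} (hF : IsBihom F d) {a b : ℕ}
    {g : Fin (n + 1) ⊕ Fin (m + 1) → Polynomial A} (ha : ∀ i, (g (Sum.inl i)).natDegree ≤ a)
    (hb : ∀ j, (g (Sum.inr j)).natDegree ≤ b) :
    (MvPolynomial.aeval g F).natDegree ≤ a * d.1 + b * d.2 := by
  rw [MvPolynomial.aeval_def, MvPolynomial.eval₂_eq']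
  refine Polynomial.natDegree_sum_le_of_forall_le _ _ fun c hc => ?_
  have hd := hF (MvPolynomial.mem_support_iff.1 hc)
  rw [weight_biweight] at hd
  subst hd
  rw [Polynomial.algebraMap_apply]
  refine (Polynomial.natDegree_C_mul_le _ _).trans ?_
  rw [Fintype.prod_sum_type, Finset.mul_sum, Finset.mul_sum]
  refine Polynomial.natDegree_mul_le.trans (add_le_add ?_ ?_)
  · refine (Polynomial.natDegree_prod_le _ _).trans (Finset.sum_le_sum fun i _ => ?_)
    rw [mul_comm]
    exact Polynomial.natDegree_pow_le_of_le _ (ha i)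
  · refine (Polynomial.natDegree_prod_le _ _).trans (Finset.sum_le_sum fun i _ => ?_)
    rw [mul_comm]
    exact Polynomial.natDegree_pow_le_of_le _ (hb i)

end
end
end BlowupProd

/-! ### Discrete valuations -/

open scoped WithZero

section
open WithZero

theorem WithZero.lt_one_iff_le_exp (a : ℤᵐ⁰) : a < 1 ↔ a ≤ exp (-1) := by
  by_cases h : a = 0
  · simp [h]
  · rw [← exp_log h, ← exp_zero, exp_lt_exp, exp_le_exp]
    omega

/-- The valuation of a domain defined by a prime element `p`. -/
noncomputable def primeVal {W : Type*} [CommRing W] [IsDomain W] [WfDvdMonoid W] {p : W}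
    (hp : Prime p) : Valuation W ℤᵐ⁰ :=
  open Classical in
  { toFun := fun x => if x = 0 then 0 else exp (-(multiplicity p x : ℤ))
    map_zero' := if_pos rfl
    map_one' := by
      rw [if_neg one_ne_zero, FiniteMultiplicity.one_right
        (FiniteMultiplicity.of_not_isUnit hp.not_isUnit one_ne_zero)]
      simp
    map_mul' := fun x y => by
      by_cases hx : x = 0
      · simp [hx]
      by_cases hy : y = 0
      · simp [hy]
      rw [if_neg hx, if_neg hy, if_neg (mul_ne_zero hx hy), multiplicity_mul hp
        (FiniteMultiplicity.of_not_isUnit hp.not_isUnit (mul_ne_zero hx hy)), ← exp_add]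
      push_cast
      ring_nf
    map_add_le_max' := fun x y => by
      by_cases hx : x = 0
      · rw [hx, zero_add]
        exact le_max_right _ _
      by_cases hy : y = 0
      · rw [hy, add_zero]
        exact le_max_left _ _
      by_cases hxy : x + y = 0
      · simp [hxy]
      rw [if_neg hx, if_neg hy, if_neg hxy, le_max_iff, exp_le_exp, exp_le_exp, neg_le_neg_iff,
        neg_le_neg_iff, Nat.cast_le, Nat.cast_le]
      have fin {z : W} (hz : z ≠ 0) := FiniteMultiplicity.of_not_isUnit hp.not_isUnit hz
      rw [← (fin hxy).pow_dvd_iff_le_multiplicity, ← (fin hxy).pow_dvd_iff_le_multiplicity]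
      rcases le_total (multiplicity p x) (multiplicity p y) with h | h
      · exact Or.inl (dvd_add (pow_multiplicity_dvd p x)
          ((pow_dvd_pow p h).trans (pow_multiplicity_dvd p y)))
      · exact Or.inr (dvd_add ((pow_dvd_pow p h).trans (pow_multiplicity_dvd p x))
          (pow_multiplicity_dvd p y)) }

section
variable {W : Type*} [CommRing W] [IsDomain W] [WfDvdMonoid W] {p : W}

theorem primeVal_of_ne_zero (hp : Prime p) {x : W} (hx : x ≠ 0) :
    primeVal hp x = exp (-(multiplicity p x : ℤ)) :=
  if_neg hx

theorem primeVal_le_iff (hp : Prime p) {x : W} {r : ℕ} :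
    primeVal hp x ≤ exp (-(r : ℤ)) ↔ p ^ r ∣ x := by
  by_cases hx : x = 0
  · simp [hx]
  · rw [primeVal_of_ne_zero hp hx, exp_le_exp, neg_le_neg_iff, Nat.cast_le,
      ← FiniteMultiplicity.pow_dvd_iff_le_multiplicity
        (FiniteMultiplicity.of_not_isUnit hp.not_isUnit hx)]

theorem primeVal_le_one (hp : Prime p) (x : W) : primeVal hp x ≤ 1 := by
  simpa using (primeVal_le_iff hp (x := x) (r := 0)).2 (by simp)

theorem primeVal_eq_zero (hp : Prime p) {x : W} (h : primeVal hp x = 0) : x = 0 := by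
  by_contra hx
  rw [primeVal_of_ne_zero hp hx] at h
  exact exp_ne_zero h

theorem primeVal_lt_one_iff (hp : Prime p) {x : W} : primeVal hp x < 1 ↔ p ∣ x := by
  rw [WithZero.lt_one_iff_le_exp]
  simpa using primeVal_le_iff hp (x := x) (r := 1)

theorem primeVal_eq_one_iff (hp : Prime p) {x : W} : primeVal hp x = 1 ↔ ¬ p ∣ x := by
  rw [← primeVal_lt_one_iff hp, not_lt]
  exact ⟨fun h => h.ge, fun h => le_antisymm (primeVal_le_one hp x) h⟩

end

section
variable {K : Type*} [Field K] {w : Valuation K ℤᵐ⁰}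

theorem Valuation.isDiscreteValuationRing_integer {t : K} (ht : w t = exp (-1)) :
    IsDiscreteValuationRing w.integer := by
  have ht1 : w t ≤ 1 := by rw [ht, ← exp_zero, exp_le_exp]; norm_num
  have hw := Valuation.integer.integers w
  refine IsDiscreteValuationRing.ofHasUnitMulPowIrreducibleFactorization
    ⟨⟨t, ht1⟩, ⟨?_, ?_⟩, ?_⟩
  · rw [hw.isUnit_iff_valuation_eq_one]
    change w t ≠ 1
    rw [ht, ← exp_zero, Ne, exp_inj]
    norm_num
  · rintro ⟨a, ha⟩ ⟨b, hb⟩ hab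
    rw [hw.isUnit_iff_valuation_eq_one, hw.isUnit_iff_valuation_eq_one]
    change w a = 1 ∨ w b = 1
    have h : w a * w b = exp (-1) := by
      rw [← map_mul, ← ht]
      exact congrArg (fun z : w.integer => w z) hab.symm
    rw [Valuation.mem_integer_iff] at ha hb
    have ha0 : w a ≠ 0 := left_ne_zero_of_mul (h ▸ exp_ne_zero)
    have hb0 : w b ≠ 0 := right_ne_zero_of_mul (h ▸ exp_ne_zero)
    rw [← exp_log ha0, ← exp_zero, exp_le_exp] at ha
    rw [← exp_log hb0, ← exp_zero, exp_le_exp] at hb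
    rw [← exp_log ha0, ← exp_log hb0, ← exp_add, exp_inj] at h
    rw [← exp_log ha0, ← exp_log hb0, ← exp_zero, exp_inj, exp_inj]
    omega
  · rintro ⟨x, hx⟩ hx0
    have hx0' : w x ≠ 0 := (map_ne_zero _).2 fun h => hx0 (Subtype.ext h)
    rw [Valuation.mem_integer_iff, ← exp_log hx0', ← exp_zero, exp_le_exp] at hx
    refine ⟨(-log (w x)).toNat, dvd_dvd_iff_associated.1 ?_⟩
    have h : w (t ^ (-log (w x)).toNat) = w x := by
      rw [map_pow, ht, ← exp_nsmul]
      conv_rhs => rw [← exp_log hx0']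
      rw [exp_inj]
      simp [hx]
    rw [hw.dvd_iff_le, hw.dvd_iff_le]
    exact ⟨h.ge, h.le⟩

theorem Valuation.irreducible_integer {t : w.integer} (ht : w t = exp (-1)) :
    Irreducible t := by
  have := Valuation.isDiscreteValuationRing_integer ht
  have hw := Valuation.integer.integers w
  obtain ⟨s, hs⟩ := IsDiscreteValuationRing.exists_irreducible w.integer
  have hs1 : w s < 1 := lt_of_le_of_ne s.2 fun h =>
    hs.not_isUnit (hw.isUnit_iff_valuation_eq_one.2 h)
  rw [WithZero.lt_one_iff_le_exp, ← ht] at hs1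
  obtain ⟨c, rfl⟩ := (hw.dvd_iff_le (x := t) (y := s)).2 hs1
  rcases hs.isUnit_or_isUnit rfl with h | h
  · rw [hw.isUnit_iff_valuation_eq_one] at h
    change w t = 1 at h
    rw [ht, ← exp_zero, exp_inj] at h
    norm_num at h
  · exact (associated_mul_unit_left t c h).irreducible hs

theorem Ring.ordFrac_eq_of_eq_integer {A : Subring K} [IsDiscreteValuationRing A]
    [IsFractionRing A K] (hA : A = w.integer) {t : K} (ht : w t = exp (-1)) (z : K) :
    Ring.ordFrac A z = (w z)⁻¹ := by
  have unit (u : K) (hu : w u = 1) : Ring.ordFrac A u = 1 := by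
    subst hA
    exact Ring.ordFrac_of_isUnit (R := w.integer) (x := ⟨u, hu.le⟩)
      ((Valuation.integer.integers w).isUnit_iff_valuation_eq_one.2 hu)
  have hord : Ring.ordFrac A t = exp 1 := by
    have ht1 : w t ≤ 1 := by rw [ht, ← exp_zero, exp_le_exp]; norm_num
    have hirr : Irreducible (⟨t, hA ▸ ht1⟩ : A) := by
      subst hA
      exact Valuation.irreducible_integer (t := ⟨t, ht1⟩) ht
    exact Ring.ordFrac_irreducible (K := K) hirr
  by_cases hz : z = 0
  · rw [hz, map_zero, map_zero, inv_zero]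
  have hz' : w z ≠ 0 := (map_ne_zero _).2 hz
  have hu : w (z * t ^ log (w z)) = 1 := by
    rw [map_mul, map_zpow₀, ht, ← exp_zsmul]
    nth_rw 1 [← exp_log hz']
    rw [← exp_add]
    simp
  have h := unit _ hu
  rw [map_mul, map_zpow₀, hord, ← exp_zsmul] at h
  rw [eq_inv_of_mul_eq_one_left h]
  congr 1
  rw [smul_eq_mul, mul_one, exp_log hz']

/-- A discrete valuation ring is a maximal proper subring of its field of fractions. -/
theorem IsDiscreteValuationRing.eq_of_le {A V : Subring K} [IsDiscreteValuationRing A]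
    [IsFractionRing A K] (h : A ≤ V) (hV : V ≠ ⊤) : A = V := by
  refine le_antisymm h fun z hz => by_contra fun hzA => hV (eq_top_iff.2 fun y _ => ?_)
  have hz0 : z ≠ 0 := by
    rintro rfl
    exact hzA A.zero_mem
  obtain ⟨s, hs⟩ : ∃ s : A, (s : K) = z⁻¹ := by
    rcases ValuationRing.isInteger_or_isInteger A z with ⟨s, hs⟩ | ⟨s, hs⟩
    · exact absurd (hs ▸ s.2) hzA
    · exact ⟨s, hs⟩
  have hs0 : s ≠ 0 := by
    rintro rfl
    exact inv_ne_zero hz0 hs.symm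
  have hsu : ¬ IsUnit s := by
    rintro ⟨u, rfl⟩
    refine hzA ?_
    have : ((↑u⁻¹ : A) : K) = z := by
      have h1 : ((↑u : A) : K) * ((↑u⁻¹ : A) : K) = 1 := by
        rw [← Subring.coe_mul, Units.mul_inv, Subring.coe_one]
      rw [hs] at h1
      field_simp at h1
      exact h1
    exact this ▸ (↑u⁻¹ : A).2
  obtain ⟨ϖ, hϖ⟩ := IsDiscreteValuationRing.exists_irreducible A
  obtain ⟨a, b, hb, rfl⟩ := IsFractionRing.div_surjective (A := A) y
  obtain ⟨i, hi⟩ := IsDiscreteValuationRing.associated_pow_irreducible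
    (nonZeroDivisors.ne_zero hb) hϖ
  obtain ⟨j, hj⟩ := IsDiscreteValuationRing.associated_pow_irreducible hs0 hϖ
  have hj0 : j ≠ 0 := by
    rintro rfl
    rw [pow_zero, associated_one_iff_isUnit] at hj
    exact hsu hj
  have hdvd : b ∣ s ^ i := by
    refine hi.dvd.trans (Dvd.dvd.trans ?_ (hj.symm.pow_pow (n := i)).dvd)
    rw [← pow_mul]
    exact pow_dvd_pow _ (Nat.le_mul_of_pos_left _ (Nat.pos_of_ne_zero hj0))
  obtain ⟨c, hc⟩ := hdvd
  have hb0 : (b : K) ≠ 0 := fun h => nonZeroDivisors.ne_zero hb (Subtype.ext h)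
  have hy : (a : K) / b = a * c * z ^ i := by
    have hc' := congrArg (fun x : A => (x : K)) hc
    simp only [Subring.coe_pow, Subring.coe_mul, hs] at hc'
    rw [inv_pow, inv_eq_iff_eq_inv] at hc'
    rw [hc', div_eq_iff hb0]
    have hc0 : (c : K) ≠ 0 := by
      rintro h
      rw [h, mul_zero, inv_zero] at hc'
      exact pow_ne_zero _ hz0 hc'
    field_simp
  change (a : K) / b ∈ V
  rw [hy]
  exact V.mul_mem (V.mul_mem (h a.2) (h c.2)) (V.pow_mem hz i)

theorem LocalSubring.mem_ofPrime_iff {B : Subring K} {P : Ideal B} [P.IsPrime] {z : K} :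
    z ∈ (LocalSubring.ofPrime B P).toSubring ↔ ∃ g h : B, h ∉ P ∧ z = g / h := by
  constructor
  · intro hz
    obtain ⟨g, h, e⟩ := IsLocalization.exists_mk'_eq P.primeCompl
      (⟨z, hz⟩ : (LocalSubring.ofPrime B P).toSubring)
    refine ⟨g, h, h.2, ?_⟩
    have h0 : ((h : B) : K) ≠ 0 := fun h0 => h.2 ((Subtype.ext h0 : (h : B) = 0) ▸ P.zero_mem)
    rw [eq_div_iff h0]
    have := IsLocalization.mk'_spec (LocalSubring.ofPrime B P).toSubring g h
    rw [e] at this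
    exact congrArg Subtype.val this
  · rintro ⟨g, h, hh, rfl⟩
    have h0 : (h : K) ≠ 0 := fun h0 => hh ((Subtype.ext h0 : h = 0) ▸ P.zero_mem)
    have := IsLocalization.mk'_spec (LocalSubring.ofPrime B P).toSubring g
      (⟨h, hh⟩ : P.primeCompl)
    have e : ((IsLocalization.mk' (LocalSubring.ofPrime B P).toSubring g
        (⟨h, hh⟩ : P.primeCompl) : (LocalSubring.ofPrime B P).toSubring) : K) * h = g :=
      congrArg Subtype.val this
    rw [← e, mul_div_cancel_right₀ _ h0]
    exact Subtype.prop _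

/-- A subring `B` of a valuation ring whose elements are all quotients `g / h` with `g, h ∈ B` and
`h` of value `1`, localizes to the valuation ring. -/
theorem LocalSubring.exists_ofPrime_eq_integer {B : Subring K} (hB : B ≤ w.integer)
    (h : ∀ z, w z ≤ 1 → ∃ g ∈ B, ∃ h ∈ B, w h = 1 ∧ z = g / h) :
    ∃ (P : Ideal B) (_ : P.IsPrime), (LocalSubring.ofPrime B P).toSubring = w.integer := by
  let P : Ideal B :=
    { carrier := {b | w b < 1}
      zero_mem' := by simp
      add_mem' := fun ha hb => Valuation.map_add_lt w ha hb
      smul_mem' := fun c x hx => by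
        change w ((c : K) * x) < 1
        rw [map_mul]
        exact mul_lt_one_of_nonneg_of_lt_one_right (hB c.2) zero_le hx }
  have hP : P.IsPrime := by
    refine ⟨fun h1 => ?_, fun {x y} hxy => ?_⟩
    · have : w ((1 : B) : K) < 1 := (Ideal.eq_top_iff_one P).1 h1
      simp at this
    · change w ((x : K) * y) < 1 at hxy
      change w x < 1 ∨ w y < 1
      by_contra! hc
      have hx : w x = 1 := le_antisymm (hB x.2) hc.1
      have hy : w y = 1 := le_antisymm (hB y.2) hc.2
      rw [map_mul, hx, hy, mul_one] at hxy
      exact lt_irrefl _ hxy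
  refine ⟨P, hP, le_antisymm (fun z hz => ?_) fun z hz => ?_⟩
  · obtain ⟨g, b, hb, rfl⟩ := mem_ofPrime_iff.1 hz
    have hb1 : w b = 1 := le_antisymm (hB b.2) (not_lt.1 hb)
    change w _ ≤ 1
    rw [map_div₀, hb1, div_one]
    exact hB g.2
  · obtain ⟨g, hg, b, hb, hb1, rfl⟩ := h z hz
    exact mem_ofPrime_iff.2 ⟨⟨g, hg⟩, ⟨b, hb⟩, fun h' => (ne_of_lt h') hb1, rfl⟩

theorem LocalSubring.mem_maximalIdeal_iff_inv_notMem (A : LocalSubring K) (x : A.toSubring) :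
    x ∈ IsLocalRing.maximalIdeal A.toSubring ↔ (x : K) = 0 ∨ (x : K)⁻¹ ∉ A.toSubring := by
  rw [IsLocalRing.mem_maximalIdeal, mem_nonunits_iff, ← not_iff_not, not_not, not_or, not_not]
  constructor
  · rintro ⟨u, rfl⟩
    have h1 : ((↑u : A.toSubring) : K) * ((↑u⁻¹ : A.toSubring) : K) = 1 := by
      rw [← Subring.coe_mul, Units.mul_inv, Subring.coe_one]
    refine ⟨left_ne_zero_of_mul (h1 ▸ one_ne_zero), ?_⟩
    rw [inv_eq_of_mul_eq_one_right h1]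
    exact Subtype.prop _
  · rintro ⟨h0, h1⟩
    exact IsUnit.of_mul_eq_one ⟨_, h1⟩ (Subtype.ext (mul_inv_cancel₀ h0))

theorem LocalSubring.mem_maximalIdeal_iff_of_eq_integer {A : LocalSubring K}
    (hA : A.toSubring = w.integer) (x : A.toSubring) :
    x ∈ IsLocalRing.maximalIdeal A.toSubring ↔ w x < 1 := by
  have hx : (x : K)⁻¹ ∈ A.toSubring ↔ (w x)⁻¹ ≤ 1 := by
    have h := SetLike.ext_iff.1 hA (x : K)⁻¹
    rwa [Valuation.mem_integer_iff, map_inv₀] at h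
  rw [mem_maximalIdeal_iff_inv_notMem, hx, not_le]
  by_cases h : (x : K) = 0
  · simp [h]
  · simp only [h, false_or]
    exact one_lt_inv₀ (zero_lt_iff.2 ((map_ne_zero w).2 h))

theorem Valuation.integer_ne_top {t : K} (ht : w t = exp (-1)) : w.integer ≠ ⊤ := by
  intro h
  have h1 : t⁻¹ ∈ w.integer := h ▸ Subring.mem_top _
  rw [Valuation.mem_integer_iff, map_inv₀, ht, ← exp_neg, ← exp_zero, exp_le_exp] at h1
  norm_num at h1

end

end

namespace BlowupProd

open Projectivization WithZero
open scoped LinearAlgebra.Projectivization TensorProduct WithZero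

noncomputable section

/-! ### Rational functions as quotients of bihomogeneous polynomials -/

/-- The ring of polynomials in the homogeneous coordinates. -/
abbrev CoordRing (k : Type*) [Field k] (n m : ℕ) : Type _ :=
  MvPolynomial (Fin (n + 1) ⊕ Fin (m + 1)) k

/-- Setting `x_a = y_b = 1`. On polynomials of bidegree `d` this is division by
`x_a ^ d.1 * y_b ^ d.2`. -/
def dehom (k : Type*) [Field k] (n m : ℕ) (a : Fin (n + 1)) (b : Fin (m + 1)) :
    CoordRing k n m →ₐ[k] FunField k n m :=
  MvPolynomial.aeval (Sum.elim (fun i => xRatio k n m i a) (fun j => yRatio k n m j b))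

section
variable {k : Type*} [Field k] {n m : ℕ}

theorem dehom_x (a : Fin (n + 1)) (b : Fin (m + 1)) (i : Fin (n + 1)) :
    dehom k n m a b (MvPolynomial.X (Sum.inl i)) = xRatio k n m i a := by
  simp [dehom]

theorem dehom_y (a : Fin (n + 1)) (b : Fin (m + 1)) (j : Fin (m + 1)) :
    dehom k n m a b (MvPolynomial.X (Sum.inr j)) = yRatio k n m j b := by
  simp [dehom]

theorem xCoord_ne_zero (i : Fin (n + 1)) : xCoord k n m i ≠ 0 := by simp [xCoord]

theorem yCoord_ne_zero (j : Fin (m + 1)) : yCoord k n m j ≠ 0 := by simp [yCoord]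

theorem FunField.val_injective : Function.Injective (FunField.val k n m) :=
  (FunField.val k n m).toRingHom.injective

theorem xRatio_self (a : Fin (n + 1)) : xRatio k n m a a = 1 :=
  Subtype.ext (div_self (xCoord_ne_zero a))

theorem yRatio_self (b : Fin (m + 1)) : yRatio k n m b b = 1 :=
  Subtype.ext (div_self (yCoord_ne_zero b))

theorem val_dehom_mul {F : CoordRing k n m} {d : ℕ × ℕ} (hF : IsBihom F d) (a : Fin (n + 1))
    (b : Fin (m + 1)) :
    FunField.val k n m (dehom k n m a b F) * (xCoord k n m a ^ d.1 * yCoord k n m b ^ d.2) =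
      algebraMap _ (CoordField k n m) F := by
  have h1 : FunField.val k n m (dehom k n m a b F) = MvPolynomial.aeval (Sum.elim
      (fun i => xCoord k n m i / xCoord k n m a) (fun j => yCoord k n m j / yCoord k n m b)) F := by
    rw [dehom, ← AlgHom.comp_apply, MvPolynomial.comp_aeval]
    congr 2
    ext (i | j) <;> rfl
  have h2 : algebraMap _ (CoordField k n m) F = MvPolynomial.aeval
      (fun s => algebraMap _ (CoordField k n m) (MvPolynomial.X s : CoordRing k n m)) F :=
    DFunLike.congr_fun (MvPolynomial.aeval_unique
      (IsScalarTower.toAlgHom k (CoordRing k n m) (CoordField k n m))) F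
  rw [h1, h2, mul_comm, ← hF.aeval_scale]
  congr 2
  ext (i | j)
  · exact mul_div_cancel₀ _ (xCoord_ne_zero a)
  · exact mul_div_cancel₀ _ (yCoord_ne_zero b)

theorem dehom_ne_zero {F : CoordRing k n m} {d : ℕ × ℕ} (hF : IsBihom F d) (h0 : F ≠ 0)
    (a : Fin (n + 1)) (b : Fin (m + 1)) : dehom k n m a b F ≠ 0 := by
  intro h
  have := val_dehom_mul hF a b
  rw [h, map_zero, zero_mul] at this
  exact h0 (IsFractionRing.injective (CoordRing k n m) (CoordField k n m)
    (by rw [← this, map_zero]))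

theorem dehom_mem_baseChart (a : Fin (n + 1)) (b : Fin (m + 1)) (F : CoordRing k n m) :
    dehom k n m a b F ∈ baseChart k n m a b := by
  induction F using MvPolynomial.induction_on with
  | C c =>
    rw [← MvPolynomial.algebraMap_eq, AlgHom.commutes]
    exact Subalgebra.algebraMap_mem _ _
  | add p q hp hq => rw [map_add]; exact add_mem hp hq
  | mul_X p s hp =>
    rw [map_mul]
    refine mul_mem hp ?_
    rcases s with i | j
    · rw [dehom_x]; exact xRatio_mem i a b
    · rw [dehom_y]; exact yRatio_mem a j b

theorem isBihom_C (c : k) : IsBihom (MvPolynomial.C c : CoordRing k n m) 0 :=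
  MvPolynomial.isWeightedHomogeneous_C _ _

theorem isBihom_monomial (a : Fin (n + 1)) (b : Fin (m + 1)) (d : ℕ × ℕ) :
    IsBihom (MvPolynomial.X (Sum.inl a) ^ d.1 * MvPolynomial.X (Sum.inr b) ^ d.2 :
      CoordRing k n m) d := by
  have := ((isBihom_x (k := k) (n := n) (m := m) a).pow d.1).mul ((isBihom_y b).pow d.2)
  simpa using this

theorem dehom_monomial (a : Fin (n + 1)) (b : Fin (m + 1)) (d : ℕ × ℕ) :
    dehom k n m a b (MvPolynomial.X (Sum.inl a) ^ d.1 * MvPolynomial.X (Sum.inr b) ^ d.2) = 1 := by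
  rw [map_mul, map_pow, map_pow, dehom_x, dehom_y, xRatio_self, yRatio_self]
  simp

/-- Every function on a chart of `ℙⁿ × ℙᵐ` is a dehomogenized bihomogeneous polynomial. -/
theorem exists_dehom_eq {a : Fin (n + 1)} {b : Fin (m + 1)} {g : FunField k n m}
    (hg : g ∈ baseChart k n m a b) :
    ∃ (d : ℕ × ℕ) (G : CoordRing k n m), IsBihom G d ∧ dehom k n m a b G = g := by
  induction hg using Algebra.adjoin_induction with
  | mem g hg =>
    rcases hg with ⟨i, rfl⟩ | ⟨j, rfl⟩
    · exact ⟨_, _, isBihom_x i, dehom_x a b i⟩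
    · exact ⟨_, _, isBihom_y j, dehom_y a b j⟩
  | algebraMap c => exact ⟨_, _, isBihom_C c, (dehom k n m a b).commutes c⟩
  | add g h _ _ hg hh =>
    obtain ⟨d, G, hG, rfl⟩ := hg
    obtain ⟨e, H, hH, rfl⟩ := hh
    refine ⟨d + e, G * (MvPolynomial.X (Sum.inl a) ^ e.1 * MvPolynomial.X (Sum.inr b) ^ e.2) +
      H * (MvPolynomial.X (Sum.inl a) ^ d.1 * MvPolynomial.X (Sum.inr b) ^ d.2),
      (hG.mul (isBihom_monomial a b e)).add ?_, ?_⟩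
    · rw [add_comm d e]
      exact hH.mul (isBihom_monomial a b d)
    · rw [map_add, map_mul, map_mul _ H, dehom_monomial, dehom_monomial, mul_one, mul_one]
  | mul g h _ _ hg hh =>
    obtain ⟨d, G, hG, rfl⟩ := hg
    obtain ⟨e, H, hH, rfl⟩ := hh
    exact ⟨d + e, G * H, hG.mul hH, map_mul _ _ _⟩

/-- Every rational function on `ℙⁿ × ℙᵐ` is a quotient of two bihomogeneous polynomials of the same
bidegree. -/
theorem exists_isBihom_fraction (z : FunField k n m) : ∃ (d : ℕ × ℕ) (G H : CoordRing k n m),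
    IsBihom G d ∧ IsBihom H d ∧ H ≠ 0 ∧
      FunField.val k n m z * algebraMap _ _ H = algebraMap _ (CoordField k n m) G := by
  have inj := IsFractionRing.injective (CoordRing k n m) (CoordField k n m)
  suffices h : ∀ z ∈ IntermediateField.adjoin k (ratios k n m),
      ∃ (d : ℕ × ℕ) (G H : CoordRing k n m), IsBihom G d ∧ IsBihom H d ∧ H ≠ 0 ∧
        z * algebraMap _ _ H = algebraMap _ (CoordField k n m) G from h _ z.2
  intro z hz
  induction hz using IntermediateField.adjoin_induction with
  | mem z hz =>
    rcases hz with ⟨⟨i, a⟩, rfl⟩ | ⟨⟨i, a⟩, rfl⟩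
    · exact ⟨_, _, _, isBihom_x i, isBihom_x a, MvPolynomial.X_ne_zero _,
        div_mul_cancel₀ _ (xCoord_ne_zero a)⟩
    · exact ⟨_, _, _, isBihom_y i, isBihom_y a, MvPolynomial.X_ne_zero _,
        div_mul_cancel₀ _ (yCoord_ne_zero a)⟩
  | algebraMap c =>
    refine ⟨0, MvPolynomial.C c, MvPolynomial.C 1, isBihom_C c, isBihom_C 1, by simp, ?_⟩
    rw [MvPolynomial.C_1, map_one, mul_one, ← MvPolynomial.algebraMap_eq,
      ← IsScalarTower.algebraMap_apply]
  | add z z' _ _ hz hz' =>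
    obtain ⟨d, G, H, hG, hH, h0, e⟩ := hz
    obtain ⟨d', G', H', hG', hH', h0', e'⟩ := hz'
    refine ⟨d + d', G * H' + H * G', H * H', (hG.mul hH').add (hH.mul hG'), hH.mul hH',
      mul_ne_zero h0 h0', ?_⟩
    rw [map_add, map_mul, map_mul, map_mul, ← e, ← e']
    ring
  | mul z z' _ _ hz hz' =>
    obtain ⟨d, G, H, hG, hH, h0, e⟩ := hz
    obtain ⟨d', G', H', hG', hH', h0', e'⟩ := hz'
    refine ⟨d + d', G * G', H * H', hG.mul hG', hH.mul hH', mul_ne_zero h0 h0', ?_⟩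
    rw [map_mul, map_mul, ← e, ← e']
    ring
  | inv z _ hz =>
    obtain ⟨d, G, H, hG, hH, h0, e⟩ := hz
    by_cases hz0 : z = 0
    · exact ⟨d, 0, H, MvPolynomial.isWeightedHomogeneous_zero _ _ _, hH, h0, by simp [hz0]⟩
    · refine ⟨d, H, G, hH, hG, ?_, ?_⟩
      · rintro rfl
        rw [map_zero, mul_eq_zero, map_eq_zero_iff _ inj] at e
        exact e.elim hz0 h0
      · rw [← e, inv_mul_cancel_left₀ hz0]

theorem eq_dehom_div {z : FunField k n m} {d : ℕ × ℕ} {G H : CoordRing k n m} (hG : IsBihom G d)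
    (hH : IsBihom H d) (h0 : H ≠ 0)
    (e : FunField.val k n m z * algebraMap _ _ H = algebraMap _ (CoordField k n m) G)
    (a : Fin (n + 1)) (b : Fin (m + 1)) : z = dehom k n m a b G / dehom k n m a b H := by
  rw [eq_div_iff (dehom_ne_zero hH h0 a b)]
  apply FunField.val_injective
  rw [← val_dehom_mul hH a b, ← val_dehom_mul hG a b, ← mul_assoc] at e
  rw [map_mul]
  exact mul_right_cancel₀ (mul_ne_zero (pow_ne_zero _ (xCoord_ne_zero a))
    (pow_ne_zero _ (yCoord_ne_zero b))) e

/-- Every rational function is a quotient of two coprime bihomogeneous polynomials of the same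
bidegree. -/
theorem exists_isRelPrime_fraction (z : FunField k n m) :
    ∃ (d : ℕ × ℕ) (G H : CoordRing k n m), IsBihom G d ∧ IsBihom H d ∧ H ≠ 0 ∧ IsRelPrime G H ∧
      FunField.val k n m z * algebraMap _ _ H = algebraMap _ (CoordField k n m) G := by
  have inj := IsFractionRing.injective (CoordRing k n m) (CoordField k n m)
  by_cases hz : z = 0
  · exact ⟨0, 0, 1, MvPolynomial.isWeightedHomogeneous_zero _ _ _,
      MvPolynomial.isWeightedHomogeneous_one _ _, one_ne_zero, isRelPrime_one_right, by simp [hz]⟩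
  obtain ⟨d, G, H, hG, hH, h0, e⟩ := exists_isBihom_fraction z
  have hG0 : G ≠ 0 := by
    rintro rfl
    rw [map_zero, mul_eq_zero, map_eq_zero_iff _ inj, map_eq_zero_iff _ FunField.val_injective] at e
    exact e.elim hz h0
  obtain ⟨G', H', c, hrel, rfl, rfl⟩ := UniqueFactorizationMonoid.exists_reduced_factors' G H h0
  obtain ⟨e₁, e₂, he₁, he₂, h⟩ := hG.of_mul hG0
  obtain ⟨e₁', e₂', he₁', he₂', h'⟩ := hH.of_mul h0
  have hc := left_ne_zero_of_mul h0
  obtain rfl : e₁ = e₁' := he₁.inj_right hc he₁'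
  obtain rfl : e₂ = e₂' := add_left_cancel (h.trans h'.symm)
  refine ⟨e₂, G', H', he₂, he₂', right_ne_zero_of_mul h0, hrel, ?_⟩
  rw [map_mul, map_mul, mul_left_comm] at e
  exact mul_left_cancel₀ ((map_ne_zero_iff _ inj).2 hc) e

end

/-! ### Valuations of the function field defined by valuations of the coordinate ring -/

/-- A discrete valuation of the coordinate ring `k[x, y]`, with trivial kernel and nonnegative
orders, whose centre defines a subvariety of `ℙⁿ × ℙᵐ` (not all the `x_i` and not all the `y_j`
have positive order), and whose restriction to the function field of `ℙⁿ × ℙᵐ` is normalized. The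
value group is written multiplicatively: an element of order `r` has the value `exp (-r)`. -/
structure FormVal (k : Type*) [Field k] (n m : ℕ) where
  toVal : Valuation (CoordRing k n m) ℤᵐ⁰
  eq_zero : ∀ F, toVal F = 0 → F = 0
  le_one : ∀ F, toVal F ≤ 1
  exists_x : ∃ i, toVal (MvPolynomial.X (Sum.inl i)) = 1
  exists_y : ∃ j, toVal (MvPolynomial.X (Sum.inr j)) = 1
  exists_uniformizer : ∃ (d : ℕ × ℕ) (G H : CoordRing k n m), IsBihom G d ∧ IsBihom H d ∧
    toVal G = exp (-1) ∧ toVal H = 1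

section
variable {k : Type*} [Field k] {n m : ℕ}

/-- The extension of a valuation of the coordinate ring to its field of fractions. -/
def FormVal.fracVal (v : FormVal k n m) : Valuation (CoordField k n m) ℤᵐ⁰ :=
  v.toVal.extendToLocalization (S := nonZeroDivisors (CoordRing k n m))
    (fun _ hx h => nonZeroDivisors.ne_zero hx (v.eq_zero _ h)) _

/-- The restriction of the valuation to the function field of `ℙⁿ × ℙᵐ`. -/
def FormVal.res (v : FormVal k n m) : Valuation (FunField k n m) ℤᵐ⁰ :=
  v.fracVal.comap (FunField.val k n m).toRingHom

theorem FormVal.fracVal_algebraMap (v : FormVal k n m) (F : CoordRing k n m) :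
    v.fracVal (algebraMap _ _ F) = v.toVal F :=
  Valuation.extendToLocalization_apply_map_apply _ _ _ _

theorem FormVal.res_mul (v : FormVal k n m) {z : FunField k n m} {G H : CoordRing k n m}
    (e : FunField.val k n m z * algebraMap _ _ H = algebraMap _ (CoordField k n m) G) :
    v.res z * v.toVal H = v.toVal G := by
  rw [← v.fracVal_algebraMap, ← v.fracVal_algebraMap, ← e, map_mul]
  rfl

/-- The chart `x_a ≠ 0`, `y_b ≠ 0` meets the centre of the valuation. -/
def FormVal.InChart (v : FormVal k n m) (a : Fin (n + 1)) (b : Fin (m + 1)) : Prop :=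
  v.toVal (MvPolynomial.X (Sum.inl a)) = 1 ∧ v.toVal (MvPolynomial.X (Sum.inr b)) = 1

theorem FormVal.exists_inChart (v : FormVal k n m) : ∃ a b, v.InChart a b := by
  obtain ⟨a, ha⟩ := v.exists_x
  obtain ⟨b, hb⟩ := v.exists_y
  exact ⟨a, b, ha, hb⟩

/-- In a chart which meets the centre, passing to affine coordinates does not change the order. -/
theorem FormVal.res_dehom (v : FormVal k n m) {a : Fin (n + 1)} {b : Fin (m + 1)}
    (h : v.InChart a b) {F : CoordRing k n m} {d : ℕ × ℕ} (hF : IsBihom F d) :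
    v.res (dehom k n m a b F) = v.toVal F := by
  have e := val_dehom_mul hF a b
  rw [xCoord, yCoord, ← map_pow, ← map_pow, ← map_mul] at e
  have := v.res_mul e
  rwa [map_mul, map_pow, map_pow, h.1, h.2, one_pow, one_pow, mul_one, mul_one] at this

theorem FormVal.baseChart_le (v : FormVal k n m) {a : Fin (n + 1)} {b : Fin (m + 1)}
    (h : v.InChart a b) : (baseChart k n m a b).toSubring ≤ v.res.integer := by
  intro g hg
  obtain ⟨d, G, hG, rfl⟩ := exists_dehom_eq hg
  rw [Valuation.mem_integer_iff, v.res_dehom h hG]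
  exact v.le_one G

theorem FormVal.inChart_of_le (v : FormVal k n m) {a : Fin (n + 1)} {b : Fin (m + 1)}
    (h : (baseChart k n m a b).toSubring ≤ v.res.integer) : v.InChart a b := by
  obtain ⟨i, hi⟩ := v.exists_x
  obtain ⟨j, hj⟩ := v.exists_y
  have h1 : v.res (xRatio k n m i a) ≤ 1 := h (xRatio_mem i a b)
  have h2 : v.res (yRatio k n m j b) ≤ 1 := h (yRatio_mem a j b)
  have e1 := v.res_mul (z := xRatio k n m i a) (H := MvPolynomial.X (Sum.inl a))
    (G := MvPolynomial.X (Sum.inl i)) (div_mul_cancel₀ _ (xCoord_ne_zero a))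
  have e2 := v.res_mul (z := yRatio k n m j b) (H := MvPolynomial.X (Sum.inr b))
    (G := MvPolynomial.X (Sum.inr j)) (div_mul_cancel₀ _ (yCoord_ne_zero b))
  rw [hi] at e1
  rw [hj] at e2
  constructor
  · refine le_antisymm (v.le_one _) ?_
    rw [← e1]
    exact mul_le_of_le_one_left' h1
  · refine le_antisymm (v.le_one _) ?_
    rw [← e2]
    exact mul_le_of_le_one_left' h2

theorem FormVal.exists_res_eq (v : FormVal k n m) : ∃ t, v.res t = exp (-1) := by
  obtain ⟨d, G, H, hG, hH, h1, h2⟩ := v.exists_uniformizer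
  obtain ⟨a, b, hab⟩ := v.exists_inChart
  refine ⟨dehom k n m a b G / dehom k n m a b H, ?_⟩
  rw [map_div₀, v.res_dehom hab hG, v.res_dehom hab hH, h1, h2, div_one]

end
end
end BlowupProd

namespace BlowupProd

open Projectivization WithZero
open scoped LinearAlgebra.Projectivization TensorProduct WithZero

noncomputable section

section
variable {k : Type*} [Field k] {n m : ℕ}

/-! ### The valuation of an irreducible bihomogeneous polynomial -/

theorem exists_not_dvd_X {σ : Type*} {F : MvPolynomial σ k} (hF : Irreducible F)
    {i j : σ} (hij : i ≠ j) : ¬ F ∣ MvPolynomial.X i ∨ ¬ F ∣ MvPolynomial.X j := by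
  by_contra! h
  have hX := (MvPolynomial.X_prime (R := k) (i := i)).irreducible
  exact hij (MvPolynomial.X_dvd_X.1 ((hF.associated_of_dvd hX h.1).symm.dvd.trans h.2))

/-- The order of vanishing along the hypersurface defined by an irreducible bihomogeneous
polynomial. The conditions on `n` and `m` exclude that this hypersurface is empty. -/
def primeForm (hn : 1 ≤ n) (hm : 1 ≤ m) {F : CoordRing k n m} (hF : Irreducible F) {d : ℕ × ℕ}
    (hd : IsBihom F d) : FormVal k n m where
  toVal := primeVal hF.prime
  eq_zero _ := primeVal_eq_zero hF.prime
  le_one := primeVal_le_one hF.prime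
  exists_x := by
    have h : (Sum.inl 0 : Fin (n + 1) ⊕ Fin (m + 1)) ≠ Sum.inl ⟨1, by omega⟩ := by
      simp [Fin.ext_iff]
    exact (exists_not_dvd_X hF h).elim (fun h => ⟨_, (primeVal_eq_one_iff _).2 h⟩)
      (fun h => ⟨_, (primeVal_eq_one_iff _).2 h⟩)
  exists_y := by
    have h : (Sum.inr 0 : Fin (n + 1) ⊕ Fin (m + 1)) ≠ Sum.inr ⟨1, by omega⟩ := by
      simp [Fin.ext_iff]
    exact (exists_not_dvd_X hF h).elim (fun h => ⟨_, (primeVal_eq_one_iff _).2 h⟩)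
      (fun h => ⟨_, (primeVal_eq_one_iff _).2 h⟩)
  exists_uniformizer := by
    obtain ⟨a, ha⟩ : ∃ a : Fin (n + 1), ¬ F ∣ MvPolynomial.X (Sum.inl a) := by
      have h : (Sum.inl 0 : Fin (n + 1) ⊕ Fin (m + 1)) ≠ Sum.inl ⟨1, by omega⟩ := by
        simp [Fin.ext_iff]
      exact (exists_not_dvd_X hF h).elim (fun h => ⟨_, h⟩) (fun h => ⟨_, h⟩)
    obtain ⟨b, hb⟩ : ∃ b : Fin (m + 1), ¬ F ∣ MvPolynomial.X (Sum.inr b) := by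
      have h : (Sum.inr 0 : Fin (n + 1) ⊕ Fin (m + 1)) ≠ Sum.inr ⟨1, by omega⟩ := by
        simp [Fin.ext_iff]
      exact (exists_not_dvd_X hF h).elim (fun h => ⟨_, h⟩) (fun h => ⟨_, h⟩)
    refine ⟨d, F, _, hd, isBihom_monomial a b d, ?_, ?_⟩
    · rw [primeVal_of_ne_zero _ hF.ne_zero, multiplicity_self, Nat.cast_one]
    · rw [map_mul, map_pow, map_pow, (primeVal_eq_one_iff _).2 ha, (primeVal_eq_one_iff _).2 hb]
      simp

theorem primeForm_toVal (hn : 1 ≤ n) (hm : 1 ≤ m) {F : CoordRing k n m} (hF : Irreducible F)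
    {d : ℕ × ℕ} (hd : IsBihom F d) : (primeForm hn hm hF hd).toVal = primeVal hF.prime :=
  rfl

theorem primeForm_lt_one_iff (hn : 1 ≤ n) (hm : 1 ≤ m) {F : CoordRing k n m} (hF : Irreducible F)
    {d : ℕ × ℕ} (hd : IsBihom F d) {G : CoordRing k n m} :
    (primeForm hn hm hF hd).toVal G < 1 ↔ F ∣ G :=
  primeVal_lt_one_iff hF.prime

theorem primeForm_eq_one_iff (hn : 1 ≤ n) (hm : 1 ≤ m) {F : CoordRing k n m} (hF : Irreducible F)
    {d : ℕ × ℕ} (hd : IsBihom F d) {G : CoordRing k n m} :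
    (primeForm hn hm hF hd).toVal G = 1 ↔ ¬ F ∣ G :=
  primeVal_eq_one_iff hF.prime

/-! ### The multiplicity at a point -/

/-- Homogeneous coordinates of a point of `ℙⁿ × ℙᵐ`. -/
def Pt.coords (q : Pt k n m) : Fin (n + 1) ⊕ Fin (m + 1) → k :=
  Sum.elim q.1.rep q.2.rep

/-- The substitution `x ↦ u + x T`, where `u` is a vector of homogeneous coordinates of the point
`q`. The multiplicity of a polynomial at `q` is the order in `T` of the result. -/
def taylor (q : Pt k n m) : CoordRing k n m →ₐ[k] Polynomial (CoordRing k n m) :=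
  MvPolynomial.aeval fun s => Polynomial.C (MvPolynomial.C (Pt.coords q s)) +
    Polynomial.C (MvPolynomial.X s) * Polynomial.X

theorem taylor_X (q : Pt k n m) (s : Fin (n + 1) ⊕ Fin (m + 1)) :
    taylor q (MvPolynomial.X s) = Polynomial.C (MvPolynomial.C (Pt.coords q s)) +
      Polynomial.C (MvPolynomial.X s) * Polynomial.X := by
  simp [taylor]

/-- Substituting `T = τ` in `taylor q F` gives the value of `F` at `u + τ x`. -/
theorem eval₂_taylor (q : Pt k n m) {A : Type*} [CommRing A] [Algebra k A]
    (z : Fin (n + 1) ⊕ Fin (m + 1) → A) (τ : A) (F : CoordRing k n m) :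
    (taylor q F).eval₂ (MvPolynomial.aeval z).toRingHom τ =
      MvPolynomial.aeval (fun s => algebraMap k A (Pt.coords q s) + z s * τ) F := by
  induction F using MvPolynomial.induction_on with
  | C c =>
    rw [← MvPolynomial.algebraMap_eq, AlgHom.commutes, AlgHom.commutes, Polynomial.algebraMap_apply,
      Polynomial.eval₂_C]
    exact AlgHom.commutes _ _
  | add p r hp hr => rw [map_add, map_add, Polynomial.eval₂_add, hp, hr]
  | mul_X p s hp =>
    rw [map_mul, map_mul, Polynomial.eval₂_mul, hp, taylor_X]
    simp [← MvPolynomial.algebraMap_eq]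

/-- Setting `T = 1` in `taylor q F` gives the value of `F` at `u + x`. -/
theorem aeval_eval_taylor (q : Pt k n m) {A : Type*} [CommRing A] [Algebra k A]
    (g : Fin (n + 1) ⊕ Fin (m + 1) → A) (F : CoordRing k n m) :
    MvPolynomial.aeval g ((taylor q F).eval 1) =
      MvPolynomial.aeval (fun s => algebraMap k A (Pt.coords q s) + g s) F := by
  have h := eval₂_taylor q g 1 F
  rw [Polynomial.eval₂_at_one] at h
  simp only [mul_one] at h
  exact h

/-- The substitution `x ↦ x - u` followed by `T = 1` is a left inverse of `taylor q`. -/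
theorem taylor_injective (q : Pt k n m) : Function.Injective (taylor q) := by
  intro F G h
  have key (F : CoordRing k n m) : MvPolynomial.aeval (fun s => MvPolynomial.X s -
      MvPolynomial.C (Pt.coords q s) : _ → CoordRing k n m) ((taylor q F).eval 1) = F := by
    rw [aeval_eval_taylor]
    simp [MvPolynomial.algebraMap_eq]
  rw [← key F, h, key]

theorem exists_coords_x_ne_zero (q : Pt k n m) : ∃ i, Pt.coords q (Sum.inl i) ≠ 0 :=
  Function.ne_iff.1 q.1.rep_nonzero

theorem exists_coords_y_ne_zero (q : Pt k n m) : ∃ j, Pt.coords q (Sum.inr j) ≠ 0 :=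
  Function.ne_iff.1 q.2.rep_nonzero

theorem X_dvd_taylor_X_iff (q : Pt k n m) (s : Fin (n + 1) ⊕ Fin (m + 1)) :
    Polynomial.X ∣ taylor q (MvPolynomial.X s) ↔ Pt.coords q s = 0 := by
  rw [Polynomial.X_dvd_iff, taylor_X]
  simp

theorem primeVal_taylor_X_eq_one_iff (q : Pt k n m) (s : Fin (n + 1) ⊕ Fin (m + 1)) :
    (primeVal (Polynomial.prime_X (R := CoordRing k n m))) (taylor q (MvPolynomial.X s)) = 1 ↔
      Pt.coords q s ≠ 0 := by
  rw [primeVal_eq_one_iff, X_dvd_taylor_X_iff]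

/-- The multiplicity at a point `q`, as a valuation. It is normalized by a linear form in the `x`
which vanishes at `q`, and which exists as `1 ≤ n`. -/
def pointForm (hn : 1 ≤ n) (q : Pt k n m) : FormVal k n m where
  toVal := (primeVal (Polynomial.prime_X (R := CoordRing k n m))).comap (taylor q).toRingHom
  eq_zero F h := taylor_injective q (by
    rw [map_zero]
    exact primeVal_eq_zero Polynomial.prime_X h)
  le_one F := primeVal_le_one Polynomial.prime_X _
  exists_x := by
    obtain ⟨i, hi⟩ := exists_coords_x_ne_zero q
    exact ⟨i, (primeVal_taylor_X_eq_one_iff q _).2 hi⟩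
  exists_y := by
    obtain ⟨j, hj⟩ := exists_coords_y_ne_zero q
    exact ⟨j, (primeVal_taylor_X_eq_one_iff q _).2 hj⟩
  exists_uniformizer := by
    obtain ⟨a, ha⟩ := exists_coords_x_ne_zero q
    obtain ⟨i, hi⟩ : ∃ i : Fin (n + 1), i ≠ a := by
      have : Nontrivial (Fin (n + 1)) := Fin.nontrivial_iff_two_le.2 (by omega)
      exact exists_ne a
    refine ⟨_, MvPolynomial.C (Pt.coords q (Sum.inl a)) * MvPolynomial.X (Sum.inl i) -
      MvPolynomial.C (Pt.coords q (Sum.inl i)) * MvPolynomial.X (Sum.inl a), _,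
      ((isBihom_x i).C_mul _).sub ((isBihom_x a).C_mul _), isBihom_x a, ?_,
      (primeVal_taylor_X_eq_one_iff q _).2 ha⟩
    set ℓ : CoordRing k n m := MvPolynomial.C (Pt.coords q (Sum.inl a)) *
      MvPolynomial.X (Sum.inl i) - MvPolynomial.C (Pt.coords q (Sum.inl i)) *
      MvPolynomial.X (Sum.inl a) with hℓ
    have hℓ0 : ℓ ≠ 0 := by
      intro h
      have := congrArg (MvPolynomial.eval (fun s => if s = Sum.inl i then (1 : k) else 0)) h
      simp [hℓ, hi.symm] at this
      exact ha this
    have e : taylor q ℓ = Polynomial.C ℓ * Polynomial.X := by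
      rw [hℓ, map_sub, map_mul, map_mul, taylor_X, taylor_X, ← MvPolynomial.algebraMap_eq,
        AlgHom.commutes, AlgHom.commutes, Polynomial.algebraMap_apply, Polynomial.algebraMap_apply,
        map_sub, map_mul, map_mul]
      ring
    change primeVal Polynomial.prime_X (taylor q ℓ) = _
    have h1 : primeVal Polynomial.prime_X (Polynomial.C ℓ) = 1 := by
      rw [primeVal_eq_one_iff, Polynomial.X_dvd_iff, Polynomial.coeff_C_zero]
      exact hℓ0
    rw [e, map_mul, h1, one_mul, primeVal_of_ne_zero _ Polynomial.X_ne_zero, multiplicity_self,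
      Nat.cast_one]

theorem pointForm_toVal_apply (hn : 1 ≤ n) (q : Pt k n m) (F : CoordRing k n m) :
    (pointForm hn q).toVal F =
      primeVal (Polynomial.prime_X (R := CoordRing k n m)) (taylor q F) :=
  rfl

theorem pointForm_inChart_iff (hn : 1 ≤ n) (q : Pt k n m) {a : Fin (n + 1)} {b : Fin (m + 1)} :
    (pointForm hn q).InChart a b ↔ InChart q a b :=
  and_congr (primeVal_taylor_X_eq_one_iff q _) (primeVal_taylor_X_eq_one_iff q _)

theorem pointForm_le_iff (hn : 1 ≤ n) (q : Pt k n m) {F : CoordRing k n m} {r : ℕ} :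
    (pointForm hn q).toVal F ≤ exp (-(r : ℤ)) ↔ Polynomial.X ^ r ∣ taylor q F :=
  primeVal_le_iff Polynomial.prime_X

/-- A polynomial of multiplicity at least `r` at a point lies in the `r`-th power of the ideal
of the point: `taylor q F` lies in the Rees algebra of the ideal of the origin. -/
theorem eval_taylor_mem (q : Pt k n m) {F : CoordRing k n m} {r : ℕ}
    (h : Polynomial.X ^ r ∣ taylor q F) :
    (taylor q F).eval 1 ∈ Ideal.span (Set.range (MvPolynomial.X (R := k))) ^ r := by
  set I := Ideal.span (Set.range (MvPolynomial.X (R := k) (σ := Fin (n + 1) ⊕ Fin (m + 1))))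
  have hrees (F : CoordRing k n m) : taylor q F ∈ reesAlgebra I := by
    induction F using MvPolynomial.induction_on with
    | C c =>
      rw [← MvPolynomial.algebraMap_eq, AlgHom.commutes, Polynomial.algebraMap_apply]
      exact Subalgebra.algebraMap_mem (reesAlgebra I) _
    | add p r hp hr => rw [map_add]; exact add_mem hp hr
    | mul_X p s hp =>
      rw [map_mul, taylor_X]
      refine mul_mem hp (add_mem (Subalgebra.algebraMap_mem (reesAlgebra I) _) ?_)
      rw [Polynomial.C_mul_X_eq_monomial]
      exact reesAlgebra.monomial_mem.2 (by
        rw [pow_one]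
        exact Ideal.subset_span ⟨s, rfl⟩)
  rw [Polynomial.eval_eq_sum, Polynomial.sum]
  refine Ideal.sum_mem _ fun i hi => ?_
  rw [one_pow, mul_one]
  refine Ideal.pow_le_pow_right ?_ (hrees F i)
  by_contra hlt
  exact Polynomial.mem_support_iff.1 hi (Polynomial.X_pow_dvd_iff.1 h i (not_le.1 hlt))

/-- Membership in a power of the maximal ideal of a point is detected by the multiplicity. -/
theorem mem_pointIdeal_pow (hn : 1 ≤ n) {q : Pt k n m} {a : Fin (n + 1)} {b : Fin (m + 1)}
    (hq : InChart q a b) {g : baseChart k n m a b} {r : ℕ}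
    (h : (pointForm hn q).res g ≤ exp (-(r : ℤ))) : g ∈ pointIdeal q a b ^ r := by
  obtain ⟨g, hg⟩ := g
  obtain ⟨d, G, hG, rfl⟩ := exists_dehom_eq hg
  change (pointForm hn q).res (dehom k n m a b G) ≤ _ at h
  rw [(pointForm hn q).res_dehom ((pointForm_inChart_iff hn q).2 hq) hG, pointForm_le_iff] at h
  let ρ : Fin (n + 1) ⊕ Fin (m + 1) → baseChart k n m a b :=
    Sum.elim (fun i => ⟨xRatio k n m i a, xRatio_mem i a b⟩)
      (fun j => ⟨yRatio k n m j b, yRatio_mem a j b⟩)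
  let c : Fin (n + 1) ⊕ Fin (m + 1) → baseChart k n m a b :=
    Sum.elim (fun _ => algebraMap k _ (q.1.rep a)) (fun _ => algebraMap k _ (q.2.rep b))
  let ξ : Fin (n + 1) ⊕ Fin (m + 1) → baseChart k n m a b := fun s =>
    c s * ρ s - algebraMap k _ (Pt.coords q s)
  have hξ (s) : ξ s ∈ pointIdeal q a b := by
    rcases s with i | j
    · have e : ξ (Sum.inl i) = algebraMap k _ (q.1.rep a) *
          (⟨xRatio k n m i a, xRatio_mem i a b⟩ - algebraMap k _ (q.1.rep i / q.1.rep a)) := by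
        rw [mul_sub, ← map_mul, mul_div_cancel₀ _ hq.1]
        rfl
      rw [e]
      exact Ideal.mul_mem_left _ _ (Ideal.subset_span (Or.inl ⟨i, rfl⟩))
    · have e : ξ (Sum.inr j) = algebraMap k _ (q.2.rep b) *
          (⟨yRatio k n m j b, yRatio_mem a j b⟩ - algebraMap k _ (q.2.rep j / q.2.rep b)) := by
        rw [mul_sub, ← map_mul, mul_div_cancel₀ _ hq.2]
        rfl
      rw [e]
      exact Ideal.mul_mem_left _ _ (Ideal.subset_span (Or.inr ⟨j, rfl⟩))
  have h1 : MvPolynomial.aeval ξ ((taylor q G).eval 1) ∈ pointIdeal q a b ^ r := by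
    have := Ideal.mem_map_of_mem (MvPolynomial.aeval (R := k) ξ) (eval_taylor_mem q h)
    rw [Ideal.map_pow] at this
    refine Ideal.pow_right_mono ?_ r this
    rw [Ideal.map_span, Ideal.span_le]
    rintro _ ⟨_, ⟨s, rfl⟩, rfl⟩
    rw [MvPolynomial.aeval_X]
    exact hξ s
  have h2 : MvPolynomial.aeval ξ ((taylor q G).eval 1) =
      algebraMap k _ (q.1.rep a ^ d.1 * q.2.rep b ^ d.2) * MvPolynomial.aeval ρ G := by
    rw [aeval_eval_taylor, map_mul, map_pow, map_pow, ← hG.aeval_scale]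
    congr 2
    ext1 s
    exact add_sub_cancel _ _
  have h3 : (⟨dehom k n m a b G, hg⟩ : baseChart k n m a b) = MvPolynomial.aeval ρ G := by
    apply Subtype.ext
    change _ = (baseChart k n m a b).val _
    rw [← AlgHom.comp_apply, MvPolynomial.comp_aeval]
    refine congrArg (fun f => MvPolynomial.aeval f G) (funext ?_)
    rintro (i | j) <;> rfl
  rw [h3]
  rw [h2] at h1
  have hc : q.1.rep a ^ d.1 * q.2.rep b ^ d.2 ≠ 0 :=
    mul_ne_zero (pow_ne_zero _ hq.1) (pow_ne_zero _ hq.2)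
  have := Ideal.mul_mem_left _ (algebraMap k _ (q.1.rep a ^ d.1 * q.2.rep b ^ d.2)⁻¹) h1
  rwa [← mul_assoc, ← map_mul, inv_mul_cancel₀ hc, map_one, one_mul] at this

end
end
end BlowupProd

open WithZero
open scoped WithZero

/-! ### Nonunits of a local subring -/

section
variable {K : Type*} [Field K]

/-- The elements of the maximal ideal of a local subring, as elements of the field. -/
def LocalSubring.IsNonunit (A : LocalSubring K) (z : K) : Prop :=
  ∃ h : z ∈ A.toSubring, (⟨z, h⟩ : A.toSubring) ∈ IsLocalRing.maximalIdeal A.toSubring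

variable {A : LocalSubring K} {x y : K}

theorem LocalSubring.IsNonunit.add (hx : A.IsNonunit x) (hy : A.IsNonunit y) :
    A.IsNonunit (x + y) :=
  ⟨add_mem hx.1 hy.1, Ideal.add_mem _ hx.2 hy.2⟩

theorem LocalSubring.IsNonunit.mul_left (hx : A.IsNonunit x) (hy : y ∈ A.toSubring) :
    A.IsNonunit (y * x) :=
  ⟨mul_mem hy hx.1, Ideal.mul_mem_left _ ⟨y, hy⟩ hx.2⟩

theorem LocalSubring.IsNonunit.inv_notMem (hx : A.IsNonunit x) (h0 : x ≠ 0) :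
    x⁻¹ ∉ A.toSubring := by
  have := (A.mem_maximalIdeal_iff_inv_notMem _).1 hx.2
  exact this.resolve_left h0

theorem LocalSubring.not_isNonunit_of_inv_mem (h0 : x ≠ 0) (h : x⁻¹ ∈ A.toSubring) :
    ¬ A.IsNonunit x :=
  fun hx => hx.inv_notMem h0 h

theorem LocalSubring.inv_mem_of_not_isNonunit (hx : x ∈ A.toSubring) (h : ¬ A.IsNonunit x) :
    x ≠ 0 ∧ x⁻¹ ∈ A.toSubring := by
  by_contra hc
  refine h ⟨hx, (A.mem_maximalIdeal_iff_inv_notMem _).2 ?_⟩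
  tauto

theorem LocalSubring.not_isNonunit_one : ¬ A.IsNonunit 1 :=
  not_isNonunit_of_inv_mem one_ne_zero (by rw [inv_one]; exact one_mem _)

theorem LocalSubring.not_isNonunit_mul (hx : x ∈ A.toSubring) (hy : y ∈ A.toSubring)
    (hx' : ¬ A.IsNonunit x) (hy' : ¬ A.IsNonunit y) : ¬ A.IsNonunit (x * y) := by
  obtain ⟨hx0, hxi⟩ := inv_mem_of_not_isNonunit hx hx'
  obtain ⟨hy0, hyi⟩ := inv_mem_of_not_isNonunit hy hy'
  exact not_isNonunit_of_inv_mem (mul_ne_zero hx0 hy0) (mul_inv x y ▸ mul_mem hxi hyi)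

end

namespace BlowupProd

open Projectivization
open scoped LinearAlgebra.Projectivization TensorProduct

noncomputable section

section
variable {k : Type*} [Field k] {n m s : ℕ} {p : Fin s → Pt k n m}

/-! ### The affine charts of the blow-up -/

theorem PrimeDivisor.ext_of_toSubring {Y Y' : PrimeDivisor p}
    (h : Y.localRing.toSubring = Y'.localRing.toSubring) : Y = Y' := by
  cases Y
  cases Y'
  obtain rfl := LocalSubring.toSubring_injective h
  rfl

theorem mem_centerIdeal {a : Fin (n + 1)} {b : Fin (m + 1)} {g : baseChart k n m a b} :
    g ∈ centerIdeal p a b ↔ ∀ i, InChart (p i) a b → g ∈ pointIdeal (p i) a b := by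
  simp only [centerIdeal, Submodule.mem_iInf]

theorem baseChart_le_blowupChart {a : Fin (n + 1)} {b : Fin (m + 1)} (f : baseChart k n m a b) :
    baseChart k n m a b ≤ blowupChart p a b f :=
  fun _ hz => Algebra.subset_adjoin (Or.inl hz)

theorem div_pow_mem_blowupChart {a : Fin (n + 1)} {b : Fin (m + 1)} {f : baseChart k n m a b}
    {r : ℕ} {g : baseChart k n m a b} (hg : g ∈ centerIdeal p a b ^ r) :
    (g : FunField k n m) / (f : FunField k n m) ^ r ∈ blowupChart p a b f := by
  induction r generalizing g with
  | zero =>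
    rw [pow_zero, div_one]
    exact baseChart_le_blowupChart f g.2
  | succ r ih =>
    rw [pow_succ] at hg
    refine Submodule.mul_induction_on hg (fun x hx y hy => ?_) (fun x y hx hy => ?_)
    · rw [pow_succ, Subalgebra.coe_mul, mul_div_mul_comm]
      exact mul_mem (ih hx) (Algebra.subset_adjoin (Or.inr ⟨y, hy, rfl⟩))
    · rw [Subalgebra.coe_add, add_div]
      exact add_mem hx hy

/-- Every element of `R[I/f]` is of the form `r / f ^ N` with `r ∈ I ^ N`. -/
theorem exists_mul_pow_eq {a : Fin (n + 1)} {b : Fin (m + 1)} {f : baseChart k n m a b}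
    (hf : f ∈ centerIdeal p a b) (hf0 : f ≠ 0) {z : FunField k n m}
    (hz : z ∈ blowupChart p a b f) :
    ∃ N, ∃ r ∈ centerIdeal p a b ^ N, z * (f : FunField k n m) ^ N = r := by
  have hf0' : (f : FunField k n m) ≠ 0 := fun h => hf0 (Subtype.ext h)
  induction hz using Algebra.adjoin_induction with
  | mem z hz =>
    rcases hz with hz | ⟨g, hg, rfl⟩
    · exact ⟨0, ⟨z, hz⟩, by simp, by simp⟩
    · exact ⟨1, g, by simpa using hg, by rw [pow_one, div_mul_cancel₀ _ hf0']⟩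
  | algebraMap c => exact ⟨0, algebraMap k _ c, by simp, by simp⟩
  | add x y _ _ hx hy =>
    obtain ⟨N, r, hr, e⟩ := hx
    obtain ⟨N', r', hr', e'⟩ := hy
    refine ⟨N + N', r * f ^ N' + r' * f ^ N, add_mem ?_ ?_, ?_⟩
    · rw [pow_add]
      exact Ideal.mul_mem_mul hr (Ideal.pow_mem_pow hf _)
    · rw [add_comm, pow_add]
      exact Ideal.mul_mem_mul hr' (Ideal.pow_mem_pow hf _)
    · rw [Subalgebra.coe_add, Subalgebra.coe_mul, Subalgebra.coe_mul, ← e, ← e',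
        SubmonoidClass.coe_pow, SubmonoidClass.coe_pow]
      ring
  | mul x y _ _ hx hy =>
    obtain ⟨N, r, hr, e⟩ := hx
    obtain ⟨N', r', hr', e'⟩ := hy
    refine ⟨N + N', r * r', ?_, ?_⟩
    · rw [pow_add]
      exact Ideal.mul_mem_mul hr hr'
    · rw [Subalgebra.coe_mul, ← e, ← e']
      ring

theorem blowupChart_le_integer {v : FormVal k n m} {a : Fin (n + 1)} {b : Fin (m + 1)}
    (hab : v.InChart a b) {f : baseChart k n m a b} (hf0 : f ≠ 0)
    (hI : ∀ g ∈ centerIdeal p a b, v.res g ≤ v.res f) :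
    (blowupChart p a b f).toSubring ≤ v.res.integer := by
  have hf0' : (f : FunField k n m) ≠ 0 := fun h => hf0 (Subtype.ext h)
  intro z hz
  have hz' : z ∈ blowupChart p a b f := hz
  induction hz' using Algebra.adjoin_induction with
  | mem z hzz =>
    rcases hzz with hzz | ⟨g, hg, rfl⟩
    · exact v.baseChart_le hab hzz
    · rw [Valuation.mem_integer_iff, map_div₀]
      exact (div_le_one₀ (zero_lt_iff.2 ((map_ne_zero _).2 hf0'))).2 (hI g hg)
  | algebraMap c => exact v.baseChart_le hab (Subalgebra.algebraMap_mem _ c)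
  | add x y hx hy ihx ihy => exact add_mem (ihx hx) (ihy hy)
  | mul x y hx hy ihx ihy => exact mul_mem (ihx hx) (ihy hy)

/-- A valuation ring which is a localization of a chart of the blow-up is a prime divisor. -/
theorem exists_primeDivisor {v : FormVal k n m} {a : Fin (n + 1)} {b : Fin (m + 1)}
    (hab : v.InChart a b) {f : baseChart k n m a b} (hf : f ∈ centerIdeal p a b) (hf0 : f ≠ 0)
    (hI : ∀ g ∈ centerIdeal p a b, v.res g ≤ v.res f)
    (h : ∀ z, v.res z ≤ 1 → ∃ x ∈ blowupChart p a b f, ∃ y ∈ blowupChart p a b f,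
      v.res y = 1 ∧ z = x / y) :
    ∃ Y : PrimeDivisor p, Y.localRing.toSubring = v.res.integer := by
  obtain ⟨P, hP, e⟩ := LocalSubring.exists_ofPrime_eq_integer (blowupChart_le_integer hab hf0 hI) h
  obtain ⟨t, ht⟩ := v.exists_res_eq
  refine ⟨⟨_, ⟨a, b, f, hf, hf0, P, hP, rfl⟩, ?_⟩, e⟩
  rw [e]
  exact Valuation.isDiscreteValuationRing_integer ht

/-! ### The strict transforms of hypersurfaces -/

theorem isUnit_of_isBihom_zero {F : CoordRing k n m} (hF : IsBihom F 0) (h0 : F ≠ 0) :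
    IsUnit F := by
  have hC : F = MvPolynomial.C (MvPolynomial.coeff 0 F) := by
    ext c
    rw [MvPolynomial.coeff_C]
    split_ifs with h
    · rw [← h]
    · by_contra hc
      have hw := hF hc
      rw [weight_biweight, Prod.mk_eq_zero, Finset.sum_eq_zero_iff, Finset.sum_eq_zero_iff] at hw
      refine h (Finsupp.ext fun s => ?_)
      rcases s with i | j
      · exact (hw.1 i (Finset.mem_univ _)).symm
      · exact (hw.2 j (Finset.mem_univ _)).symm
  rw [hC]
  refine (isUnit_iff_ne_zero.2 fun h => h0 ?_).map MvPolynomial.C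
  rw [hC, h, map_zero]

/-- Some function which vanishes at `q` does not vanish on the hypersurface of `F`: a linear form in
the `x_i` and one in the `y_j` have no common factor. -/
theorem exists_mem_pointIdeal_res_eq_one (hn : 1 ≤ n) (hm : 1 ≤ m) {F : CoordRing k n m}
    (hF : Irreducible F) {d : ℕ × ℕ} (hd : IsBihom F d) {a : Fin (n + 1)} {b : Fin (m + 1)}
    (hab : (primeForm hn hm hF hd).InChart a b) (q : Pt k n m) :
    ∃ g ∈ pointIdeal q a b, (primeForm hn hm hF hd).res g = 1 := by
  have : Nontrivial (Fin (n + 1)) := Fin.nontrivial_iff_two_le.2 (by omega)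
  have : Nontrivial (Fin (m + 1)) := Fin.nontrivial_iff_two_le.2 (by omega)
  obtain ⟨i, hi⟩ := exists_ne a
  obtain ⟨j, hj⟩ := exists_ne b
  set ℓ : CoordRing k n m := MvPolynomial.X (Sum.inl i) -
    MvPolynomial.C (q.1.rep i / q.1.rep a) * MvPolynomial.X (Sum.inl a) with hℓ
  set ℓ' : CoordRing k n m := MvPolynomial.X (Sum.inr j) -
    MvPolynomial.C (q.2.rep j / q.2.rep b) * MvPolynomial.X (Sum.inr b) with hℓ'
  have hb : IsBihom ℓ (1, 0) := (isBihom_x i).sub ((isBihom_x a).C_mul _)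
  have hb' : IsBihom ℓ' (0, 1) := (isBihom_y j).sub ((isBihom_y b).C_mul _)
  have h0 : ℓ ≠ 0 := by
    intro h
    have := congrArg (MvPolynomial.eval (fun s => if s = Sum.inl i then (1 : k) else 0)) h
    simp [hℓ, hi.symm] at this
  have h0' : ℓ' ≠ 0 := by
    intro h
    have := congrArg (MvPolynomial.eval (fun s => if s = Sum.inr j then (1 : k) else 0)) h
    simp [hℓ', hj.symm] at this
  by_cases h1 : F ∣ ℓ
  · by_cases h2 : F ∣ ℓ'
    · exfalso
      obtain ⟨H, e⟩ := h1
      obtain ⟨H', e'⟩ := h2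
      rw [e] at hb h0
      rw [e'] at hb' h0'
      obtain ⟨d₁, d₂, hd₁, -, hsum⟩ := hb.of_mul h0
      obtain ⟨d₁', d₂', hd₁', -, hsum'⟩ := hb'.of_mul h0'
      obtain rfl := hd.inj_right hF.ne_zero hd₁
      obtain rfl := hd.inj_right hF.ne_zero hd₁'
      refine hF.not_isUnit (isUnit_of_isBihom_zero ?_ hF.ne_zero)
      rw [Prod.ext_iff] at hsum hsum'
      have hd0 : d = 0 := by
        ext
        · have := hsum'.1
          simp only [Prod.fst_add] at this
          simp only [Prod.fst_zero]
          omega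
        · have := hsum.2
          simp only [Prod.snd_add] at this
          simp only [Prod.snd_zero]
          omega
      exact hd0 ▸ hd
    · refine ⟨_, Ideal.subset_span (Or.inr ⟨j, rfl⟩), ?_⟩
      have e : (((⟨yRatio k n m j b, yRatio_mem a j b⟩ : baseChart k n m a b) -
          algebraMap k _ (q.2.rep j / q.2.rep b) : baseChart k n m a b) : FunField k n m) =
          dehom k n m a b ℓ' := by
        rw [hℓ', map_sub, map_mul, dehom_y, dehom_y, yRatio_self, mul_one,
          ← MvPolynomial.algebraMap_eq, AlgHom.commutes]
        rfl
      rw [e, FormVal.res_dehom _ hab hb', primeForm_eq_one_iff]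
      exact h2
  · refine ⟨_, Ideal.subset_span (Or.inl ⟨i, rfl⟩), ?_⟩
    have e : (((⟨xRatio k n m i a, xRatio_mem i a b⟩ : baseChart k n m a b) -
        algebraMap k _ (q.1.rep i / q.1.rep a) : baseChart k n m a b) : FunField k n m) =
        dehom k n m a b ℓ := by
      rw [hℓ, map_sub, map_mul, dehom_x, dehom_x, xRatio_self, mul_one,
        ← MvPolynomial.algebraMap_eq, AlgHom.commutes]
      rfl
    rw [e, FormVal.res_dehom _ hab hb, primeForm_eq_one_iff]
    exact h1

theorem prod_mem_centerIdeal {a : Fin (n + 1)} {b : Fin (m + 1)}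
    {g : Fin s → baseChart k n m a b} (hg : ∀ i, g i ∈ pointIdeal (p i) a b) :
    ∏ i, g i ∈ centerIdeal p a b :=
  mem_centerIdeal.2 fun i _ =>
    Ideal.mem_of_dvd _ (Finset.dvd_prod_of_mem g (Finset.mem_univ i)) (hg i)

variable (p) in
/-- Every irreducible bihomogeneous polynomial defines a prime divisor of the blow-up. -/
theorem exists_primeDivisor_primeForm (hn : 1 ≤ n) (hm : 1 ≤ m) {F : CoordRing k n m}
    (hF : Irreducible F) {d : ℕ × ℕ} (hd : IsBihom F d) :
    ∃ Y : PrimeDivisor p, Y.localRing.toSubring = (primeForm hn hm hF hd).res.integer := by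
  set v := primeForm hn hm hF hd with hv
  obtain ⟨a, b, hab⟩ := v.exists_inChart
  choose g hg hg1 using fun i => exists_mem_pointIdeal_res_eq_one hn hm hF hd hab (p i)
  have hres : v.res (∏ i, g i : baseChart k n m a b) = 1 := by
    rw [SubmonoidClass.coe_finsetProd, map_prod]
    exact Finset.prod_eq_one fun i _ => hg1 i
  have hf0 : ∏ i, g i ≠ 0 := by
    intro h
    rw [h, ZeroMemClass.coe_zero, map_zero] at hres
    exact zero_ne_one hres
  refine exists_primeDivisor hab (prod_mem_centerIdeal hg) hf0
    (fun g _ => hres ▸ v.baseChart_le hab g.2) fun z hz => ?_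
  obtain ⟨e, G, H, hG, hH, h0, hrel, hz'⟩ := exists_isRelPrime_fraction z
  refine ⟨_, baseChart_le_blowupChart _ (dehom_mem_baseChart a b G), _,
    baseChart_le_blowupChart _ (dehom_mem_baseChart a b H), ?_, eq_dehom_div hG hH h0 hz' a b⟩
  rw [v.res_dehom hab hH]
  have e1 := v.res_mul hz'
  rw [hv, primeForm_eq_one_iff]
  intro hdvd
  have h1 : v.toVal H < 1 := (primeForm_lt_one_iff hn hm hF hd).2 hdvd
  have h2 : v.toVal G < 1 := e1 ▸ (mul_le_of_le_one_left' hz).trans_lt h1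
  exact hF.not_isUnit (hrel ((primeForm_lt_one_iff hn hm hF hd).1 h2) hdvd)

end
end
end BlowupProd

namespace BlowupProd

open Projectivization WithZero
open scoped LinearAlgebra.Projectivization TensorProduct WithZero

noncomputable section

section
variable {k : Type*} [Field k] {n m s : ℕ} {p : Fin s → Pt k n m}

/-! ### The exceptional divisors -/

theorem FormVal.res_algebraMap (v : FormVal k n m) {c : k} (hc : c ≠ 0) :
    v.res (algebraMap k _ c) = 1 := by
  obtain ⟨a, b, hab⟩ := v.exists_inChart
  have h (c : k) : v.res (algebraMap k _ c) ≤ 1 :=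
    v.baseChart_le hab (Subalgebra.algebraMap_mem _ c)
  refine le_antisymm (h c) ?_
  have h1 := h c⁻¹
  rw [map_inv₀, map_inv₀] at h1
  have h0 : v.res (algebraMap k _ c) ≠ 0 := by
    rw [map_ne_zero, map_ne_zero]
    exact hc
  exact (inv_le_one₀ (zero_lt_iff.2 h0)).1 h1

theorem res_lt_one_of_mem_pointIdeal (hn : 1 ≤ n) {q : Pt k n m} {a : Fin (n + 1)}
    {b : Fin (m + 1)} (hq : InChart q a b) {g : baseChart k n m a b} (hg : g ∈ pointIdeal q a b) :
    (pointForm hn q).res g < 1 := by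
  have hab := (pointForm_inChart_iff hn q).2 hq
  have key (s t : Fin (n + 1) ⊕ Fin (m + 1)) (ht : Pt.coords q t ≠ 0) :
      (pointForm hn q).toVal (MvPolynomial.X s - MvPolynomial.C (Pt.coords q s / Pt.coords q t) *
        MvPolynomial.X t) < 1 := by
    rw [pointForm_toVal_apply, primeVal_lt_one_iff, Polynomial.X_dvd_iff, map_sub, map_mul,
      taylor_X, taylor_X, ← MvPolynomial.algebraMap_eq, AlgHom.commutes]
    simp only [Polynomial.algebraMap_apply, Polynomial.coeff_sub,
      Polynomial.coeff_add, Polynomial.coeff_C_zero, Polynomial.mul_coeff_zero,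
      Polynomial.coeff_X_zero, mul_zero, add_zero]
    rw [← map_mul, div_mul_cancel₀ _ ht, sub_self]
  induction hg using Submodule.span_induction with
  | mem g hg =>
    rcases hg with ⟨i, rfl⟩ | ⟨j, rfl⟩
    · have h := key (Sum.inl i) (Sum.inl a) hq.1
      rw [← (pointForm hn q).res_dehom hab ((isBihom_x i).sub ((isBihom_x a).C_mul _)), map_sub,
        map_mul, dehom_x, dehom_x, xRatio_self, mul_one, ← MvPolynomial.algebraMap_eq,
        AlgHom.commutes] at h
      exact h
    · have h := key (Sum.inr j) (Sum.inr b) hq.2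
      rw [← (pointForm hn q).res_dehom hab ((isBihom_y j).sub ((isBihom_y b).C_mul _)), map_sub,
        map_mul, dehom_y, dehom_y, yRatio_self, mul_one, ← MvPolynomial.algebraMap_eq,
        AlgHom.commutes] at h
      exact h
  | zero => simp
  | add x y _ _ hx hy => exact Valuation.map_add_lt _ hx hy
  | smul c x _ hx =>
    rw [smul_eq_mul, Subalgebra.coe_mul, map_mul]
    exact mul_lt_one_of_nonneg_of_lt_one_right ((pointForm hn q).baseChart_le hab c.2) zero_le hx

theorem res_le_of_mem_pointIdeal (hn : 1 ≤ n) {q : Pt k n m} {a : Fin (n + 1)}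
    {b : Fin (m + 1)} (hq : InChart q a b) {g : baseChart k n m a b} (hg : g ∈ pointIdeal q a b) :
    (pointForm hn q).res g ≤ exp (-1) :=
  (WithZero.lt_one_iff_le_exp _).1 (res_lt_one_of_mem_pointIdeal hn hq hg)

theorem Pt.ext_of_ratios {q q' : Pt k n m} {a : Fin (n + 1)} {b : Fin (m + 1)}
    (hq : InChart q a b) (h1 : ∀ i, q.1.rep i / q.1.rep a = q'.1.rep i / q'.1.rep a)
    (h2 : ∀ j, q.2.rep j / q.2.rep b = q'.2.rep j / q'.2.rep b) : q = q' := by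
  refine Prod.ext ?_ ?_
  · rw [← q.1.mk_rep, ← q'.1.mk_rep, mk_eq_mk_iff']
    refine ⟨q.1.rep a / q'.1.rep a, funext fun i => ?_⟩
    have h := h1 i
    rw [div_eq_iff hq.1] at h
    rw [Pi.smul_apply, smul_eq_mul, h]
    ring
  · rw [← q.2.mk_rep, ← q'.2.mk_rep, mk_eq_mk_iff']
    refine ⟨q.2.rep b / q'.2.rep b, funext fun i => ?_⟩
    have h := h2 i
    rw [div_eq_iff hq.2] at h
    rw [Pi.smul_apply, smul_eq_mul, h]
    ring

/-- A function which vanishes at `q'` and takes a nonzero value `c` at `q`. -/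
theorem exists_separating {q q' : Pt k n m} (hne : q ≠ q') {a : Fin (n + 1)} {b : Fin (m + 1)}
    (hq : InChart q a b) :
    ∃ e ∈ pointIdeal q' a b, ∃ c : k, c ≠ 0 ∧ e - algebraMap k _ c ∈ pointIdeal q a b := by
  by_cases h1 : ∀ i, q.1.rep i / q.1.rep a = q'.1.rep i / q'.1.rep a
  · by_cases h2 : ∀ j, q.2.rep j / q.2.rep b = q'.2.rep j / q'.2.rep b
    · exact absurd (Pt.ext_of_ratios hq h1 h2) hne
    · push Not at h2
      obtain ⟨j, hj⟩ := h2
      refine ⟨_, Ideal.subset_span (Or.inr ⟨j, rfl⟩), _, sub_ne_zero.2 hj, ?_⟩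
      rw [map_sub, sub_sub, add_sub_cancel]
      exact Ideal.subset_span (Or.inr ⟨j, rfl⟩)
  · push Not at h1
    obtain ⟨j, hj⟩ := h1
    refine ⟨_, Ideal.subset_span (Or.inl ⟨j, rfl⟩), _, sub_ne_zero.2 hj, ?_⟩
    rw [map_sub, sub_sub, add_sub_cancel]
    exact Ideal.subset_span (Or.inl ⟨j, rfl⟩)

/-- A function which vanishes at all the centres but one of a chart, and not at that centre. It
makes the ideal of all the centres agree locally with that of a single one. -/
theorem exists_separating_all (hp : Function.Injective p) {i : Fin s} {a : Fin (n + 1)}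
    {b : Fin (m + 1)} (hi : InChart (p i) a b) :
    ∃ (e : baseChart k n m a b) (c : k), c ≠ 0 ∧ e - algebraMap k _ c ∈ pointIdeal (p i) a b ∧
      ∀ g ∈ pointIdeal (p i) a b, e * g ∈ centerIdeal p a b := by
  have h (j : Fin s) : ∃ (e : baseChart k n m a b) (c : k), c ≠ 0 ∧
      e - algebraMap k _ c ∈ pointIdeal (p i) a b ∧
      (j ≠ i → InChart (p j) a b → e ∈ pointIdeal (p j) a b) := by
    by_cases hj : j ≠ i ∧ InChart (p j) a b
    · obtain ⟨e, he, c, hc, hec⟩ := exists_separating (hp.ne hj.1.symm) hi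
      exact ⟨e, c, hc, hec, fun _ _ => he⟩
    · refine ⟨1, 1, one_ne_zero, by simp, fun h1 h2 => absurd ⟨h1, h2⟩ hj⟩
  choose e c hc hec he using h
  refine ⟨∏ j, e j, ∏ j, c j, Finset.prod_ne_zero_iff.2 fun j _ => hc j, ?_, fun g hg => ?_⟩
  · rw [← Ideal.Quotient.eq, map_prod, map_prod, map_prod]
    exact Finset.prod_congr rfl fun j _ => Ideal.Quotient.eq.2 (hec j)
  · refine mem_centerIdeal.2 fun j hj => ?_
    by_cases hji : j = i
    · rw [hji]
      exact Ideal.mul_mem_left _ _ hg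
    · exact Ideal.mul_mem_right _ _ (Ideal.mem_of_dvd _
        (Finset.dvd_prod_of_mem e (Finset.mem_univ j)) (he j hji hj))

theorem pow_mul_mem_pow {R : Type*} [CommRing R] {I J : Ideal R} {e : R}
    (h : ∀ g ∈ J, e * g ∈ I) {r : ℕ} {g : R} (hg : g ∈ J ^ r) : e ^ r * g ∈ I ^ r := by
  have hle : Ideal.span {e} * J ≤ I := by
    rw [Ideal.span_singleton_mul_le_iff]
    exact h
  refine Ideal.pow_right_mono hle r ?_
  rw [mul_pow, Ideal.span_singleton_pow]
  exact Ideal.mul_mem_mul (Ideal.mem_span_singleton_self _) hg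

theorem res_eq_one_of_sub_mem (hn : 1 ≤ n) {q : Pt k n m} {a : Fin (n + 1)}
    {b : Fin (m + 1)} (hq : InChart q a b) {e : baseChart k n m a b} {c : k} (hc : c ≠ 0)
    (h : e - algebraMap k _ c ∈ pointIdeal q a b) : (pointForm hn q).res e = 1 := by
  have h1 := res_lt_one_of_mem_pointIdeal hn hq h
  have h2 := (pointForm hn q).res_algebraMap hc
  have e1 : (e : FunField k n m) = algebraMap k _ c +
      ((e - algebraMap k _ c : baseChart k n m a b) : FunField k n m) :=
    (add_sub_cancel _ _).symm
  rw [e1, Valuation.map_add_eq_of_lt_left _ (h2.symm ▸ h1), h2]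

/-- The exceptional divisor over each centre exists: its order function is the multiplicity. -/
theorem exists_primeDivisor_pointForm (hn : 1 ≤ n) (hp : Function.Injective p) (i : Fin s) :
    ∃ Y : PrimeDivisor p, Y.localRing.toSubring = (pointForm hn (p i)).res.integer := by
  set v := pointForm hn (p i) with hv
  obtain ⟨a, b, hab⟩ := v.exists_inChart
  have hi : InChart (p i) a b := (pointForm_inChart_iff hn _).1 hab
  obtain ⟨e, c, hc, hec, he⟩ := exists_separating_all hp hi
  have he1 : v.res e = 1 := res_eq_one_of_sub_mem hn hi hc hec
  obtain ⟨d, G, -, hG, -, hG1, -⟩ := v.exists_uniformizer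
  obtain ⟨ξ, hξ1⟩ : ∃ ξ : baseChart k n m a b, v.res ξ = exp (-1) :=
    ⟨⟨_, dehom_mem_baseChart a b G⟩, (v.res_dehom hab hG).trans hG1⟩
  have hξ : ξ ∈ pointIdeal (p i) a b := by
    simpa using mem_pointIdeal_pow hn hi (r := 1) (g := ξ) (by simpa using hξ1.le)
  have hres : v.res (e * ξ : baseChart k n m a b) = exp (-1) := by
    rw [Subalgebra.coe_mul, map_mul, he1, hξ1, one_mul]
  have hf0 : e * ξ ≠ 0 := by
    intro h
    rw [h, ZeroMemClass.coe_zero, map_zero] at hres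
    exact exp_ne_zero hres.symm
  have hf0' : ((e * ξ : baseChart k n m a b) : FunField k n m) ≠ 0 :=
    fun h => hf0 (Subtype.ext h)
  refine exists_primeDivisor hab (he ξ hξ) hf0
    (fun g hg => hres ▸ res_le_of_mem_pointIdeal hn hi (mem_centerIdeal.1 hg i hi))
    fun z hz => ?_
  obtain ⟨d, G, H, hG, hH, h0, hz'⟩ := exists_isBihom_fraction z
  have hvH : v.toVal H ≠ 0 := fun h => h0 (v.eq_zero _ h)
  have hle : log (v.toVal H) ≤ 0 := by
    have := v.le_one H
    rwa [← exp_log hvH, ← exp_zero, exp_le_exp] at this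
  obtain ⟨r, hr⟩ := Int.eq_ofNat_of_zero_le (neg_nonneg.2 hle)
  have hvH' : v.toVal H = exp (-(r : ℤ)) := by
    rw [← exp_log hvH, exp_inj]
    omega
  have hvG : v.toVal G ≤ exp (-(r : ℤ)) := by
    rw [← v.res_mul hz', ← hvH']
    exact mul_le_of_le_one_left' hz
  have mem (F : CoordRing k n m) (hF : IsBihom F d) (hvF : v.toVal F ≤ exp (-(r : ℤ))) :
      (e : FunField k n m) ^ r * dehom k n m a b F /
        ((e * ξ : baseChart k n m a b) : FunField k n m) ^ r ∈ blowupChart p a b (e * ξ) := by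
    have h1 : (⟨_, dehom_mem_baseChart a b F⟩ : baseChart k n m a b) ∈ pointIdeal (p i) a b ^ r :=
      mem_pointIdeal_pow hn hi ((v.res_dehom hab hF).le.trans hvF)
    simpa using div_pow_mem_blowupChart (f := e * ξ) (pow_mul_mem_pow he h1)
  refine ⟨_, mem G hG hvG, _, mem H hH hvH'.le, ?_, ?_⟩
  · rw [map_div₀, map_mul, map_pow, map_pow, hres, he1, v.res_dehom hab hH, hvH', one_pow, one_mul,
      ← exp_nsmul, smul_neg, nsmul_one]
    exact div_self exp_ne_zero
  · rw [eq_dehom_div hG hH h0 hz' a b]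
    have he0 : (e : FunField k n m) ≠ 0 := fun h => by simp [h] at he1
    have hH0 := dehom_ne_zero hH h0 a b
    rw [div_div_div_cancel_right₀ (pow_ne_zero _ hf0'), mul_div_mul_left _ _ (pow_ne_zero _ he0)]

theorem liesOver_of_toSubring_eq (hn : 1 ≤ n) {i : Fin s} {Y : PrimeDivisor p}
    (hY : Y.localRing.toSubring = (pointForm hn (p i)).res.integer) : Y.LiesOver (p i) := by
  obtain ⟨a, b, hab⟩ := (pointForm hn (p i)).exists_inChart
  have hi : InChart (p i) a b := (pointForm_inChart_iff hn _).1 hab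
  refine ⟨a, b, hi, hY ▸ (pointForm hn (p i)).baseChart_le hab, fun g hg => ?_⟩
  rw [LocalSubring.mem_maximalIdeal_iff_of_eq_integer hY]
  exact res_lt_one_of_mem_pointIdeal hn hi hg

theorem isNonunit_of_mem_pointIdeal {A : LocalSubring (FunField k n m)} {q : Pt k n m}
    {a : Fin (n + 1)} {b : Fin (m + 1)} (hA : (baseChart k n m a b).toSubring ≤ A.toSubring)
    (hx : ∀ i, A.IsNonunit (xRatio k n m i a - algebraMap k _ (q.1.rep i / q.1.rep a)))
    (hy : ∀ j, A.IsNonunit (yRatio k n m j b - algebraMap k _ (q.2.rep j / q.2.rep b)))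
    {g : baseChart k n m a b} (hg : g ∈ pointIdeal q a b) : A.IsNonunit g := by
  induction hg using Submodule.span_induction with
  | mem g hg =>
    rcases hg with ⟨i, rfl⟩ | ⟨j, rfl⟩
    · exact hx i
    · exact hy j
  | zero => exact ⟨zero_mem _, Ideal.zero_mem _⟩
  | add x y _ _ hx hy => exact hx.add hy
  | smul c x _ hx => exact hx.mul_left (hA c.2)

theorem algebraMap_mem_of_baseChart_le {A : LocalSubring (FunField k n m)} {a : Fin (n + 1)}
    {b : Fin (m + 1)} (hA : (baseChart k n m a b).toSubring ≤ A.toSubring) (c : k) :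
    algebraMap k _ c ∈ A.toSubring :=
  hA (Subalgebra.algebraMap_mem _ c)

theorem not_isNonunit_of_sub_mem {A : LocalSubring (FunField k n m)} {q : Pt k n m}
    {a : Fin (n + 1)} {b : Fin (m + 1)} (hA : (baseChart k n m a b).toSubring ≤ A.toSubring)
    (hq : ∀ g ∈ pointIdeal q a b, A.IsNonunit g) {e : baseChart k n m a b} {c : k} (hc : c ≠ 0)
    (h : e - algebraMap k _ c ∈ pointIdeal q a b) : ¬ A.IsNonunit (e : FunField k n m) := by
  intro he
  have h1 := he.add ((hq _ h).mul_left (algebraMap_mem_of_baseChart_le hA (-1)))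
  have h2 := h1.mul_left (algebraMap_mem_of_baseChart_le hA c⁻¹)
  have hc' : algebraMap k (FunField k n m) c ≠ 0 := (map_ne_zero _).2 hc
  have e2 : algebraMap k (FunField k n m) c⁻¹ * (e + algebraMap k _ (-1) *
      ((e - algebraMap k _ c : baseChart k n m a b) : FunField k n m)) = 1 := by
    change algebraMap k (FunField k n m) c⁻¹ * (e + algebraMap k _ (-1) *
      ((e : FunField k n m) - algebraMap k _ c)) = 1
    rw [map_inv₀, map_neg, map_one]
    field_simp
    ring
  rw [e2] at h2
  exact LocalSubring.not_isNonunit_one h2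

/-- If a local ring dominates the local ring of a point, then every chart whose functions it
contains is a chart around that point. -/
theorem inChart_of_forall_isNonunit {A : LocalSubring (FunField k n m)} {q : Pt k n m}
    {a a' : Fin (n + 1)} {b b' : Fin (m + 1)} (h : ∀ g ∈ pointIdeal q a' b', A.IsNonunit g)
    (hA : (baseChart k n m a b).toSubring ≤ A.toSubring) :
    InChart q a b ∧ ∀ g ∈ pointIdeal q a b, A.IsNonunit g := by
  have halg := algebraMap_mem_of_baseChart_le hA
  have hx (i) : A.IsNonunit (xRatio k n m i a' - algebraMap k _ (q.1.rep i / q.1.rep a')) :=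
    h _ (Ideal.subset_span (Or.inl ⟨i, rfl⟩))
  have hy (j) : A.IsNonunit (yRatio k n m j b' - algebraMap k _ (q.2.rep j / q.2.rep b')) :=
    h _ (Ideal.subset_span (Or.inr ⟨j, rfl⟩))
  have ex (i) : xRatio k n m i a' * xRatio k n m a' a = xRatio k n m i a :=
    Subtype.ext (div_mul_div_cancel₀ (xCoord_ne_zero a'))
  have ey (j) : yRatio k n m j b' * yRatio k n m b' b = yRatio k n m j b :=
    Subtype.ext (div_mul_div_cancel₀ (yCoord_ne_zero b'))
  have exa := (ex a).trans (xRatio_self a)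
  have eyb := (ey b).trans (yRatio_self b)
  have hxa : ¬ A.IsNonunit (xRatio k n m a a') := LocalSubring.not_isNonunit_of_inv_mem
    (left_ne_zero_of_mul (exa ▸ one_ne_zero))
    (by rw [inv_eq_of_mul_eq_one_right exa]; exact hA (xRatio_mem a' a b))
  have hyb : ¬ A.IsNonunit (yRatio k n m b b') := LocalSubring.not_isNonunit_of_inv_mem
    (left_ne_zero_of_mul (eyb ▸ one_ne_zero))
    (by rw [inv_eq_of_mul_eq_one_right eyb]; exact hA (yRatio_mem a b' b))
  have hqa : q.1.rep a ≠ 0 := by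
    intro h0
    have := hx a
    rw [h0, zero_div, map_zero, sub_zero] at this
    exact hxa this
  have hqb : q.2.rep b ≠ 0 := by
    intro h0
    have := hy b
    rw [h0, zero_div, map_zero, sub_zero] at this
    exact hyb this
  refine ⟨⟨hqa, hqb⟩, fun g hg => isNonunit_of_mem_pointIdeal hA (fun i => ?_) (fun j => ?_) hg⟩
  · have h1 := ((hx i).add ((hx a).mul_left (halg (-(q.1.rep i / q.1.rep a))))).mul_left
      (hA (xRatio_mem a' a b))
    convert h1 using 1
    have e1 : algebraMap k (FunField k n m) (q.1.rep i / q.1.rep a') =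
        algebraMap k _ (q.1.rep i / q.1.rep a) * algebraMap k _ (q.1.rep a / q.1.rep a') := by
      rw [← map_mul, div_mul_div_cancel₀ hqa]
    rw [e1, ← ex i, map_neg]
    linear_combination algebraMap k (FunField k n m) (q.1.rep i / q.1.rep a) * exa
  · have h1 := ((hy j).add ((hy b).mul_left (halg (-(q.2.rep j / q.2.rep b))))).mul_left
      (hA (yRatio_mem a b' b))
    convert h1 using 1
    have e1 : algebraMap k (FunField k n m) (q.2.rep j / q.2.rep b') =
        algebraMap k _ (q.2.rep j / q.2.rep b) * algebraMap k _ (q.2.rep b / q.2.rep b') := by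
      rw [← map_mul, div_mul_div_cancel₀ hqb]
    rw [e1, ← ey j, map_neg]
    linear_combination algebraMap k (FunField k n m) (q.2.rep j / q.2.rep b) * eyb

theorem PrimeDivisor.LiesOver.isNonunit {Y : PrimeDivisor p} {q : Pt k n m} (h : Y.LiesOver q)
    {a : Fin (n + 1)} {b : Fin (m + 1)}
    (hA : (baseChart k n m a b).toSubring ≤ Y.localRing.toSubring) :
    InChart q a b ∧ ∀ g ∈ pointIdeal q a b, Y.localRing.IsNonunit g := by
  obtain ⟨a', b', -, hle, hnu⟩ := h
  exact inChart_of_forall_isNonunit (fun g hg => ⟨_, hnu g hg⟩) hA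

/-- There is only one exceptional divisor over each centre: a discrete valuation ring of the blow-up
which dominates the local ring of `p i` is contained in the valuation ring of the multiplicity. -/
theorem toSubring_eq_of_liesOver (hn : 1 ≤ n) (hp : Function.Injective p) {i : Fin s}
    {Y : PrimeDivisor p} (hY : Y.LiesOver (p i)) :
    Y.localRing.toSubring = (pointForm hn (p i)).res.integer := by
  have := Y.isDVR
  have := isFractionRing_of_mem Y.mem
  set v := pointForm hn (p i) with hv
  obtain ⟨t, ht⟩ := v.exists_res_eq
  refine IsDiscreteValuationRing.eq_of_le ?_ (Valuation.integer_ne_top ht)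
  obtain ⟨a, b, f, hf, hf0, P, hP, hA⟩ := Y.mem
  have hB : (blowupChart p a b f).toSubring ≤ Y.localRing.toSubring :=
    hA ▸ LocalSubring.le_ofPrime _ P
  have hR : (baseChart k n m a b).toSubring ≤ Y.localRing.toSubring :=
    fun z hz => hB (baseChart_le_blowupChart f hz)
  obtain ⟨hi, hnu⟩ := hY.isNonunit hR
  have hab : v.InChart a b := (pointForm_inChart_iff hn _).2 hi
  have hf0' : (f : FunField k n m) ≠ 0 := fun h => hf0 (Subtype.ext h)
  obtain ⟨e, c, hc, hec, he⟩ := exists_separating_all hp hi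
  have heA := not_isNonunit_of_sub_mem hR hnu hc hec
  obtain ⟨he0, hei⟩ := LocalSubring.inv_mem_of_not_isNonunit (hR e.2) heA
  have hfA := hnu f (mem_centerIdeal.1 hf i hi)
  -- a function of multiplicity at least `r` is divisible by `f ^ r` in the local ring
  have key (r : ℕ) (x : baseChart k n m a b) (hx : v.res x ≤ exp (-(r : ℤ))) :
      (x : FunField k n m) / (f : FunField k n m) ^ r ∈ Y.localRing.toSubring := by
    have h1 := div_pow_mem_blowupChart (f := f) (pow_mul_mem_pow he (mem_pointIdeal_pow hn hi hx))
    have h2 := mul_mem (pow_mem hei r) (hB h1)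
    have e2 : (e : FunField k n m)⁻¹ ^ r * (((e ^ r * x : baseChart k n m a b) : FunField k n m) /
        (f : FunField k n m) ^ r) = x / (f : FunField k n m) ^ r := by
      rw [Subalgebra.coe_mul, SubmonoidClass.coe_pow, inv_pow, mul_div_assoc,
        inv_mul_cancel_left₀ (pow_ne_zero _ he0)]
    rwa [e2] at h2
  -- if `f` had multiplicity two, it would be divisible by its square, and so a unit
  have hresf : v.res f = exp (-1) := by
    refine le_antisymm (res_le_of_mem_pointIdeal hn hi (mem_centerIdeal.1 hf i hi)) ?_
    by_contra! hlt
    have hle : v.res f ≤ exp (-((2 : ℕ) : ℤ)) := by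
      have h0 : v.res f ≠ 0 := (map_ne_zero _).2 hf0'
      rw [← exp_log h0, exp_lt_exp] at hlt
      rw [← exp_log h0, exp_le_exp]
      push_cast
      omega
    have h1 := key 2 f hle
    have h2 : (f : FunField k n m) / (f : FunField k n m) ^ 2 = (f : FunField k n m)⁻¹ := by
      field_simp
    exact hfA.inv_notMem hf0' (h2 ▸ h1)
  have hI : ∀ g ∈ centerIdeal p a b, v.res g ≤ v.res f := fun g hg =>
    hresf ▸ res_le_of_mem_pointIdeal hn hi (mem_centerIdeal.1 hg i hi)
  have hBV := blowupChart_le_integer hab hf0 hI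
  intro z hz
  rw [hA] at hz
  obtain ⟨x, y, hy, rfl⟩ := LocalSubring.mem_ofPrime_iff.1 hz
  suffices hy1 : v.res y = 1 by
    rw [Valuation.mem_integer_iff, map_div₀, hy1, div_one]
    exact hBV x.2
  refine le_antisymm (hBV y.2) ?_
  by_contra! hlt
  have hy0 : (y : FunField k n m) ≠ 0 := fun h => hy ((Subtype.ext h : y = 0) ▸ P.zero_mem)
  have hyi : (y : FunField k n m)⁻¹ ∈ Y.localRing.toSubring := by
    rw [hA]
    exact LocalSubring.mem_ofPrime_iff.2 ⟨1, y, hy, by simp⟩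
  -- a denominator of positive order would be a multiple of the nonunit `f`
  obtain ⟨N, r, hr, e1⟩ := exists_mul_pow_eq hf hf0 y.2
  have hresr : v.res r ≤ exp (-((N + 1 : ℕ) : ℤ)) := by
    rw [WithZero.lt_one_iff_le_exp] at hlt
    rw [← e1, map_mul, map_pow, hresf, ← exp_nsmul]
    refine (mul_le_mul_left hlt _).trans ?_
    rw [← exp_add, exp_le_exp]
    push_cast
    simp
  have h1 := key (N + 1) r hresr
  have h2 := mul_mem h1 hyi
  refine hfA.inv_notMem hf0' ?_
  convert h2 using 1
  rw [← e1, pow_succ]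
  field_simp

end
end
end BlowupProd

namespace BlowupProd

open Projectivization WithZero
open scoped LinearAlgebra.Projectivization TensorProduct WithZero

noncomputable section

section
variable {k : Type*} [Field k] {n m s : ℕ} {p : Fin s → Pt k n m}

/-! ### Classification of the prime divisors -/

/-- The strict transform of a hypersurface is not exceptional. -/
theorem not_liesOver_of_toSubring_eq (hn : 1 ≤ n) (hm : 1 ≤ m) {F : CoordRing k n m}
    (hF : Irreducible F) {d : ℕ × ℕ} (hd : IsBihom F d) {Y : PrimeDivisor p}
    (hY : Y.localRing.toSubring = (primeForm hn hm hF hd).res.integer) (q : Pt k n m) :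
    ¬ Y.LiesOver q := by
  rintro ⟨a, b, hq, hle, h⟩
  obtain ⟨g, hg, hg1⟩ := exists_mem_pointIdeal_res_eq_one hn hm hF hd
    ((primeForm hn hm hF hd).inChart_of_le (hY ▸ hle)) q
  have := (LocalSubring.mem_maximalIdeal_iff_of_eq_integer hY _).1 (h g hg)
  exact this.ne hg1

theorem exists_irreducible_dehom {A : LocalSubring (FunField k n m)} {a : Fin (n + 1)}
    {b : Fin (m + 1)} (hA : (baseChart k n m a b).toSubring ≤ A.toSubring)
    {G : CoordRing k n m} (h0 : G ≠ 0) (hG : A.IsNonunit (dehom k n m a b G)) :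
    ∃ F, Irreducible F ∧ F ∣ G ∧ A.IsNonunit (dehom k n m a b F) := by
  induction G using WfDvdMonoid.induction_on_irreducible with
  | zero => exact absurd rfl h0
  | unit u hu =>
    obtain ⟨u, rfl⟩ := hu
    have h1 : dehom k n m a b u * dehom k n m a b (↑u⁻¹ : CoordRing k n m) = 1 := by
      rw [← map_mul, Units.mul_inv, map_one]
    have h2 := hG.mul_left (hA (dehom_mem_baseChart a b (↑u⁻¹ : CoordRing k n m)))
    rw [mul_comm, h1] at h2
    exact absurd h2 LocalSubring.not_isNonunit_one
  | mul G F hG0 hF ih =>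
    by_cases h : A.IsNonunit (dehom k n m a b F)
    · exact ⟨F, hF, dvd_mul_right _ _, h⟩
    · by_cases h' : A.IsNonunit (dehom k n m a b G)
      · obtain ⟨F', h1, h2, h3⟩ := ih hG0 h'
        exact ⟨F', h1, h2.mul_left _, h3⟩
      · rw [map_mul] at hG
        exact absurd hG (LocalSubring.not_isNonunit_mul (hA (dehom_mem_baseChart a b _))
          (hA (dehom_mem_baseChart a b _)) h h')

/-- A prime divisor whose generic point lies in the open subset `Spec R[1/f]`, where the blow-up is
an isomorphism, is the strict transform of a hypersurface. -/
theorem exists_primeForm_of_inv_mem (hn : 1 ≤ n) (hm : 1 ≤ m) {Y : PrimeDivisor p}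
    {a : Fin (n + 1)} {b : Fin (m + 1)} {f : baseChart k n m a b} (hf : f ∈ centerIdeal p a b)
    (hf0 : f ≠ 0) {P : Ideal (blowupChart p a b f).toSubring} {_ : P.IsPrime}
    (hA : Y.localRing = LocalSubring.ofPrime (blowupChart p a b f).toSubring P)
    (hfi : (f : FunField k n m)⁻¹ ∈ Y.localRing.toSubring) :
    ∃ (F : CoordRing k n m) (hF : Irreducible F) (d : ℕ × ℕ) (hd : IsBihom F d),
      Y.localRing.toSubring = (primeForm hn hm hF hd).res.integer := by
  have := Y.isDVR
  have := isFractionRing_of_mem Y.mem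
  have hB : (blowupChart p a b f).toSubring ≤ Y.localRing.toSubring :=
    hA ▸ LocalSubring.le_ofPrime _ P
  have hR : (baseChart k n m a b).toSubring ≤ Y.localRing.toSubring :=
    fun z hz => hB (baseChart_le_blowupChart f hz)
  have hf0' : (f : FunField k n m) ≠ 0 := fun h => hf0 (Subtype.ext h)
  -- elements of the local ring are quotients of functions on the chart of `ℙⁿ × ℙᵐ`
  have key (z : FunField k n m) (hz : z ∈ Y.localRing.toSubring) :
      ∃ x y : baseChart k n m a b, (y : FunField k n m) ≠ 0 ∧
        (y : FunField k n m)⁻¹ ∈ Y.localRing.toSubring ∧ z = x / y := by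
    rw [hA] at hz
    obtain ⟨g, h, hh, rfl⟩ := LocalSubring.mem_ofPrime_iff.1 hz
    have hh0 : (h : FunField k n m) ≠ 0 := fun h' => hh ((Subtype.ext h' : h = 0) ▸ P.zero_mem)
    have hhi : (h : FunField k n m)⁻¹ ∈ Y.localRing.toSubring := by
      rw [hA]
      exact LocalSubring.mem_ofPrime_iff.2 ⟨1, h, hh, by simp⟩
    obtain ⟨N, r, -, e⟩ := exists_mul_pow_eq hf hf0 g.2
    obtain ⟨N', r', -, e'⟩ := exists_mul_pow_eq hf hf0 h.2
    refine ⟨r * f ^ N', r' * f ^ N, ?_, ?_, ?_⟩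
    · rw [Subalgebra.coe_mul, SubmonoidClass.coe_pow, ← e']
      exact mul_ne_zero (mul_ne_zero hh0 (pow_ne_zero _ hf0')) (pow_ne_zero _ hf0')
    · rw [Subalgebra.coe_mul, SubmonoidClass.coe_pow, ← e', mul_inv, mul_inv, ← inv_pow, ← inv_pow]
      exact mul_mem (mul_mem hhi (pow_mem hfi _)) (pow_mem hfi _)
    · rw [Subalgebra.coe_mul, SubmonoidClass.coe_pow, Subalgebra.coe_mul, SubmonoidClass.coe_pow,
        ← e, ← e']
      field_simp
  obtain ⟨t, ht⟩ := IsDiscreteValuationRing.exists_irreducible Y.localRing.toSubring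
  have htn : Y.localRing.IsNonunit (t : FunField k n m) :=
    ⟨t.2, (IsLocalRing.mem_maximalIdeal _).2 ht.not_isUnit⟩
  obtain ⟨x, y, hy0, hyi, e⟩ := key t t.2
  have hxn : Y.localRing.IsNonunit (x : FunField k n m) := by
    have := htn.mul_left (hR y.2)
    rwa [e, mul_div_cancel₀ _ hy0] at this
  have hx0 : (x : FunField k n m) ≠ 0 := by
    intro h
    rw [h, zero_div] at e
    exact ht.ne_zero (Subtype.ext e)
  obtain ⟨d, G, hG, eG⟩ := exists_dehom_eq x.2
  have hG0 : G ≠ 0 := by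
    rintro rfl
    rw [map_zero] at eG
    exact hx0 eG.symm
  obtain ⟨F, hF, hFG, hFn⟩ := exists_irreducible_dehom hR hG0 (eG ▸ hxn)
  obtain ⟨d', hd'⟩ := hG.of_dvd hG0 hFG
  -- no function outside the maximal ideal is divisible by `F`
  have notDvd (H : CoordRing k n m) (hH : ¬ Y.localRing.IsNonunit (dehom k n m a b H)) :
      ¬ F ∣ H := by
    rintro ⟨H', rfl⟩
    rw [map_mul, mul_comm] at hH
    exact hH (hFn.mul_left (hR (dehom_mem_baseChart a b H')))
  have hab : (primeForm hn hm hF hd').InChart a b := by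
    constructor
    · rw [primeForm_eq_one_iff]
      refine notDvd _ ?_
      rw [dehom_x, xRatio_self]
      exact LocalSubring.not_isNonunit_one
    · rw [primeForm_eq_one_iff]
      refine notDvd _ ?_
      rw [dehom_y, yRatio_self]
      exact LocalSubring.not_isNonunit_one
  obtain ⟨t', ht'⟩ := (primeForm hn hm hF hd').exists_res_eq
  refine ⟨F, hF, d', hd', IsDiscreteValuationRing.eq_of_le (fun z hz => ?_)
    (Valuation.integer_ne_top ht')⟩
  obtain ⟨x', y', hy0', hyi', rfl⟩ := key z hz
  obtain ⟨c, H, hH, eH⟩ := exists_dehom_eq y'.2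
  have h1 : (primeForm hn hm hF hd').res y' = 1 := by
    rw [← eH, FormVal.res_dehom _ hab hH, primeForm_eq_one_iff]
    refine notDvd _ ?_
    rw [eH]
    exact LocalSubring.not_isNonunit_of_inv_mem hy0' hyi'
  rw [Valuation.mem_integer_iff, map_div₀, h1, div_one]
  exact FormVal.baseChart_le _ hab x'.2

/-- A prime divisor is exceptional, or the strict transform of a hypersurface. -/
theorem PrimeDivisor.liesOver_or_exists_primeForm (hn : 1 ≤ n) (hm : 1 ≤ m) (Y : PrimeDivisor p) :
    (∃ i, Y.LiesOver (p i)) ∨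
      ∃ (F : CoordRing k n m) (hF : Irreducible F) (d : ℕ × ℕ) (hd : IsBihom F d),
        Y.localRing.toSubring = (primeForm hn hm hF hd).res.integer := by
  obtain ⟨a, b, f, hf, hf0, P, hP, hA⟩ := Y.mem
  have hB : (blowupChart p a b f).toSubring ≤ Y.localRing.toSubring :=
    hA ▸ LocalSubring.le_ofPrime _ P
  have hR : (baseChart k n m a b).toSubring ≤ Y.localRing.toSubring :=
    fun z hz => hB (baseChart_le_blowupChart f hz)
  by_cases hfi : (f : FunField k n m)⁻¹ ∈ Y.localRing.toSubring
  · exact Or.inr (exists_primeForm_of_inv_mem hn hm hf hf0 hA hfi)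
  refine Or.inl ?_
  have hf0' : (f : FunField k n m) ≠ 0 := fun h => hf0 (Subtype.ext h)
  have hfn : Y.localRing.IsNonunit (f : FunField k n m) := by
    by_contra h
    exact hfi (LocalSubring.inv_mem_of_not_isNonunit (hR f.2) h).2
  -- the ideal of the centres is contained in the prime ideal of the image of `Y`
  have hI (g : baseChart k n m a b) (hg : g ∈ centerIdeal p a b) :
      Y.localRing.IsNonunit (g : FunField k n m) := by
    have h1 : (g : FunField k n m) / f ∈ blowupChart p a b f :=
      Algebra.subset_adjoin (Or.inr ⟨g, hg, rfl⟩)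
    have := hfn.mul_left (hB h1)
    rwa [div_mul_cancel₀ _ hf0'] at this
  by_contra! hc
  have h (i : Fin s) : ∃ g : baseChart k n m a b,
      (InChart (p i) a b → g ∈ pointIdeal (p i) a b) ∧
        ¬ Y.localRing.IsNonunit (g : FunField k n m) := by
    by_cases hi : InChart (p i) a b
    · by_contra! hc'
      exact hc i ⟨a, b, hi, hR, fun g hg => (hc' g fun _ => hg).2⟩
    · exact ⟨1, fun h => absurd h hi, LocalSubring.not_isNonunit_one⟩
  choose g hg hgn using h
  have hprod : ¬ Y.localRing.IsNonunit ((∏ i, g i : baseChart k n m a b) : FunField k n m) := by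
    rw [SubmonoidClass.coe_finsetProd]
    have (T : Finset (Fin s)) : ¬ Y.localRing.IsNonunit (∏ i ∈ T, (g i : FunField k n m)) := by
      classical
      induction T using Finset.induction_on with
      | empty => exact LocalSubring.not_isNonunit_one
      | insert i T hi ih =>
        rw [Finset.prod_insert hi]
        exact LocalSubring.not_isNonunit_mul (hR (g i).2)
          (prod_mem fun j _ => hR (g j).2) (hgn i) ih
    exact this _
  refine hprod (hI _ (mem_centerIdeal.2 fun i hi => ?_))
  exact Ideal.mem_of_dvd _ (Finset.dvd_prod_of_mem g (Finset.mem_univ i)) (hg i hi)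

end
end
end BlowupProd

namespace BlowupProd

open Projectivization WithZero
open scoped LinearAlgebra.Projectivization TensorProduct WithZero

noncomputable section

section
variable {k : Type*} [Field k] {n m s : ℕ} {p : Fin s → Pt k n m}

/-! ### Orders of vanishing of bihomogeneous polynomials -/

theorem PrimeDivisor.exists_formVal (hn : 1 ≤ n) (hm : 1 ≤ m) (hp : Function.Injective p)
    (Y : PrimeDivisor p) : ∃ v : FormVal k n m, Y.localRing.toSubring = v.res.integer := by
  obtain ⟨i, hi⟩ | ⟨F, hF, d, hd, h⟩ := Y.liesOver_or_exists_primeForm hn hm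
  · exact ⟨_, toSubring_eq_of_liesOver hn hp hi⟩
  · exact ⟨_, h⟩

theorem PrimeDivisor.baseChart_chart_le (Y : PrimeDivisor p) :
    (baseChart k n m Y.chart.1 Y.chart.2).toSubring ≤ Y.localRing.toSubring :=
  (exists_baseChart_le Y.mem).choose_spec

theorem PrimeDivisor.ord_eq {Y : PrimeDivisor p} {v : FormVal k n m}
    (hY : Y.localRing.toSubring = v.res.integer) (z : FunField k n m) :
    Y.ord z = -log (v.res z) := by
  have := Y.isDVR
  have := isFractionRing_of_mem Y.mem
  obtain ⟨t, ht⟩ := v.exists_res_eq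
  rw [← log_inv, ← Ring.ordFrac_eq_of_eq_integer hY ht z]
  rfl

/-- The order of vanishing along `Y` of a bihomogeneous polynomial, that is, of a local equation, in
a chart around the generic point of the image of `Y`, of the effective divisor it defines. -/
def PrimeDivisor.formOrd (Y : PrimeDivisor p) (F : CoordRing k n m) : ℤ :=
  Y.ord (dehom k n m Y.chart.1 Y.chart.2 F)

theorem PrimeDivisor.formOrd_eq {Y : PrimeDivisor p} {v : FormVal k n m}
    (hY : Y.localRing.toSubring = v.res.integer) {F : CoordRing k n m} {d : ℕ × ℕ}
    (hF : IsBihom F d) : Y.formOrd F = -log (v.toVal F) := by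
  rw [formOrd, ord_eq hY, v.res_dehom (v.inChart_of_le (hY ▸ Y.baseChart_chart_le)) hF]

theorem FormVal.log_nonpos (v : FormVal k n m) {F : CoordRing k n m} (h0 : F ≠ 0) :
    log (v.toVal F) ≤ 0 := by
  have h := v.le_one F
  have hv : v.toVal F ≠ 0 := fun h => h0 (v.eq_zero _ h)
  rwa [← exp_log hv, ← exp_zero, exp_le_exp] at h

theorem FormVal.log_mul (v : FormVal k n m) {F G : CoordRing k n m} (hF : F ≠ 0) (hG : G ≠ 0) :
    log (v.toVal (F * G)) = log (v.toVal F) + log (v.toVal G) := by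
  rw [map_mul, WithZero.log_mul (fun h => hF (v.eq_zero _ h)) (fun h => hG (v.eq_zero _ h))]

theorem FormVal.log_pow (v : FormVal k n m) {F : CoordRing k n m} (r : ℕ) :
    log (v.toVal (F ^ r)) = r * log (v.toVal F) := by
  rw [map_pow, WithZero.log_pow, nsmul_eq_mul]

theorem PrimeDivisor.formOrd_nonneg (hn : 1 ≤ n) (hm : 1 ≤ m) (hp : Function.Injective p)
    (Y : PrimeDivisor p) {F : CoordRing k n m} {d : ℕ × ℕ} (hF : IsBihom F d) (h0 : F ≠ 0) :
    0 ≤ Y.formOrd F := by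
  obtain ⟨v, hv⟩ := Y.exists_formVal hn hm hp
  rw [formOrd_eq hv hF]
  exact neg_nonneg.2 (v.log_nonpos h0)

theorem PrimeDivisor.formOrd_mul (hn : 1 ≤ n) (hm : 1 ≤ m) (hp : Function.Injective p)
    (Y : PrimeDivisor p) {F G : CoordRing k n m} {d e : ℕ × ℕ} (hF : IsBihom F d)
    (hG : IsBihom G e) (hF0 : F ≠ 0) (hG0 : G ≠ 0) :
    Y.formOrd (F * G) = Y.formOrd F + Y.formOrd G := by
  obtain ⟨v, hv⟩ := Y.exists_formVal hn hm hp
  rw [formOrd_eq hv (hF.mul hG), formOrd_eq hv hF, formOrd_eq hv hG, v.log_mul hF0 hG0]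
  ring

theorem PrimeDivisor.ord_fraction (hn : 1 ≤ n) (hm : 1 ≤ m) (hp : Function.Injective p)
    (Y : PrimeDivisor p) {z : FunField k n m} {G H : CoordRing k n m} {d : ℕ × ℕ}
    (hG : IsBihom G d) (hH : IsBihom H d) (hG0 : G ≠ 0)
    (e : FunField.val k n m z * algebraMap _ _ H = algebraMap _ (CoordField k n m) G) :
    Y.ord z = Y.formOrd G - Y.formOrd H := by
  obtain ⟨v, hv⟩ := Y.exists_formVal hn hm hp
  have h := v.res_mul e
  have h0 : v.res z * v.toVal H ≠ 0 := h ▸ fun h => hG0 (v.eq_zero _ h)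
  rw [formOrd_eq hv hG, formOrd_eq hv hH, ord_eq hv, ← h,
    WithZero.log_mul (left_ne_zero_of_mul h0) (right_ne_zero_of_mul h0)]
  ring

/-! ### Strict transforms and exceptional divisors -/

variable (p) in
/-- The strict transform of the hypersurface defined by an irreducible bihomogeneous polynomial. -/
def strictTransform (hn : 1 ≤ n) (hm : 1 ≤ m) {F : CoordRing k n m} (hF : Irreducible F)
    {d : ℕ × ℕ} (hd : IsBihom F d) : PrimeDivisor p :=
  (exists_primeDivisor_primeForm p hn hm hF hd).choose

theorem strictTransform_toSubring (hn : 1 ≤ n) (hm : 1 ≤ m) {F : CoordRing k n m}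
    (hF : Irreducible F) {d : ℕ × ℕ} (hd : IsBihom F d) :
    (strictTransform p hn hm hF hd).localRing.toSubring = (primeForm hn hm hF hd).res.integer :=
  (exists_primeDivisor_primeForm p hn hm hF hd).choose_spec

/-- The exceptional divisor over the centre `p i`. -/
def exceptional (hn : 1 ≤ n) (hp : Function.Injective p) (i : Fin s) : PrimeDivisor p :=
  (exists_primeDivisor_pointForm hn hp i).choose

theorem exceptional_toSubring (hn : 1 ≤ n) (hp : Function.Injective p) (i : Fin s) :
    (exceptional hn hp i).localRing.toSubring = (pointForm hn (p i)).res.integer :=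
  (exists_primeDivisor_pointForm hn hp i).choose_spec

theorem liesOver_iff_eq_exceptional (hn : 1 ≤ n) (hp : Function.Injective p) {i : Fin s}
    {Y : PrimeDivisor p} : Y.LiesOver (p i) ↔ Y = exceptional hn hp i := by
  constructor
  · intro h
    exact PrimeDivisor.ext_of_toSubring
      ((toSubring_eq_of_liesOver hn hp h).trans (exceptional_toSubring hn hp i).symm)
  · rintro rfl
    exact liesOver_of_toSubring_eq hn (exceptional_toSubring hn hp i)

theorem exceptional_ne_strictTransform (hn : 1 ≤ n) (hm : 1 ≤ m) (hp : Function.Injective p)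
    (i : Fin s) {F : CoordRing k n m} (hF : Irreducible F) {d : ℕ × ℕ} (hd : IsBihom F d) :
    exceptional hn hp i ≠ strictTransform p hn hm hF hd := fun h =>
  not_liesOver_of_toSubring_eq hn hm hF hd (strictTransform_toSubring hn hm hF hd) (p i)
    ((liesOver_iff_eq_exceptional hn hp).2 h.symm)

theorem exceptional_injective (hn : 1 ≤ n) (hp : Function.Injective p) :
    Function.Injective (exceptional hn hp) := by
  intro i j h
  by_contra hij
  have hi := (liesOver_iff_eq_exceptional hn hp).2 (rfl : exceptional hn hp i = _)
  have hj := (liesOver_iff_eq_exceptional hn hp).2 h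
  obtain ⟨hci, hni⟩ := hi.isNonunit (exceptional hn hp i).baseChart_chart_le
  obtain ⟨-, hnj⟩ := hj.isNonunit (exceptional hn hp i).baseChart_chart_le
  obtain ⟨e, he, c, hc, hec⟩ := exists_separating (hp.ne hij) hci
  exact not_isNonunit_of_sub_mem (exceptional hn hp i).baseChart_chart_le hni hc hec (hnj _ he)

theorem PrimeDivisor.eq_exceptional_or_strictTransform (hn : 1 ≤ n) (hm : 1 ≤ m)
    (hp : Function.Injective p) (Y : PrimeDivisor p) : (∃ i, Y = exceptional hn hp i) ∨
      ∃ (F : CoordRing k n m) (hF : Irreducible F) (d : ℕ × ℕ) (hd : IsBihom F d),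
        Y = strictTransform p hn hm hF hd := by
  obtain ⟨i, hi⟩ | ⟨F, hF, d, hd, h⟩ := Y.liesOver_or_exists_primeForm hn hm
  · exact Or.inl ⟨i, (liesOver_iff_eq_exceptional hn hp).1 hi⟩
  · exact Or.inr ⟨F, hF, d, hd, ext_of_toSubring
      (h.trans (strictTransform_toSubring hn hm hF hd).symm)⟩

theorem formOrd_strictTransform_self (hn : 1 ≤ n) (hm : 1 ≤ m) {F : CoordRing k n m}
    (hF : Irreducible F) {d : ℕ × ℕ} (hd : IsBihom F d) :
    (strictTransform p hn hm hF hd).formOrd F = 1 := by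
  rw [PrimeDivisor.formOrd_eq (strictTransform_toSubring hn hm hF hd) hd, primeForm_toVal,
    primeVal_of_ne_zero _ hF.ne_zero, multiplicity_self, log_exp]
  norm_num

theorem formOrd_strictTransform_eq_zero (hn : 1 ≤ n) (hm : 1 ≤ m) {F : CoordRing k n m}
    (hF : Irreducible F) {d : ℕ × ℕ} (hd : IsBihom F d) {G : CoordRing k n m} {e : ℕ × ℕ}
    (hG : IsBihom G e) (h : ¬ F ∣ G) : (strictTransform p hn hm hF hd).formOrd G = 0 := by
  rw [PrimeDivisor.formOrd_eq (strictTransform_toSubring hn hm hF hd) hG,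
    (primeForm_eq_one_iff hn hm hF hd).2 h]
  simp

theorem formOrd_strictTransform_pos (hn : 1 ≤ n) (hm : 1 ≤ m) {F : CoordRing k n m}
    (hF : Irreducible F) {d : ℕ × ℕ} (hd : IsBihom F d) {G : CoordRing k n m} {e : ℕ × ℕ}
    (hG : IsBihom G e) (h0 : G ≠ 0) (h : F ∣ G) :
    0 < (strictTransform p hn hm hF hd).formOrd G := by
  rw [PrimeDivisor.formOrd_eq (strictTransform_toSubring hn hm hF hd) hG]
  have h1 := (primeForm_lt_one_iff hn hm hF hd).2 h
  have hv : (primeForm hn hm hF hd).toVal G ≠ 0 := fun h => h0 (FormVal.eq_zero _ _ h)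
  rw [← exp_log hv, ← exp_zero, exp_lt_exp] at h1
  exact neg_pos.2 h1

theorem strictTransform_eq_of_associated (hn : 1 ≤ n) (hm : 1 ≤ m) {F G : CoordRing k n m}
    (hF : Irreducible F) (hG : Irreducible G) {d e : ℕ × ℕ} (hd : IsBihom F d) (he : IsBihom G e)
    (h : Associated F G) : strictTransform p hn hm hF hd = strictTransform p hn hm hG he := by
  apply PrimeDivisor.ext_of_toSubring
  rw [strictTransform_toSubring, strictTransform_toSubring]
  have e1 : (primeForm hn hm hF hd).toVal = (primeForm hn hm hG he).toVal := by
    ext x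
    rw [primeForm_toVal, primeForm_toVal]
    by_cases hx : x = 0
    · rw [hx, map_zero, map_zero]
    · rw [primeVal_of_ne_zero _ hx, primeVal_of_ne_zero _ hx,
        multiplicity_eq_of_associated_left h]
  have ext (v w : FormVal k n m) (h : v.toVal = w.toVal) : v = w := by
    cases v
    cases w
    simpa using h
  rw [ext _ _ e1]

theorem finite_formOrd_ne_zero (hn : 1 ≤ n) (hm : 1 ≤ m) (hp : Function.Injective p)
    {F : CoordRing k n m} {d : ℕ × ℕ} (hF : IsBihom F d) (h0 : F ≠ 0) :
    (Function.support fun Y : PrimeDivisor p => Y.formOrd F).Finite := by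
  have hfin : (⋃ G ∈ {G | G ∈ UniqueFactorizationMonoid.factors F},
      {Y : PrimeDivisor p | ∃ (hG : Irreducible G) (e : ℕ × ℕ) (he : IsBihom G e),
        Y = strictTransform p hn hm hG he}).Finite := by
    refine Set.Finite.biUnion (Multiset.finite_toSet _) fun G _ => Set.Subsingleton.finite ?_
    rintro _ ⟨hG, e, he, rfl⟩ _ ⟨hG', e', he', rfl⟩
    exact strictTransform_eq_of_associated hn hm hG hG' he he' (Associated.refl G)
  refine ((Set.finite_range (exceptional hn hp)).union hfin).subset fun Y hY => ?_
  rcases Y.eq_exceptional_or_strictTransform hn hm hp with ⟨i, rfl⟩ | ⟨G, hG, e, he, rfl⟩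
  · exact Or.inl ⟨i, rfl⟩
  · refine Or.inr ?_
    have hdvd : G ∣ F := by
      by_contra h
      exact hY (formOrd_strictTransform_eq_zero hn hm hG he hF h)
    obtain ⟨G', hG', hass⟩ := UniqueFactorizationMonoid.exists_mem_factors_of_dvd h0 hG hdvd
    obtain ⟨e', he'⟩ := hF.of_dvd h0 (UniqueFactorizationMonoid.dvd_of_mem_factors hG')
    have hirr := UniqueFactorizationMonoid.irreducible_of_factor _ hG'
    exact Set.mem_biUnion hG' ⟨hirr, e', he', strictTransform_eq_of_associated hn hm hG hirr he he'
      hass⟩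

/-! ### Divisor classes -/

theorem finsum_single_eq {α : Type*} {f : α → ℤ} (hf : f.support.Finite) :
    ∑ᶠ a, Finsupp.single a (f a) = Finsupp.ofSupportFinite f hf := by
  classical
  have hsub : (Function.support fun a => Finsupp.single a (f a)) ⊆ (hf.toFinset : Set α) := by
    intro a ha
    simp only [Function.mem_support, ne_eq, Finsupp.single_eq_zero] at ha
    simpa using ha
  rw [finsum_eq_sum_of_support_subset _ hsub]
  ext a
  rw [Finsupp.finsetSum_apply, Finsupp.ofSupportFinite_coe]
  simp only [Finsupp.single_apply]
  rw [Finset.sum_ite_eq']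
  split_ifs with h
  · rfl
  · rw [hf.mem_toFinset, Function.mem_support, not_not] at h
    exact h.symm

/-- The pullback to the blow-up of the divisor of a bihomogeneous polynomial. -/
def divForm (hn : 1 ≤ n) (hm : 1 ≤ m) (hp : Function.Injective p) {F : CoordRing k n m}
    {d : ℕ × ℕ} (hF : IsBihom F d) (h0 : F ≠ 0) : Divisor p :=
  Finsupp.ofSupportFinite (fun Y => Y.formOrd F) (finite_formOrd_ne_zero hn hm hp hF h0)

theorem divForm_apply (hn : 1 ≤ n) (hm : 1 ≤ m) (hp : Function.Injective p) {F : CoordRing k n m}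
    {d : ℕ × ℕ} (hF : IsBihom F d) (h0 : F ≠ 0) (Y : PrimeDivisor p) :
    divForm hn hm hp hF h0 Y = Y.formOrd F :=
  rfl

theorem E_eq (hn : 1 ≤ n) (hp : Function.Injective p) (i : Fin s) :
    E p i = divisorClass p (Finsupp.single (exceptional hn hp i) 1) := by
  classical
  rw [E]
  congr 1
  simp only [liesOver_iff_eq_exceptional hn hp, finsum_eq_if]
  rw [finsum_eq_single _ (exceptional hn hp i) fun Y hY => if_neg hY, if_pos rfl]

theorem H₁_eq (hn : 1 ≤ n) (hm : 1 ≤ m) (hp : Function.Injective p) :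
    H₁ p = divisorClass p (divForm hn hm hp (isBihom_x 0) (MvPolynomial.X_ne_zero _)) := by
  rw [divForm, ← finsum_single_eq, H₁]
  simp only [PrimeDivisor.formOrd, dehom_x]

theorem H₂_eq (hn : 1 ≤ n) (hm : 1 ≤ m) (hp : Function.Injective p) :
    H₂ p = divisorClass p (divForm hn hm hp (isBihom_y 0) (MvPolynomial.X_ne_zero _)) := by
  rw [divForm, ← finsum_single_eq, H₂]
  simp only [PrimeDivisor.formOrd, dehom_y]

theorem divisorClass_eq_iff {D D' : Divisor p} : divisorClass p D = divisorClass p D' ↔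
    ∃ f : FunField k n m, f ≠ 0 ∧ ∀ Y : PrimeDivisor p, D' Y - D Y = Y.ord f := by
  have : divisorClass p D = divisorClass p D' ↔ -D + D' ∈ principal p := QuotientAddGroup.eq
  rw [this, neg_add_eq_sub]
  rfl

theorem formOrd_mul_monomial (hn : 1 ≤ n) (hm : 1 ≤ m) (hp : Function.Injective p)
    (Y : PrimeDivisor p) {F : CoordRing k n m} {d : ℕ × ℕ} (hF : IsBihom F d) (h0 : F ≠ 0)
    (e : ℕ × ℕ) :
    Y.formOrd (F * (MvPolynomial.X (Sum.inl 0) ^ e.1 * MvPolynomial.X (Sum.inr 0) ^ e.2)) =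
      Y.formOrd F + (e.1 * Y.formOrd (MvPolynomial.X (Sum.inl 0)) +
        e.2 * Y.formOrd (MvPolynomial.X (Sum.inr 0))) := by
  obtain ⟨v, hv⟩ := Y.exists_formVal hn hm hp
  have hx : (MvPolynomial.X (Sum.inl 0) : CoordRing k n m) ≠ 0 := MvPolynomial.X_ne_zero _
  have hy : (MvPolynomial.X (Sum.inr 0) : CoordRing k n m) ≠ 0 := MvPolynomial.X_ne_zero _
  rw [PrimeDivisor.formOrd_eq hv (hF.mul (isBihom_monomial 0 0 e)), PrimeDivisor.formOrd_eq hv hF,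
    PrimeDivisor.formOrd_eq hv (isBihom_x 0), PrimeDivisor.formOrd_eq hv (isBihom_y 0),
    v.log_mul h0 (mul_ne_zero (pow_ne_zero _ hx) (pow_ne_zero _ hy)),
    v.log_mul (pow_ne_zero _ hx) (pow_ne_zero _ hy), v.log_pow, v.log_pow]
  ring

theorem divisorClass_divForm (hn : 1 ≤ n) (hm : 1 ≤ m) (hp : Function.Injective p)
    {F : CoordRing k n m} {d : ℕ × ℕ} (hF : IsBihom F d) (h0 : F ≠ 0) :
    divisorClass p (divForm hn hm hp hF h0) = (d.1 : ℤ) • H₁ p + (d.2 : ℤ) • H₂ p := by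
  rw [H₁_eq hn hm hp, H₂_eq hn hm hp, ← map_zsmul, ← map_zsmul, ← map_add, eq_comm,
    divisorClass_eq_iff]
  refine ⟨dehom k n m 0 0 F, dehom_ne_zero hF h0 0 0, fun Y => ?_⟩
  have h1 := val_dehom_mul hF 0 0
  rw [xCoord, yCoord, ← map_pow, ← map_pow, ← map_mul] at h1
  rw [Y.ord_fraction hn hm hp hF (isBihom_monomial 0 0 d) h0 h1]
  have h2 := formOrd_mul_monomial hn hm hp Y
    (MvPolynomial.isWeightedHomogeneous_one k (biweight n m)) one_ne_zero d
  have h3 : Y.formOrd 1 = 0 := by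
    rw [PrimeDivisor.formOrd, map_one, PrimeDivisor.ord_one]
  rw [one_mul, h3, zero_add] at h2
  rw [h2]
  simp [divForm_apply]

/-- The pullback of a hypersurface is its strict transform plus the exceptional divisors, with the
multiplicities of the hypersurface at the centres. -/
theorem divisorClass_strictTransform (hn : 1 ≤ n) (hm : 1 ≤ m) (hp : Function.Injective p)
    {F : CoordRing k n m} (hF : Irreducible F) {d : ℕ × ℕ} (hd : IsBihom F d) :
    divisorClass p (Finsupp.single (strictTransform p hn hm hF hd) 1) =
      (d.1 : ℤ) • H₁ p + (d.2 : ℤ) • H₂ p - ∑ i, (exceptional hn hp i).formOrd F • E p i := by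
  classical
  rw [← divisorClass_divForm hn hm hp hd hF.ne_zero, eq_sub_iff_add_eq]
  simp only [E_eq hn hp, ← map_zsmul, ← map_sum, ← map_add]
  congr 1
  ext Y
  rw [divForm_apply, Finsupp.add_apply, Finsupp.finsetSum_apply]
  simp only [Finsupp.smul_apply, Finsupp.single_apply, smul_eq_mul, mul_ite, mul_one, mul_zero]
  rcases Y.eq_exceptional_or_strictTransform hn hm hp with ⟨i, rfl⟩ | ⟨G, hG, e, he, rfl⟩
  · rw [if_neg (exceptional_ne_strictTransform hn hm hp i hF hd).symm, zero_add]
    simp only [(exceptional_injective hn hp).eq_iff]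
    rw [Finset.sum_ite_eq', if_pos (Finset.mem_univ i)]
  · rw [Finset.sum_eq_zero fun i _ => if_neg (exceptional_ne_strictTransform hn hm hp i hG he),
      add_zero]
    split_ifs with h
    · rw [← h, formOrd_strictTransform_self]
    · refine (formOrd_strictTransform_eq_zero hn hm hG he hd fun hdvd => h ?_).symm
      exact strictTransform_eq_of_associated hn hm hF hG hd he
        (hG.associated_of_dvd hF hdvd).symm

variable (p) in
/-- The class `d₁ H₁ + d₂ H₂ - ∑ rᵢ Eᵢ`, as a function of its coefficients. -/
def combination : ℤ × ℤ × (Fin s → ℤ) →+ ClassGrp p where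
  toFun d := d.1 • H₁ p + d.2.1 • H₂ p - ∑ i, d.2.2 i • E p i
  map_zero' := by simp
  map_add' x y := by
    simp only [Prod.fst_add, Prod.snd_add, Pi.add_apply, add_zsmul, Finset.sum_add_distrib]
    abel

theorem combination_apply (d : ℤ × ℤ × (Fin s → ℤ)) :
    combination p d = d.1 • H₁ p + d.2.1 • H₂ p - ∑ i, d.2.2 i • E p i :=
  rfl

theorem combination_surjective (hn : 1 ≤ n) (hm : 1 ≤ m) (hp : Function.Injective p) :
    Function.Surjective (combination p) := by
  classical
  intro c
  obtain ⟨D, rfl⟩ := QuotientAddGroup.mk'_surjective (principal p) c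
  change divisorClass p D ∈ (combination p).range
  induction D using Finsupp.induction_linear with
  | zero => rw [map_zero]; exact zero_mem _
  | add D D' h h' => rw [map_add]; exact add_mem h h'
  | single Y r =>
    have e : Finsupp.single Y r = r • Finsupp.single Y (1 : ℤ) := by simp
    rw [e, map_zsmul]
    refine zsmul_mem ?_ r
    rcases Y.eq_exceptional_or_strictTransform hn hm hp with ⟨i, rfl⟩ | ⟨F, hF, d, hd, rfl⟩
    · rw [← E_eq hn hp]
      refine ⟨(0, 0, -Pi.single i 1), ?_⟩
      rw [combination_apply]
      simp [Pi.single_apply]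
    · rw [divisorClass_strictTransform hn hm hp]
      exact ⟨(d.1, d.2, fun i => (exceptional hn hp i).formOrd F), rfl⟩

/-! ### Effective classes and bihomogeneous polynomials -/

/-- A bihomogeneous polynomial which vanishes to order at least `r i` at each centre makes the
corresponding class effective. -/
theorem mem_effMonoid_of_form (hn : 1 ≤ n) (hm : 1 ≤ m) (hp : Function.Injective p)
    {F : CoordRing k n m} {d : ℕ × ℕ} (hF : IsBihom F d) (h0 : F ≠ 0) {r : Fin s → ℤ}
    (hr : ∀ i, r i ≤ (exceptional hn hp i).formOrd F) :
    (d.1 : ℤ) • H₁ p + (d.2 : ℤ) • H₂ p - ∑ i, r i • E p i ∈ effMonoid p := by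
  classical
  refine ⟨divForm hn hm hp hF h0 - ∑ i, r i • Finsupp.single (exceptional hn hp i) 1, ?_, ?_⟩
  · change 0 ≤ divForm hn hm hp hF h0 - ∑ i, r i • Finsupp.single (exceptional hn hp i) 1
    intro Y
    rw [Finsupp.sub_apply, Finsupp.finsetSum_apply, divForm_apply, Finsupp.zero_apply, sub_nonneg]
    simp only [Finsupp.smul_apply, Finsupp.single_apply, smul_eq_mul, mul_ite, mul_one, mul_zero]
    by_cases hY : ∃ i, exceptional hn hp i = Y
    · obtain ⟨i, rfl⟩ := hY
      simp only [(exceptional_injective hn hp).eq_iff]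
      rw [Finset.sum_ite_eq', if_pos (Finset.mem_univ i)]
      exact hr i
    · rw [Finset.sum_eq_zero fun i _ => if_neg fun h => hY ⟨i, h⟩]
      exact Y.formOrd_nonneg hn hm hp hF h0
  · rw [map_sub, divisorClass_divForm, map_sum]
    simp only [E_eq hn hp, map_zsmul]

/-- An effective class is represented by a bihomogeneous polynomial: a rational bihomogeneous
function without poles along the strict transforms of hypersurfaces is a polynomial. -/
theorem exists_form_of_mem_effMonoid (hn : 1 ≤ n) (hm : 1 ≤ m) (hp : Function.Injective p)
    {d₁ d₂ : ℤ} {r : Fin s → ℤ}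
    (h : d₁ • H₁ p + d₂ • H₂ p - ∑ i, r i • E p i ∈ effMonoid p) :
    ∃ (F : CoordRing k n m) (d : ℕ × ℕ), IsBihom F d ∧ F ≠ 0 ∧ (d.1 : ℤ) = d₁ ∧ (d.2 : ℤ) = d₂ ∧
      ∀ i, r i ≤ (exceptional hn hp i).formOrd F := by
  classical
  obtain ⟨D, hD, e⟩ := h
  replace hD : 0 ≤ D := hD
  have e' : divisorClass p (d₁ • divForm hn hm hp (isBihom_x 0) (MvPolynomial.X_ne_zero _) +
      d₂ • divForm hn hm hp (isBihom_y 0) (MvPolynomial.X_ne_zero _) -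
      ∑ i, r i • Finsupp.single (exceptional hn hp i) 1) = divisorClass p D := by
    rw [e, map_sub, map_add, map_sum, map_zsmul, map_zsmul, ← H₁_eq hn hm hp, ← H₂_eq hn hm hp]
    simp only [E_eq hn hp, map_zsmul]
  obtain ⟨f, hf0, hf⟩ := divisorClass_eq_iff.1 e'
  simp only [Finsupp.sub_apply, Finsupp.add_apply, Finsupp.smul_apply, divForm_apply,
    Finsupp.finsetSum_apply, Finsupp.single_apply, smul_eq_mul, mul_ite, mul_one, mul_zero] at hf
  obtain ⟨c, G, H, hG, hH, hH0, hGH⟩ := exists_isBihom_fraction f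
  have hG0 : G ≠ 0 := by
    rintro rfl
    rw [map_zero, mul_eq_zero, map_eq_zero_iff _ FunField.val_injective,
      map_eq_zero_iff _ (IsFractionRing.injective (CoordRing k n m) (CoordField k n m))] at hGH
    exact hGH.elim hf0 hH0
  -- `A / B` is the function `f * x_0 ^ d₁ * y_0 ^ d₂`
  set u : ℕ × ℕ := (d₁.toNat, d₂.toNat) with hu
  set w : ℕ × ℕ := ((-d₁).toNat, (-d₂).toNat) with hw
  set A : CoordRing k n m :=
    G * (MvPolynomial.X (Sum.inl 0) ^ u.1 * MvPolynomial.X (Sum.inr 0) ^ u.2) with hA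
  set B : CoordRing k n m :=
    H * (MvPolynomial.X (Sum.inl 0) ^ w.1 * MvPolynomial.X (Sum.inr 0) ^ w.2) with hB
  have hmon (e : ℕ × ℕ) : (MvPolynomial.X (Sum.inl 0) ^ e.1 * MvPolynomial.X (Sum.inr 0) ^ e.2 :
      CoordRing k n m) ≠ 0 :=
    mul_ne_zero (pow_ne_zero _ (MvPolynomial.X_ne_zero _))
      (pow_ne_zero _ (MvPolynomial.X_ne_zero _))
  have hA0 : A ≠ 0 := mul_ne_zero hG0 (hmon u)
  have hB0 : B ≠ 0 := mul_ne_zero hH0 (hmon w)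
  have hAb : IsBihom A (c + u) := hG.mul (isBihom_monomial 0 0 u)
  have hBb : IsBihom B (c + w) := hH.mul (isBihom_monomial 0 0 w)
  have key (Y : PrimeDivisor p) : Y.formOrd A - Y.formOrd B = D Y +
      ∑ i, if exceptional hn hp i = Y then r i else 0 := by
    have h1 := hf Y
    rw [Y.ord_fraction hn hm hp hG hH hG0 hGH] at h1
    rw [hA, hB, formOrd_mul_monomial hn hm hp Y hG hG0, formOrd_mul_monomial hn hm hp Y hH hH0]
    have hu1 : d₁ = (d₁.toNat : ℤ) - ((-d₁).toNat : ℤ) := by omega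
    have hu2 : d₂ = (d₂.toNat : ℤ) - ((-d₂).toNat : ℤ) := by omega
    rw [hu1, hu2] at h1
    simp only [hu, hw]
    linear_combination (-1 : ℤ) * h1
  obtain ⟨A', B', C', hrel, hA', hB'⟩ :=
    UniqueFactorizationMonoid.exists_reduced_factors' A B hB0
  have hB'u : IsUnit B' := by
    have hB'0 : B' ≠ 0 := right_ne_zero_of_mul (hB' ▸ hB0)
    by_contra hnu
    obtain ⟨F, hF, hFB⟩ := WfDvdMonoid.exists_irreducible_factor hnu hB'0
    have hA'0 : A' ≠ 0 := right_ne_zero_of_mul (hA' ▸ hA0)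
    have hC0 : C' ≠ 0 := left_ne_zero_of_mul (hB' ▸ hB0)
    obtain ⟨e, he⟩ := hBb.of_dvd hB0 (hFB.trans (hB' ▸ dvd_mul_left B' C'))
    have h1 := key (strictTransform p hn hm hF he)
    rw [Finset.sum_eq_zero fun i _ => if_neg (exceptional_ne_strictTransform hn hm hp i hF he),
      add_zero] at h1
    have h2 := hD (strictTransform p hn hm hF he)
    rw [Finsupp.zero_apply] at h2
    obtain ⟨-, eA, -, hbA, -⟩ := (hA' ▸ hAb : IsBihom (C' * A') _).of_mul (hA' ▸ hA0)
    obtain ⟨eC, eB, hbC, hbB, -⟩ := (hB' ▸ hBb : IsBihom (C' * B') _).of_mul (hB' ▸ hB0)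
    rw [← hA', ← hB', PrimeDivisor.formOrd_mul hn hm hp _ hbC hbA hC0 hA'0,
      PrimeDivisor.formOrd_mul hn hm hp _ hbC hbB hC0 hB'0] at h1
    have h3 := formOrd_strictTransform_pos (p := p) hn hm hF he hbB hB'0 hFB
    have h4 : ¬ F ∣ A' := fun h => hF.not_isUnit (hrel h hFB)
    have h5 := formOrd_strictTransform_eq_zero (p := p) hn hm hF he hbA h4
    omega
  have hBA : B ∣ A := by
    rw [← hA', ← hB']
    exact mul_dvd_mul_left _ hB'u.dvd
  obtain ⟨F, hF⟩ := hBA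
  have hF0 : F ≠ 0 := right_ne_zero_of_mul (hF ▸ hA0)
  obtain ⟨d', d, hd', hd, hsum⟩ := (hF ▸ hAb : IsBihom (B * F) _).of_mul (hF ▸ hA0)
  obtain rfl := hBb.inj_right hB0 hd'
  rw [Prod.ext_iff] at hsum
  simp only [Prod.fst_add, Prod.snd_add, hu, hw] at hsum
  refine ⟨F, d, hd, hF0, by omega, by omega, fun i => ?_⟩
  have h1 := key (exceptional hn hp i)
  simp only [(exceptional_injective hn hp).eq_iff] at h1
  rw [Finset.sum_ite_eq', if_pos (Finset.mem_univ i)] at h1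
  have h2 := hD (exceptional hn hp i)
  rw [Finsupp.zero_apply] at h2
  rw [hF, PrimeDivisor.formOrd_mul hn hm hp _ hBb hd hB0 hF0] at h1
  omega

end
end
end BlowupProd

/-! ### Distributing multiplicities -/

section
variable {G ι : Type*} [AddCommGroup G] [LinearOrder G] [IsOrderedAddMonoid G] [Fintype ι]
  [DecidableEq ι]

/-- The case `d₁ = 0` of `mem_of_inequalities`: the linear forms in the `y` are distributed greedily
over the points. -/
theorem mem_of_sum_le {C : AddSubmonoid (G × G × (ι → G))}
    (h₂ : ∀ t : G, 0 ≤ t → ∀ i, (0, t, Pi.single i t) ∈ C)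
    (h₃ : ∀ t : G, 0 ≤ t → ∀ i, (0, 0, Pi.single i t) ∈ C) {d : G} (hd : 0 ≤ d) {c : ι → G}
    (hc : ∀ i, 0 ≤ c i) (h : d ≤ ∑ i, c i) : (0, d, c) ∈ C := by
  induction hN : (Finset.univ.filter fun i => c i ≠ 0).card using Nat.strong_induction_on
    generalizing d c with
  | _ N ih =>
  subst hN
  by_cases hc0 : ∀ i, c i = 0
  · simp only [hc0, Finset.sum_const_zero] at h
    obtain rfl : d = 0 := le_antisymm h hd
    obtain rfl : c = 0 := funext hc0
    exact zero_mem C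
  push Not at hc0
  obtain ⟨i, hi⟩ := hc0
  -- use up the coefficient `c i`: as long as possible with forms, the rest without
  set t := min (c i) d
  have ht0 : 0 ≤ t := le_min (hc i) hd
  have hsum : ∑ j, (c - Pi.single i (c i) : ι → G) j = ∑ j, c j - c i := by
    simp [Finset.sum_sub_distrib, Pi.single_apply]
  have h1 : (0, d - t, c - Pi.single i (c i)) ∈ C := by
    refine ih _ (Finset.card_lt_card ?_) (sub_nonneg.2 (min_le_right _ _)) (fun j => ?_) ?_ rfl
    · rw [Finset.ssubset_iff_of_subset]
      · exact ⟨i, by simpa using hi, by simp⟩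
      · intro j hj
        simp only [Finset.mem_filter, Finset.mem_univ, true_and, Pi.sub_apply] at hj ⊢
        intro hj0
        by_cases hji : j = i
        · exact hi (hji ▸ hj0)
        · rw [Pi.single_eq_of_ne hji, sub_zero] at hj
          exact hj hj0
    · rw [Pi.sub_apply]
      by_cases hji : j = i
      · rw [hji, Pi.single_eq_same, sub_self]
      · rw [Pi.single_eq_of_ne hji, sub_zero]
        exact hc j
    · rw [hsum]
      rcases le_total (c i) d with hle | hle
      · rw [min_eq_left hle]
        exact sub_le_sub_right h _
      · rw [min_eq_right hle, sub_self, sub_nonneg]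
        exact Finset.single_le_sum (fun j _ => hc j) (Finset.mem_univ i)
  have h4 := add_mem (add_mem h1 (h₂ t ht0 i)) (h₃ (c i - t) (sub_nonneg.2 (min_le_left _ _)) i)
  convert h4 using 1
  refine Prod.ext (by simp) (Prod.ext (by simp) ?_)
  simp only [Prod.snd_add, add_assoc, ← Pi.single_add]
  rw [add_sub_cancel, sub_add_cancel]

/-- The boundary case of `mem_of_inequalities`: if `∑_{j ≠ l} c_j = d₁`, each of the forms in the `x`
must be nonzero at the `l`-th point and at one of the others. -/
theorem mem_of_sum_erase_eq {C : AddSubmonoid (G × G × (ι → G))}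
    (h₁ : ∀ t : G, 0 ≤ t → ∀ i j, i ≠ j → (t, 0, Pi.single i t + Pi.single j t) ∈ C)
    (h₂ : ∀ t : G, 0 ≤ t → ∀ i, (0, t, Pi.single i t) ∈ C)
    (h₃ : ∀ t : G, 0 ≤ t → ∀ i, (0, 0, Pi.single i t) ∈ C) {d₁ d₂ : G} (hd₂ : 0 ≤ d₂)
    {c : ι → G} (hc : ∀ i, 0 ≤ c i) (h : 2 • d₁ + d₂ ≤ ∑ i, c i) {l : ι}
    (hl : ∑ j ∈ Finset.univ.erase l, c j = d₁) : (d₁, d₂, c) ∈ C := by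
  have hcl : d₁ + d₂ ≤ c l := by
    rw [← Finset.add_sum_erase _ _ (Finset.mem_univ l), hl, two_nsmul, add_assoc, add_comm (c l)]
      at h
    exact le_of_add_le_add_left h
  have h4 : (∑ j ∈ Finset.univ.erase l, (c j, (0 : G), Pi.single l (c j) + Pi.single j (c j)) :
      G × G × (ι → G)) ∈ C :=
    sum_mem fun j hj => h₁ _ (hc j) l j (Finset.ne_of_mem_erase hj).symm
  have h5 := add_mem (add_mem h4 (h₂ d₂ hd₂ l))
    (h₃ (c l - d₁ - d₂) (by rw [sub_sub]; exact sub_nonneg.2 hcl) l)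
  convert h5 using 1
  refine Prod.ext ?_ (Prod.ext ?_ ?_)
  · simp only [Prod.fst_add, Prod.fst_sum, hl, add_zero]
  · simp [Prod.fst_sum, Prod.snd_sum]
  · ext i
    simp only [Prod.snd_add, Prod.snd_sum, Pi.add_apply, Finset.sum_apply]
    rw [Finset.sum_add_distrib]
    by_cases hi : i = l
    · subst hi
      simp only [Pi.single_eq_same]
      rw [hl, Finset.sum_eq_zero fun j hj =>
        Pi.single_eq_of_ne (Finset.ne_of_mem_erase hj).symm _]
      abel
    · rw [Pi.single_eq_of_ne hi, Pi.single_eq_of_ne hi]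
      simp only [Pi.single_eq_of_ne hi, Finset.sum_const_zero, Pi.single_apply]
      rw [Finset.sum_ite_eq, if_pos (Finset.mem_erase.2 ⟨hi, Finset.mem_univ i⟩)]
      abel

/-- The inequalities `c ≥ 0`, `∑ c ≥ 2 d₁ + d₂` and `∑_{j ≠ l} c_j ≥ d₁` define the cone generated
by the `(1, 0, e_i + e_j)`, `i ≠ j`, the `(0, 1, e_i)` and the `(0, 0, e_i)`. Here `c i` stands for
`d₁ + d₂ - m i`, the number of the `d₁ + d₂` factors of a product of linear forms which do not
vanish at the `i`-th point; the generators of the first two kinds are the linear forms in the `x`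
and in the `y` which vanish at as many points as possible. The proof is uniform in the ordered group
`G`, and so covers integral and real coefficients: subtract a form in the `x` which is nonzero at
two points `i`, `j` as often as possible, until a coefficient vanishes or one of the last
inequalities becomes an equality. -/
theorem mem_of_inequalities {C : AddSubmonoid (G × G × (ι → G))}
    (h₁ : ∀ t : G, 0 ≤ t → ∀ i j, i ≠ j → (t, 0, Pi.single i t + Pi.single j t) ∈ C)
    (h₂ : ∀ t : G, 0 ≤ t → ∀ i, (0, t, Pi.single i t) ∈ C)
    (h₃ : ∀ t : G, 0 ≤ t → ∀ i, (0, 0, Pi.single i t) ∈ C) {d₁ d₂ : G} (hd₁ : 0 ≤ d₁)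
    (hd₂ : 0 ≤ d₂) {c : ι → G} (hc : ∀ i, 0 ≤ c i) (h : 2 • d₁ + d₂ ≤ ∑ i, c i)
    (hl : ∀ l, d₁ ≤ ∑ j ∈ Finset.univ.erase l, c j) : (d₁, d₂, c) ∈ C := by
  induction hN : (Finset.univ.filter fun i => c i ≠ 0).card using Nat.strong_induction_on
    generalizing d₁ c with
  | _ N ih =>
  subst hN
  by_cases hd0 : d₁ = 0
  · subst hd0
    rw [nsmul_zero, zero_add] at h
    exact mem_of_sum_le h₂ h₃ hd₂ hc h
  by_cases htight : ∃ l, ∑ j ∈ Finset.univ.erase l, c j = d₁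
  · obtain ⟨l, hl⟩ := htight
    exact mem_of_sum_erase_eq h₁ h₂ h₃ hd₂ hc h hl
  have hpos : 0 < d₁ := lt_of_le_of_ne hd₁ (Ne.symm hd0)
  obtain ⟨i, -, hi⟩ : ∃ i ∈ Finset.univ, c i ≠ 0 := by
    refine Finset.exists_ne_zero_of_sum_ne_zero fun h0 => ?_
    rw [h0, two_nsmul] at h
    exact absurd h (not_le.2 (add_pos_of_pos_of_nonneg (add_pos hpos hpos) hd₂))
  obtain ⟨j, hj, hj0⟩ : ∃ j ∈ Finset.univ.erase i, c j ≠ 0 :=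
    Finset.exists_ne_zero_of_sum_ne_zero (ne_of_gt (hpos.trans_le (hl i)))
  have hij : i ≠ j := (Finset.ne_of_mem_erase hj).symm
  -- `t` is the largest multiple of the form which can be subtracted; only the inequalities for
  -- `l ≠ i, j` change in the process
  set g : ι → G := fun l =>
    if l = i ∨ l = j then d₁ else ∑ j ∈ Finset.univ.erase l, c j - d₁ with hg
  set t := min (min (c i) (c j)) (min d₁ (Finset.univ.inf' ⟨i, Finset.mem_univ i⟩ g)) with ht
  have hti : t ≤ c i := (min_le_left _ _).trans (min_le_left _ _)
  have htj : t ≤ c j := (min_le_left _ _).trans (min_le_right _ _)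
  have htd : t ≤ d₁ := (min_le_right _ _).trans (min_le_left _ _)
  have htg (l) : t ≤ g l := (min_le_right _ _).trans
    ((min_le_right _ _).trans (Finset.inf'_le _ (Finset.mem_univ l)))
  have ht0 : 0 ≤ t := le_min (le_min (hc i) (hc j))
    (le_min hd₁ (Finset.le_inf' _ _ fun l _ => by
      rw [hg]
      dsimp only
      split_ifs
      exacts [hd₁, sub_nonneg.2 (hl l)]))
  set c' : ι → G := c - (Pi.single i t + Pi.single j t) with hc'
  have hc'i : c' i = c i - t := by simp [hc', Pi.single_eq_of_ne hij]
  have hc'j : c' j = c j - t := by simp [hc', Pi.single_eq_of_ne hij.symm]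
  have hc'l (l) (hli : l ≠ i) (hlj : l ≠ j) : c' l = c l := by
    simp [hc', Pi.single_eq_of_ne hli, Pi.single_eq_of_ne hlj]
  have hc'0 (l) : 0 ≤ c' l := by
    by_cases hli : l = i
    · rw [hli, hc'i]; exact sub_nonneg.2 hti
    by_cases hlj : l = j
    · rw [hlj, hc'j]; exact sub_nonneg.2 htj
    rw [hc'l l hli hlj]
    exact hc l
  have hsum (T : Finset ι) : ∑ l ∈ T, c' l =
      ∑ l ∈ T, c l - ((if i ∈ T then t else 0) + if j ∈ T then t else 0) := by
    simp only [hc', Pi.sub_apply, Pi.add_apply, Finset.sum_sub_distrib, Finset.sum_add_distrib,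
      Pi.single_apply, Finset.sum_ite_eq']
  have h' : 2 • (d₁ - t) + d₂ ≤ ∑ l, c' l := by
    rw [hsum, if_pos (Finset.mem_univ _), if_pos (Finset.mem_univ _)]
    refine le_trans (le_of_eq ?_) (sub_le_sub_right h _)
    rw [two_nsmul, two_nsmul]
    abel
  have hl' (l) : d₁ - t ≤ ∑ x ∈ Finset.univ.erase l, c' x := by
    rw [hsum]
    by_cases hli : l = i
    · rw [if_neg (by simp [hli]), if_pos (by simp [hli, hij.symm]), zero_add]
      exact sub_le_sub_right (hl l) _
    by_cases hlj : l = j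
    · rw [if_pos (by simp [hlj, hij]), if_neg (by simp [hlj]), add_zero]
      exact sub_le_sub_right (hl l) _
    rw [if_pos (by simp [Ne.symm hli]), if_pos (by simp [Ne.symm hlj])]
    have h1 := add_le_add_left (htg l) (d₁ - t - t)
    simp only [hg, if_neg (not_or.2 ⟨hli, hlj⟩)] at h1
    refine le_trans (le_of_eq ?_) (h1.trans (le_of_eq ?_)) <;> abel
  have hmem : (d₁ - t, d₂, c') ∈ C := by
    have hd' : 0 ≤ d₁ - t := sub_nonneg.2 htd
    have hsub : (Finset.univ.filter fun l => c' l ≠ 0) ⊆ Finset.univ.filter fun l => c l ≠ 0 := by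
      intro l hl0
      simp only [Finset.mem_filter, Finset.mem_univ, true_and] at hl0 ⊢
      by_cases hli : l = i
      · exact hli ▸ hi
      by_cases hlj : l = j
      · exact hlj ▸ hj0
      exact hc'l l hli hlj ▸ hl0
    have hmin : t = c i ∨ t = c j ∨ t = d₁ ∨ ∃ l, t = g l := by
      rcases min_choice (min (c i) (c j))
        (min d₁ (Finset.univ.inf' ⟨i, Finset.mem_univ i⟩ g)) with h | h
      · rcases min_choice (c i) (c j) with h2 | h2
        · exact Or.inl (h.trans h2)
        · exact Or.inr (Or.inl (h.trans h2))
      · rcases min_choice d₁ (Finset.univ.inf' ⟨i, Finset.mem_univ i⟩ g) with h2 | h2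
        · exact Or.inr (Or.inr (Or.inl (h.trans h2)))
        · obtain ⟨l, -, hl⟩ := Finset.exists_mem_eq_inf' ⟨i, Finset.mem_univ i⟩ g
          exact Or.inr (Or.inr (Or.inr ⟨l, h.trans (h2.trans hl)⟩))
    have hdone (h1 : t = d₁) : (d₁ - t, d₂, c') ∈ C := by
      rw [← h1, sub_self, nsmul_zero, zero_add] at h'
      rw [← h1, sub_self]
      exact mem_of_sum_le h₂ h₃ hd₂ hc'0 h'
    rcases hmin with h1 | h1 | h1 | ⟨l, h1⟩
    · refine ih _ (Finset.card_lt_card ((Finset.ssubset_iff_of_subset hsub).2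
        ⟨i, by simpa using hi, by simp [hc'i, ← h1]⟩)) hd' hc'0 h' hl' rfl
    · refine ih _ (Finset.card_lt_card ((Finset.ssubset_iff_of_subset hsub).2
        ⟨j, by simpa using hj0, by simp [hc'j, ← h1]⟩)) hd' hc'0 h' hl' rfl
    · exact hdone h1
    · by_cases hlij : l = i ∨ l = j
      · exact hdone (h1.trans (if_pos hlij))
      · obtain ⟨hli, hlj⟩ := not_or.1 hlij
        refine mem_of_sum_erase_eq h₁ h₂ h₃ hd₂ hc'0 h' (l := l) ?_
        rw [hsum, if_pos (by simp [Ne.symm hli]), if_pos (by simp [Ne.symm hlj])]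
        have h2 : t = ∑ j ∈ Finset.univ.erase l, c j - d₁ := h1.trans (if_neg hlij)
        nth_rewrite 1 [h2]
        abel
  have h4 := add_mem hmem (h₁ t ht0 i j hij)
  convert h4 using 1
  refine Prod.ext (by simp) (Prod.ext (by simp) ?_)
  simp [hc']

end

namespace BlowupProd

open Projectivization WithZero
open scoped LinearAlgebra.Projectivization TensorProduct WithZero

noncomputable section

section
variable {k : Type*} [Field k] {n m s : ℕ}

/-! ### Multiplicities at points -/

theorem le_formOrd_exceptional_iff {p : Fin s → Pt k n m} (hn : 1 ≤ n)
    (hp : Function.Injective p) {F : CoordRing k n m} {d : ℕ × ℕ} (hF : IsBihom F d) (h0 : F ≠ 0)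
    (i : Fin s) {r : ℕ} :
    (r : ℤ) ≤ (exceptional hn hp i).formOrd F ↔ Polynomial.X ^ r ∣ taylor (p i) F := by
  rw [PrimeDivisor.formOrd_eq (exceptional_toSubring hn hp i) hF, le_neg,
    log_le_iff_le_exp fun h => h0 ((pointForm hn (p i)).eq_zero _ h), pointForm_le_iff]

theorem le_of_X_pow_dvd_taylor {q : Pt k n m} {F : CoordRing k n m} {d : ℕ × ℕ}
    (hF : IsBihom F d) (h0 : F ≠ 0) {r : ℕ} (h : Polynomial.X ^ r ∣ taylor q F) :
    r ≤ d.1 + d.2 := by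
  have h1 := Polynomial.natDegree_le_of_dvd h
    ((map_ne_zero_iff _ (taylor_injective q)).2 h0)
  rw [Polynomial.natDegree_X_pow] at h1
  have hdeg (s : Fin (n + 1) ⊕ Fin (m + 1)) :
      (Polynomial.C (MvPolynomial.C (Pt.coords q s)) +
        Polynomial.C (MvPolynomial.X s) * Polynomial.X :
          Polynomial (CoordRing k n m)).natDegree ≤ 1 :=
    Polynomial.natDegree_add_le_of_degree_le ((Polynomial.natDegree_C _).trans_le zero_le_one)
      ((Polynomial.natDegree_C_mul_le _ _).trans Polynomial.natDegree_X_le)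
  have h2 : (taylor q F).natDegree ≤ 1 * d.1 + 1 * d.2 :=
    hF.natDegree_aeval_le (fun i => hdeg (Sum.inl i)) (fun j => hdeg (Sum.inr j))
  rw [one_mul, one_mul] at h2
  exact h1.trans h2

/-- The restriction of `F` to a curve through `q` vanishes to at least the order of the
multiplicity of `F` at `q`. -/
theorem X_sub_C_pow_dvd_aeval {q : Pt k n m} {F : CoordRing k n m} {d : ℕ × ℕ}
    (hF : IsBihom F d) {r : ℕ} (h : Polynomial.X ^ r ∣ taylor q F)
    {g : Fin (n + 1) ⊕ Fin (m + 1) → Polynomial k} {t a b : k} (ha : a ≠ 0) (hb : b ≠ 0)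
    (hx : ∀ i, (g (Sum.inl i)).eval t = a * q.1.rep i)
    (hy : ∀ j, (g (Sum.inr j)).eval t = b * q.2.rep j) :
    (Polynomial.X - Polynomial.C t) ^ r ∣ MvPolynomial.aeval g F := by
  -- normalize the curve so that its value at `t` is the chosen vector of coordinates
  set g' : Fin (n + 1) ⊕ Fin (m + 1) → Polynomial k := fun s =>
    Sum.elim (fun _ => Polynomial.C a⁻¹) (fun _ => Polynomial.C b⁻¹) s * g s with hg'
  have hval (s) : (g' s).eval t = Pt.coords q s := by
    rcases s with i | j
    · simp [hg', hx, Pt.coords, ha]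
    · simp [hg', hy, Pt.coords, hb]
  choose z hz using fun s => Polynomial.X_sub_C_dvd_sub_C_eval (a := t) (p := g' s)
  have h1 : (Polynomial.X - Polynomial.C t) ^ r ∣ MvPolynomial.aeval g' F := by
    have h2 := map_dvd (Polynomial.eval₂RingHom (MvPolynomial.aeval z).toRingHom
      (Polynomial.X - Polynomial.C t)) h
    rw [map_pow, Polynomial.coe_eval₂RingHom, Polynomial.eval₂_X, eval₂_taylor] at h2
    have h3 : g' = fun s => algebraMap k (Polynomial k) (Pt.coords q s) +
        z s * (Polynomial.X - Polynomial.C t) := by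
      ext1 s
      rw [← hval, Polynomial.algebraMap_eq, mul_comm, ← hz, add_sub_cancel]
    rwa [← h3] at h2
  rw [hF.aeval_scale, ← map_pow, ← map_pow, ← map_mul] at h1
  refine (IsUnit.dvd_mul_left ?_).1 h1
  exact Polynomial.isUnit_C.2 (isUnit_iff_ne_zero.2
    (mul_ne_zero (pow_ne_zero _ (inv_ne_zero ha)) (pow_ne_zero _ (inv_ne_zero hb))))

/-! ### Linear forms through some of the points -/

theorem exists_linear_relation {N : ℕ} {ι : Type*} (u : ι → Fin N → k) {I : Finset ι}
    (hI : I.card < N) : ∃ a : Fin N → k, a ≠ 0 ∧ ∀ i ∈ I, ∑ l, a l * u i l = 0 := by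
  let f : (Fin N → k) →ₗ[k] (I → k) := LinearMap.pi fun i => ∑ l, u i l • LinearMap.proj l
  have hf : f.ker ≠ ⊥ := LinearMap.ker_ne_bot_of_finrank_lt (by simpa using hI)
  obtain ⟨a, ha, ha0⟩ := Submodule.exists_mem_ne_zero_of_ne_bot hf
  refine ⟨a, ha0, fun i hi => ?_⟩
  have := congrFun (LinearMap.mem_ker.1 ha) ⟨i, hi⟩
  simpa [f, mul_comm] using this

theorem X_dvd_taylor_sum (q : Pt k n m) {N : ℕ} (a : Fin N → k)
    (e : Fin N → Fin (n + 1) ⊕ Fin (m + 1)) (h : ∑ l, a l * Pt.coords q (e l) = 0) :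
    Polynomial.X ∣ taylor q (∑ l, MvPolynomial.C (a l) * MvPolynomial.X (e l)) := by
  rw [Polynomial.X_dvd_iff, map_sum, Polynomial.finsetSum_coeff]
  simp only [map_mul, taylor_X, ← MvPolynomial.algebraMap_eq, AlgHom.commutes]
  simp only [Polynomial.algebraMap_apply, MvPolynomial.algebraMap_eq, Polynomial.coeff_C_mul,
    Polynomial.coeff_add, Polynomial.coeff_C_zero, Polynomial.coeff_mul_X_zero, add_zero]
  simp only [← map_mul, ← map_sum, h, map_zero]

theorem sum_C_mul_X_ne_zero {σ : Type*} {N : ℕ} {a : Fin N → k} (ha : a ≠ 0) {e : Fin N → σ}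
    (he : Function.Injective e) :
    (∑ l, MvPolynomial.C (a l) * MvPolynomial.X (e l) : MvPolynomial σ k) ≠ 0 := by
  classical
  obtain ⟨l, hl⟩ := Function.ne_iff.1 ha
  intro h
  have := congrArg (MvPolynomial.eval (fun s => if s = e l then (1 : k) else 0)) h
  simp [he.eq_iff] at this
  exact hl this

theorem H₁_sub_mem_effMonoid {p : Fin s → Pt k n m} (hn : 1 ≤ n) (hm : 1 ≤ m)
    (hp : Function.Injective p) {I : Finset (Fin s)} (hI : I.card ≤ n) :
    H₁ p - ∑ i ∈ I, E p i ∈ effMonoid p := by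
  classical
  obtain ⟨a, ha, h⟩ := exists_linear_relation (fun i => (p i).1.rep) (Nat.lt_succ_of_le hI)
  have hF : IsBihom (∑ l, MvPolynomial.C (a l) * MvPolynomial.X (Sum.inl l) : CoordRing k n m)
      (1, 0) := MvPolynomial.IsWeightedHomogeneous.sum _ _ _ fun l _ => (isBihom_x l).C_mul _
  have h0 := sum_C_mul_X_ne_zero ha (Sum.inl_injective (α := Fin (n + 1)) (β := Fin (m + 1)))
  have := mem_effMonoid_of_form hn hm hp hF h0 (r := fun i => if i ∈ I then 1 else 0) fun i => by
    split_ifs with hi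
    · have := (le_formOrd_exceptional_iff hn hp hF h0 i (r := 1)).2 (by
        rw [pow_one]
        exact X_dvd_taylor_sum _ _ _ (h i hi))
      exact_mod_cast this
    · exact PrimeDivisor.formOrd_nonneg hn hm hp _ hF h0
  simpa [ite_smul] using this

theorem H₂_sub_mem_effMonoid {p : Fin s → Pt k n m} (hn : 1 ≤ n) (hm : 1 ≤ m)
    (hp : Function.Injective p) {I : Finset (Fin s)} (hI : I.card ≤ m) :
    H₂ p - ∑ i ∈ I, E p i ∈ effMonoid p := by
  classical
  obtain ⟨a, ha, h⟩ := exists_linear_relation (fun i => (p i).2.rep) (Nat.lt_succ_of_le hI)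
  have hF : IsBihom (∑ l, MvPolynomial.C (a l) * MvPolynomial.X (Sum.inr l) : CoordRing k n m)
      (0, 1) := MvPolynomial.IsWeightedHomogeneous.sum _ _ _ fun l _ => (isBihom_y l).C_mul _
  have h0 := sum_C_mul_X_ne_zero ha (Sum.inr_injective (α := Fin (n + 1)) (β := Fin (m + 1)))
  have := mem_effMonoid_of_form hn hm hp hF h0 (r := fun i => if i ∈ I then 1 else 0) fun i => by
    split_ifs with hi
    · have := (le_formOrd_exceptional_iff hn hp hF h0 i (r := 1)).2 (by
        rw [pow_one]
        exact X_dvd_taylor_sum _ _ _ (h i hi))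
      exact_mod_cast this
    · exact PrimeDivisor.formOrd_nonneg hn hm hp _ hF h0
  simpa [ite_smul] using this

theorem E_mem_effMonoid {p : Fin s → Pt k n m} (hn : 1 ≤ n) (hp : Function.Injective p)
    (i : Fin s) : E p i ∈ effMonoid p := by
  rw [E_eq hn hp]
  refine ⟨_, ?_, rfl⟩
  exact Finsupp.single_nonneg.2 zero_le_one

/-! ### Points in general position -/

theorem GeneralPosition.injective {p : Fin s → Pt k n m} (hn : 1 ≤ n) (hp : GeneralPosition p) :
    Function.Injective p := by
  classical
  intro i j hij
  have h := hp.1 {i, j} (Finset.card_le_two.trans (by omega))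
  rw [independent_iff] at h
  have h1 := h.injective (a₁ := ⟨i, by simp⟩) (a₂ := ⟨j, by simp⟩) (by simp [hij])
  exact congrArg Subtype.val h1

theorem exists_sum_mul_eq {N : ℕ} {ι : Type*} [Fintype ι] {u : ι → Fin N → k} {T : Finset ι}
    (hT : T.card = N) (hu : LinearIndependent k fun i : T => u i) (x : Fin N → k) :
    ∃ a : ι → k, ∀ l, ∑ i, a i * u i l = x l := by
  have h1 : Submodule.span k (Set.range u) = ⊤ := by
    rw [← top_le_iff, ← hu.span_eq_top_of_card_eq_finrank' (by simp [hT])]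
    exact Submodule.span_mono (by rintro _ ⟨i, rfl⟩; exact ⟨i, rfl⟩)
  obtain ⟨a, rfl⟩ := (Submodule.mem_span_range_iff_exists_fun k).1 (h1 ▸ Submodule.mem_top (x := x))
  exact ⟨a, fun l => by simp [Finset.sum_apply]⟩

/-- All coefficients of the linear relation between `N + 1` vectors of `k ^ N` in general position
are nonzero. -/
theorem exists_relation_ne_zero {N : ℕ} {ι : Type*} [Fintype ι] [DecidableEq ι]
    {u : ι → Fin N → k} (hι : Fintype.card ι = N + 1)
    (hu : ∀ i, LinearIndependent k fun j : (Finset.univ.erase i : Finset ι) => u j) :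
    ∃ c : ι → k, (∀ i, c i ≠ 0) ∧ ∀ l, ∑ i, c i * u i l = 0 := by
  have h : ¬ LinearIndependent k u := fun h => by
    have := h.fintype_card_le_finrank
    simp [hι] at this
  rw [Fintype.linearIndependent_iff] at h
  push Not at h
  obtain ⟨c, hc, j, hj⟩ := h
  refine ⟨c, fun i hi => hj ?_, fun l => by simpa [Finset.sum_apply] using congrFun hc l⟩
  by_cases hji : j = i
  · exact hji ▸ hi
  · refine Fintype.linearIndependent_iff.1 (hu i) (fun x => c x) ?_
      ⟨j, Finset.mem_erase.2 ⟨hji, Finset.mem_univ j⟩⟩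
    rw [Finset.sum_coe_sort (Finset.univ.erase i) fun x => c x • u x,
      ← hc, ← Finset.add_sum_erase _ _ (Finset.mem_univ i), hi, zero_smul, zero_add]

end
end
end BlowupProd

namespace BlowupProd

open Projectivization WithZero
open scoped LinearAlgebra.Projectivization TensorProduct WithZero

noncomputable section

section
variable {k : Type*} [Field k] {n m : ℕ}

/-! ### Rational curves through the points -/

/-- The product of the `1 - t i T`, `i ≠ j`. -/
def cofactor {ι : Type*} [Fintype ι] [DecidableEq ι] (t : ι → k) (j : ι) : Polynomial k :=
  ∏ i ∈ Finset.univ.erase j, (1 - Polynomial.C (t i) * Polynomial.X)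

/-- A rational curve in the projective space of `k ^ N` through the points with coordinates `u j`;
it passes through the `j`-th point at the parameter `(t j)⁻¹`, and its value at `0` is
`∑ a j * u j`. -/
def curve {ι : Type*} [Fintype ι] [DecidableEq ι] {N : ℕ} (t a : ι → k) (u : ι → Fin N → k)
    (l : Fin N) : Polynomial k :=
  ∑ j, Polynomial.C (a j * u j l) * cofactor t j

section
variable {ι : Type*} [Fintype ι] [DecidableEq ι] {N : ℕ}

theorem cofactor_eval_zero (t : ι → k) (j : ι) : (cofactor t j).eval 0 = 1 := by
  simp [cofactor, Polynomial.eval_prod]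

theorem cofactor_eval_inv_ne_zero {t : ι → k} (ht : ∀ i, t i ≠ 0) (hinj : Function.Injective t)
    (j : ι) : (cofactor t j).eval (t j)⁻¹ ≠ 0 := by
  rw [cofactor, Polynomial.eval_prod, Finset.prod_ne_zero_iff]
  intro i hi h
  simp only [Polynomial.eval_sub, Polynomial.eval_one, Polynomial.eval_mul, Polynomial.eval_C,
    Polynomial.eval_X, sub_eq_zero] at h
  refine Finset.ne_of_mem_erase hi (hinj ?_)
  rw [eq_comm, ← div_eq_mul_inv, div_eq_one_iff_eq (ht j)] at h
  exact h

theorem cofactor_eval_inv_eq_zero {t : ι → k} (ht : ∀ i, t i ≠ 0) {i j : ι} (hij : i ≠ j) :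
    (cofactor t j).eval (t i)⁻¹ = 0 := by
  rw [cofactor, Polynomial.eval_prod]
  refine Finset.prod_eq_zero (Finset.mem_erase.2 ⟨hij, Finset.mem_univ i⟩) ?_
  simp [ht i]

theorem natDegree_cofactor_le (t : ι → k) (j : ι) :
    (cofactor t j).natDegree ≤ Fintype.card ι - 1 := by
  refine (Polynomial.natDegree_prod_le _ _).trans
    ((Finset.sum_le_card_nsmul _ _ 1 fun i _ => ?_).trans_eq ?_)
  · refine (Polynomial.natDegree_sub_le _ _).trans (max_le ?_ ?_)
    · simp
    · exact (Polynomial.natDegree_C_mul_le _ _).trans Polynomial.natDegree_X_le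
  · simp [Finset.card_univ]

theorem curve_eval_zero (t a : ι → k) (u : ι → Fin N → k) (l : Fin N) :
    (curve t a u l).eval 0 = ∑ j, a j * u j l := by
  simp [curve, Polynomial.eval_finsetSum, cofactor_eval_zero]

theorem curve_eval_inv {t : ι → k} (ht : ∀ i, t i ≠ 0) (a : ι → k) (u : ι → Fin N → k) (i : ι)
    (l : Fin N) :
    (curve t a u l).eval (t i)⁻¹ = a i * (cofactor t i).eval (t i)⁻¹ * u i l := by
  rw [curve, Polynomial.eval_finsetSum, Finset.sum_eq_single i]
  · rw [Polynomial.eval_mul, Polynomial.eval_C]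
    ring
  · intro j _ hj
    rw [Polynomial.eval_mul, cofactor_eval_inv_eq_zero ht hj.symm, mul_zero]
  · simp

theorem natDegree_curve_le (t a : ι → k) (u : ι → Fin N → k) (l : Fin N) :
    (curve t a u l).natDegree ≤ Fintype.card ι - 1 :=
  Polynomial.natDegree_sum_le_of_forall_le _ _ fun j _ =>
    (Polynomial.natDegree_C_mul_le _ _).trans (natDegree_cofactor_le t j)

/-- If the coefficients are `c j * t j` for a linear relation `c` between the points, the degree of
the curve drops by one. -/
theorem natDegree_curve_le_of_relation (t : ι → k) {c : ι → k} {u : ι → Fin N → k}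
    (hc : ∀ l, ∑ j, c j * u j l = 0) (l : Fin N) :
    (curve t (fun j => c j * t j) u l).natDegree ≤ Fintype.card ι - 2 := by
  have key : Polynomial.X * curve t (fun j => c j * t j) u l = curve t c u l := by
    have h1 (j) : Polynomial.X * (Polynomial.C (c j * t j * u j l) * cofactor t j) =
        Polynomial.C (c j * u j l) * cofactor t j - Polynomial.C (c j * u j l) *
          ∏ i, (1 - Polynomial.C (t i) * Polynomial.X) := by
      rw [← Finset.mul_prod_erase _ _ (Finset.mem_univ j), cofactor]
      simp only [Polynomial.C_mul]
      ring
    rw [curve, Finset.mul_sum, Finset.sum_congr rfl fun j _ => h1 j, Finset.sum_sub_distrib,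
      ← Finset.sum_mul, ← map_sum, hc, Polynomial.C_0, zero_mul, sub_zero, curve]
  by_cases h0 : curve t (fun j => c j * t j) u l = 0
  · rw [h0, Polynomial.natDegree_zero]
    exact Nat.zero_le _
  · have := natDegree_curve_le t c u l
    rw [← key, Polynomial.natDegree_X_mul h0] at this
    omega

end

/-- Parameters for two curves, of the shape of `curve`, whose common value at `0` does not lie on
the hypersurface of `F`. -/
theorem exists_curve [Infinite k] {ι : Type*} [Fintype ι] {F : CoordRing k n m} (h0 : F ≠ 0)
    {u : ι → Fin (n + 1) → k} {w : ι → Fin (m + 1) → k}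
    (hu : ∀ x : Fin (n + 1) → k, ∃ a : ι → k, ∀ l, ∑ j, a j * u j l = x l)
    (hw : ∀ y : Fin (m + 1) → k, ∃ b : ι → k, ∀ l, ∑ j, b j * w j l = y l)
    {c : ι → k} (hc : ∀ j, c j ≠ 0) :
    ∃ t b : ι → k, (∀ j, t j ≠ 0) ∧ (∀ j, b j ≠ 0) ∧ Function.Injective t ∧
      MvPolynomial.eval (Sum.elim (fun l => ∑ j, c j * t j * u j l) (fun l => ∑ j, b j * w j l)) F
        ≠ 0 := by
  classical
  let G : Fin (n + 1) ⊕ Fin (m + 1) → MvPolynomial (ι ⊕ ι) k := Sum.elim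
    (fun l => ∑ j, MvPolynomial.C (c j * u j l) * MvPolynomial.X (Sum.inl j))
    (fun l => ∑ j, MvPolynomial.C (w j l) * MvPolynomial.X (Sum.inr j))
  have hG (v : ι ⊕ ι → k) : MvPolynomial.eval v (MvPolynomial.aeval G F) =
      MvPolynomial.eval (Sum.elim (fun l => ∑ j, c j * v (Sum.inl j) * u j l)
        (fun l => ∑ j, v (Sum.inr j) * w j l)) F := by
    rw [← MvPolynomial.coe_aeval_eq_eval v, RingHom.coe_coe, ← AlgHom.comp_apply,
      MvPolynomial.comp_aeval, ← MvPolynomial.coe_aeval_eq_eval, RingHom.coe_coe]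
    refine congrArg (fun f => MvPolynomial.aeval f F) (funext ?_)
    rintro (l | l)
    · simp [G, mul_right_comm]
    · simp [G, mul_comm]
  have hFG : MvPolynomial.aeval G F ≠ 0 := by
    intro h
    refine h0 (MvPolynomial.funext fun v => ?_)
    obtain ⟨a, ha⟩ := hu fun l => v (Sum.inl l)
    obtain ⟨b, hb⟩ := hw fun l => v (Sum.inr l)
    have := hG (Sum.elim (fun j => a j / c j) b)
    rw [h, map_zero] at this
    rw [map_zero, this]
    congr 2
    ext (l | l)
    · simp [mul_div_cancel₀ _ (hc _), ha]
    · simp [hb]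
  -- the conditions on `t` and `b` are the nonvanishing of one polynomial
  set P : MvPolynomial (ι ⊕ ι) k := MvPolynomial.aeval G F * (∏ s, MvPolynomial.X s) *
    ∏ q ∈ Finset.univ.offDiag (α := ι),
      (MvPolynomial.X (Sum.inl q.1) - MvPolynomial.X (Sum.inl q.2))
    with hP
  have hP0 : P ≠ 0 := by
    refine mul_ne_zero (mul_ne_zero hFG ?_) ?_
    · exact Finset.prod_ne_zero_iff.2 fun s _ => MvPolynomial.X_ne_zero s
    · refine Finset.prod_ne_zero_iff.2 fun q hq h => ?_
      rw [sub_eq_zero, MvPolynomial.X_inj, Sum.inl.injEq] at h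
      exact (Finset.mem_offDiag.1 hq).2.2 h
  obtain ⟨v, hv⟩ : ∃ v, MvPolynomial.eval v P ≠ 0 := by
    by_contra! h
    exact hP0 (MvPolynomial.funext fun v => by rw [h, map_zero])
  rw [hP, map_mul, map_mul, hG, map_prod, map_prod] at hv
  have h1 := right_ne_zero_of_mul (left_ne_zero_of_mul hv)
  have h2 := right_ne_zero_of_mul hv
  rw [Finset.prod_ne_zero_iff] at h1 h2
  refine ⟨fun j => v (Sum.inl j), fun j => v (Sum.inr j), fun j => ?_, fun j => ?_,
    fun i j hij => ?_, left_ne_zero_of_mul (left_ne_zero_of_mul hv)⟩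
  · simpa using h1 (Sum.inl j) (Finset.mem_univ _)
  · simpa using h1 (Sum.inr j) (Finset.mem_univ _)
  · by_contra hne
    have := h2 (i, j) (Finset.mem_offDiag.2 ⟨Finset.mem_univ _, Finset.mem_univ _, hne⟩)
    rw [map_sub, MvPolynomial.eval_X, MvPolynomial.eval_X] at this
    exact this (sub_eq_zero.2 hij)

/-- The multiplicities of a hypersurface of bidegree `d` at the points have sum at most
`n d.1 + (n + 1) d.2`, its intersection number with a curve of bidegree `(n, n + 1)` through all the
points; these curves cover a dense set, so that one of them is not contained in the hypersurface. -/
theorem sum_le_of_X_pow_dvd_taylor [Infinite k] {p : Fin (n + 2) → Pt k n (n + 1)}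
    (hp : GeneralPosition p) {F : CoordRing k n (n + 1)} {d : ℕ × ℕ} (hF : IsBihom F d)
    (h0 : F ≠ 0) {r : Fin (n + 2) → ℕ} (hr : ∀ i, Polynomial.X ^ r i ∣ taylor (p i) F) :
    ∑ i, r i ≤ n * d.1 + (n + 1) * d.2 := by
  classical
  have hu (i) : LinearIndependent k
      fun j : (Finset.univ.erase i : Finset (Fin (n + 2))) => (p j).1.rep :=
    independent_iff.1 (hp.1 _ (by simp))
  obtain ⟨c, hc, hc0⟩ := exists_relation_ne_zero (u := fun j => (p j).1.rep) (by simp) hu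
  obtain ⟨t, b, ht, hb, hinj, hne⟩ := exists_curve h0 (u := fun j => (p j).1.rep)
    (w := fun j => (p j).2.rep) (exists_sum_mul_eq (T := Finset.univ.erase 0) (by simp) (hu 0))
    (exists_sum_mul_eq (T := Finset.univ) (by simp)
      (independent_iff.1 (hp.2 Finset.univ (by simp)))) hc
  set g : Fin (n + 1) ⊕ Fin (n + 1 + 1) → Polynomial k :=
    Sum.elim (curve t (fun j => c j * t j) fun j => (p j).1.rep)
      (curve t b fun j => (p j).2.rep) with hg
  have hQ0 : MvPolynomial.aeval g F ≠ 0 := by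
    intro h
    refine hne ?_
    have h1 := congrArg (Polynomial.aeval (0 : k)) h
    rw [map_zero, ← AlgHom.comp_apply, MvPolynomial.comp_aeval] at h1
    rw [← MvPolynomial.coe_aeval_eq_eval, RingHom.coe_coe, ← h1]
    refine congrArg (fun f => MvPolynomial.aeval f F) (funext ?_)
    rintro (l | l) <;> simp [hg, Polynomial.coe_aeval_eq_eval, curve_eval_zero]
  have hdeg : (MvPolynomial.aeval g F).natDegree ≤ n * d.1 + (n + 1) * d.2 :=
    hF.natDegree_aeval_le
      (fun l => (natDegree_curve_le_of_relation t hc0 l).trans (by simp))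
      (fun l => (natDegree_curve_le t b _ l).trans (by simp))
  have hdvd : ∏ i, (Polynomial.X - Polynomial.C (t i)⁻¹) ^ r i ∣ MvPolynomial.aeval g F := by
    refine Finset.prod_dvd_of_coprime (fun i _ j _ hij => ?_) fun i _ => ?_
    · exact (Polynomial.pairwise_coprime_X_sub_C (s := fun i => (t i)⁻¹)
        (inv_injective.comp hinj) hij).pow
    · exact X_sub_C_pow_dvd_aeval hF (hr i)
        (mul_ne_zero (mul_ne_zero (hc i) (ht i)) (cofactor_eval_inv_ne_zero ht hinj i))
        (mul_ne_zero (hb i) (cofactor_eval_inv_ne_zero ht hinj i))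
        (fun l => curve_eval_inv ht _ _ i l) (fun l => curve_eval_inv ht _ _ i l)
  have h1 := Polynomial.natDegree_le_of_dvd hdvd hQ0
  rw [Polynomial.natDegree_prod_of_monic _ _ fun i _ => (Polynomial.monic_X_sub_C _).pow _] at h1
  simp only [Polynomial.natDegree_pow, Polynomial.natDegree_X_sub_C, mul_one] at h1
  exact h1.trans hdeg

/-- The inequalities satisfied by an effective class. -/
theorem inequalities_of_mem_effMonoid [Infinite k] (hn : 1 ≤ n) {p : Fin (n + 2) → Pt k n (n + 1)}
    (hp : GeneralPosition p) {d₁ d₂ : ℤ} {r : Fin (n + 2) → ℤ}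
    (h : d₁ • H₁ p + d₂ • H₂ p - ∑ i, r i • E p i ∈ effMonoid p) :
    (0 ≤ d₁ ∧ 0 ≤ d₂) ∧ (∀ i, r i ≤ d₁ + d₂) ∧
      ∀ I : Finset (Fin (n + 2)), ∑ i ∈ I, r i ≤ n * d₁ + (n + 1) * d₂ := by
  have hinj := hp.injective hn
  have hm : 1 ≤ n + 1 := by omega
  obtain ⟨F, d, hF, h0, rfl, rfl, hr⟩ := exists_form_of_mem_effMonoid hn hm hinj h
  choose e he using fun i =>
    Int.eq_ofNat_of_zero_le (PrimeDivisor.formOrd_nonneg hn hm hinj (exceptional hn hinj i) hF h0)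
  have he' (i) : Polynomial.X ^ e i ∣ taylor (p i) F :=
    (le_formOrd_exceptional_iff hn hinj hF h0 i).1 (he i).ge
  have hre (i) : r i ≤ e i := (hr i).trans_eq (he i)
  refine ⟨⟨Int.natCast_nonneg _, Int.natCast_nonneg _⟩, fun i => ?_, fun I => ?_⟩
  · exact (hre i).trans (by exact_mod_cast le_of_X_pow_dvd_taylor hF h0 (he' i))
  · calc ∑ i ∈ I, r i ≤ ∑ i ∈ I, (e i : ℤ) := Finset.sum_le_sum fun i _ => hre i
      _ ≤ ∑ i, (e i : ℤ) := Finset.sum_le_sum_of_subset_of_nonneg (Finset.subset_univ I)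
        fun i _ _ => Int.natCast_nonneg _
      _ ≤ _ := by exact_mod_cast sum_le_of_X_pow_dvd_taylor hp hF h0 he'

end
end
end BlowupProd

namespace BlowupProd

open Projectivization WithZero
open scoped LinearAlgebra.Projectivization TensorProduct WithZero

noncomputable section

section

/-! ### The monoid and the cone of effective classes -/

/-- `mem_of_inequalities` in the coordinates `m i = d₁ + d₂ - c i`. -/
theorem mem_of_multiplicity_inequalities {R : Type*} [CommRing R] [LinearOrder R]
    [IsStrictOrderedRing R] {n : ℕ} {C : AddSubmonoid (R × R × (Fin (n + 2) → R))}
    (h₁ : ∀ t : R, 0 ≤ t → ∀ I : Finset (Fin (n + 2)), I.card = n →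
      (t, 0, fun i => if i ∈ I then t else 0) ∈ C)
    (h₂ : ∀ t : R, 0 ≤ t → ∀ I : Finset (Fin (n + 2)), I.card = n + 1 →
      (0, t, fun i => if i ∈ I then t else 0) ∈ C)
    (h₃ : ∀ t : R, 0 ≤ t → ∀ i, (0, 0, -Pi.single i t) ∈ C) {d₁ d₂ : R} {r : Fin (n + 2) → R}
    (hd₁ : 0 ≤ d₁) (hd₂ : 0 ≤ d₂) (hr : ∀ i, r i ≤ d₁ + d₂)
    (hI : ∀ I : Finset (Fin (n + 2)), I.card = n + 1 ∨ I.card = n + 2 →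
      ∑ i ∈ I, r i ≤ n * d₁ + (n + 1) * d₂) : (d₁, d₂, r) ∈ C := by
  let φ : R × R × (Fin (n + 2) → R) →+ R × R × (Fin (n + 2) → R) :=
    { toFun := fun d => (d.1, d.2.1, fun i => d.1 + d.2.1 - d.2.2 i)
      map_zero' := by ext <;> simp
      map_add' := fun d e => by
        refine Prod.ext rfl (Prod.ext rfl (funext fun i => ?_))
        simp only [Prod.fst_add, Prod.snd_add, Pi.add_apply]
        ring }
  have hφ (d) : φ d = (d.1, d.2.1, fun i => d.1 + d.2.1 - d.2.2 i) := rfl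
  have hsum (I : Finset (Fin (n + 2))) :
      ∑ i ∈ I, (d₁ + d₂ - r i) = I.card * (d₁ + d₂) - ∑ i ∈ I, r i := by
    rw [Finset.sum_sub_distrib, Finset.sum_const, nsmul_eq_mul]
  have h : (d₁, d₂, fun i => d₁ + d₂ - r i) ∈ C.comap φ := by
    refine mem_of_inequalities (fun t ht i j hij => ?_) (fun t ht i => ?_) (fun t ht i => ?_) hd₁
      hd₂ (fun i => sub_nonneg.2 (hr i)) ?_ fun l => ?_
    · rw [AddSubmonoid.mem_comap, hφ]
      convert h₁ t ht (Finset.univ \ {i, j}) ?_ using 4 with l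
      · by_cases hli : l = i
        · simp [hli, Pi.single_eq_of_ne hij]
        by_cases hlj : l = j
        · simp [hlj, Pi.single_eq_of_ne hij.symm]
        simp [hli, hlj]
      · rw [Finset.card_sdiff_of_subset (Finset.subset_univ _), Finset.card_pair hij]
        simp
    · rw [AddSubmonoid.mem_comap, hφ]
      convert h₂ t ht (Finset.univ.erase i) (by simp) using 4 with l
      by_cases hli : l = i
      · simp [hli]
      · simp [hli]
    · rw [AddSubmonoid.mem_comap, hφ]
      convert h₃ t ht i using 3
      ext l
      simp
    · rw [hsum]
      have := hI Finset.univ (Or.inr (by simp))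
      rw [Finset.card_univ, Fintype.card_fin, two_nsmul]
      push_cast
      linarith
    · rw [hsum]
      have h := hI (Finset.univ.erase l) (Or.inl (by simp))
      rw [Finset.card_erase_of_mem (Finset.mem_univ l), Finset.card_univ, Fintype.card_fin]
      push_cast [Nat.add_sub_cancel]
      linarith
  rw [AddSubmonoid.mem_comap, hφ] at h
  simpa using h

variable {k : Type*} [Field k] {n s : ℕ}

/-- Real combinations of `H₁`, `H₂` and the `E i`. -/
def realCombination {m : ℕ} (p : Fin s → Pt k n m) :
    ℝ × ℝ × (Fin s → ℝ) →+ ℝ ⊗[ℤ] ClassGrp p where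
  toFun d := d.1 ⊗ₜ[ℤ] H₁ p + d.2.1 ⊗ₜ[ℤ] H₂ p - ∑ i, d.2.2 i ⊗ₜ[ℤ] E p i
  map_zero' := by simp
  map_add' d e := by
    simp only [Prod.fst_add, Prod.snd_add, Pi.add_apply, TensorProduct.add_tmul,
      Finset.sum_add_distrib]
    abel

theorem realCombination_apply {m : ℕ} (p : Fin s → Pt k n m) (d : ℝ × ℝ × (Fin s → ℝ)) :
    realCombination p d =
      d.1 ⊗ₜ[ℤ] H₁ p + d.2.1 ⊗ₜ[ℤ] H₂ p - ∑ i, d.2.2 i ⊗ₜ[ℤ] E p i :=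
  rfl

theorem tmul_mem_effCone {m : ℕ} {p : Fin s → Pt k n m} {t : ℝ} (ht : 0 ≤ t) {c : ClassGrp p}
    (hc : c ∈ effMonoid p) : t ⊗ₜ[ℤ] c ∈ effCone p := by
  have := (effCone p).smul_mem ht (PointedCone.subset_hull ⟨c, hc, rfl⟩)
  rwa [TensorProduct.smul_tmul', smul_eq_mul, mul_one] at this

/-- The monoid generated by the classes of the exceptional divisors and of the linear forms. -/
def generatedMonoid (p : Fin (n + 2) → Pt k n (n + 1)) : AddSubmonoid (ClassGrp p) :=
  AddSubmonoid.closure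
      (Set.range (E p) ∪
        {c | ∃ I : Finset (Fin (n + 2)), I.card = n ∧ c = H₁ p - ∑ i ∈ I, E p i} ∪
        {c | ∃ I : Finset (Fin (n + 2)), I.card = n + 1 ∧ c = H₂ p - ∑ i ∈ I, E p i})

theorem generatedMonoid_le (hn : 1 ≤ n) {p : Fin (n + 2) → Pt k n (n + 1)}
    (hp : GeneralPosition p) : generatedMonoid p ≤ effMonoid p := by
  have hinj := hp.injective hn
  rw [generatedMonoid, AddSubmonoid.closure_le]
  rintro _ ((⟨i, rfl⟩ | ⟨I, hI, rfl⟩) | ⟨I, hI, rfl⟩)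
  · exact E_mem_effMonoid hn hinj i
  · exact H₁_sub_mem_effMonoid hn (by omega) hinj hI.le
  · exact H₂_sub_mem_effMonoid hn (by omega) hinj hI.le

theorem combination_mem_generatedMonoid {p : Fin (n + 2) → Pt k n (n + 1)} {d₁ d₂ : ℤ}
    {r : Fin (n + 2) → ℤ} (hd : 0 ≤ d₁ ∧ 0 ≤ d₂) (hr : ∀ i, r i ≤ d₁ + d₂)
    (hI : ∀ I : Finset (Fin (n + 2)), I.card = n + 1 ∨ I.card = n + 2 →
      ∑ i ∈ I, r i ≤ n * d₁ + (n + 1) * d₂) :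
    combination p (d₁, d₂, r) ∈ generatedMonoid p := by
  refine mem_of_multiplicity_inequalities (C := (generatedMonoid p).comap (combination p))
    (fun t ht I hI => ?_) (fun t ht I hI => ?_) (fun t ht i => ?_) hd.1 hd.2 hr hI
  all_goals
    lift t to ℕ using ht
    rw [AddSubmonoid.mem_comap, combination_apply]
  · convert nsmul_mem (show H₁ p - ∑ i ∈ I, E p i ∈ generatedMonoid p from
      AddSubmonoid.subset_closure (Or.inl (Or.inr ⟨I, hI, rfl⟩))) t using 1
    simp [ite_smul, nsmul_sub, Finset.sum_nsmul]
  · convert nsmul_mem (show H₂ p - ∑ i ∈ I, E p i ∈ generatedMonoid p from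
      AddSubmonoid.subset_closure (Or.inr ⟨I, hI, rfl⟩)) t using 1
    simp [ite_smul, nsmul_sub, Finset.sum_nsmul]
  · convert nsmul_mem (show E p i ∈ generatedMonoid p from
      AddSubmonoid.subset_closure (Or.inl (Or.inl ⟨i, rfl⟩))) t using 1
    simp [Pi.single_apply, ite_smul]

theorem realCombination_mem_effCone (hn : 1 ≤ n) {p : Fin (n + 2) → Pt k n (n + 1)}
    (hp : GeneralPosition p) {d₁ d₂ : ℝ} {r : Fin (n + 2) → ℝ} (hd : 0 ≤ d₁ ∧ 0 ≤ d₂)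
    (hr : ∀ i, r i ≤ d₁ + d₂) (hI : ∀ I : Finset (Fin (n + 2)), I.card = n + 1 ∨ I.card = n + 2 →
      ∑ i ∈ I, r i ≤ n * d₁ + (n + 1) * d₂) :
    realCombination p (d₁, d₂, r) ∈ effCone p := by
  have hinj := hp.injective hn
  refine mem_of_multiplicity_inequalities
    (C := (effCone p).toAddSubmonoid.comap (realCombination p))
    (fun t ht I hI => ?_) (fun t ht I hI => ?_) (fun t ht i => ?_) hd.1 hd.2 hr hI
  all_goals rw [AddSubmonoid.mem_comap, realCombination_apply]
  · convert tmul_mem_effCone ht (H₁_sub_mem_effMonoid hn (by omega) hinj hI.le) using 1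
    simp [TensorProduct.ite_tmul, TensorProduct.tmul_sub, TensorProduct.tmul_sum]
  · convert tmul_mem_effCone ht (H₂_sub_mem_effMonoid hn (by omega) hinj hI.le) using 1
    simp [TensorProduct.ite_tmul, TensorProduct.tmul_sub, TensorProduct.tmul_sum]
  · convert tmul_mem_effCone ht (E_mem_effMonoid hn hinj i) using 1
    simp [Pi.single_apply, TensorProduct.ite_tmul, TensorProduct.neg_tmul]

theorem combination_bijective [Infinite k] (hn : 1 ≤ n) {p : Fin (n + 2) → Pt k n (n + 1)}
    (hp : GeneralPosition p) : Function.Bijective (combination p) := by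
  refine ⟨(injective_iff_map_eq_zero _).2 fun d hd => ?_,
    combination_surjective hn (by omega) (hp.injective hn)⟩
  -- the zero class is effective, and satisfies the inequalities and the opposite ones
  have h1 := inequalities_of_mem_effMonoid hn hp (hd ▸ zero_mem (effMonoid p))
  have h2 : combination p (-d) ∈ effMonoid p := by
    rw [map_neg, hd, neg_zero]
    exact zero_mem _
  have h3 := inequalities_of_mem_effMonoid hn hp h2
  obtain ⟨d₁, d₂, r⟩ := d
  simp only [Prod.fst_neg, Prod.snd_neg, Pi.neg_apply] at h1 h3
  have e1 : d₁ = 0 := by omega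
  have e2 : d₂ = 0 := by omega
  subst e1 e2
  refine Prod.ext rfl (Prod.ext rfl (funext fun i => ?_))
  have h4 := h1.2.1 i
  have h5 := h3.2.1 i
  change r i = 0
  omega

/-- The coordinates `(d₁, d₂, m)` of a real divisor class. -/
theorem exists_coordinates [Infinite k] (hn : 1 ≤ n) {p : Fin (n + 2) → Pt k n (n + 1)}
    (hp : GeneralPosition p) :
    ∃ Ψ : ℝ ⊗[ℤ] ClassGrp p →ₗ[ℝ] ℝ × ℝ × (Fin (n + 2) → ℝ),
      (∀ d, Ψ (realCombination p d) = d) ∧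
      ∀ d : ℤ × ℤ × (Fin (n + 2) → ℤ), Ψ (1 ⊗ₜ[ℤ] combination p d) =
        ((d.1 : ℝ), (d.2.1 : ℝ), fun i => (d.2.2 i : ℝ)) := by
  let e := AddEquiv.ofBijective (combination p) (combination_bijective hn hp)
  let ψ : ℤ × ℤ × (Fin (n + 2) → ℤ) →+ ℝ × ℝ × (Fin (n + 2) → ℝ) :=
    { toFun := fun d => ((d.1 : ℝ), (d.2.1 : ℝ), fun i => (d.2.2 i : ℝ))
      map_zero' := by ext <;> simp
      map_add' := fun d d' => by ext <;> simp }
  let Ψ := LinearMap.liftBaseChange ℝ (ψ.comp e.symm.toAddMonoidHom).toIntLinearMap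
  have h1 (t : ℝ) (d) : Ψ (t ⊗ₜ[ℤ] combination p d) = t • ψ d := by
    rw [LinearMap.liftBaseChange_tmul]
    exact congrArg (fun x => t • ψ x) (e.symm_apply_apply d)
  have hH₁ : H₁ p = combination p (1, 0, 0) := by simp [combination_apply]
  have hH₂ : H₂ p = combination p (0, 1, 0) := by simp [combination_apply]
  have hE (i) : E p i = combination p (0, 0, -Pi.single i 1) := by
    simp [combination_apply, Pi.single_apply, ite_smul]
  refine ⟨Ψ, fun d => ?_, fun d => by rw [h1, one_smul]; rfl⟩
  rw [realCombination_apply, map_sub, map_add, map_sum, hH₁, hH₂]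
  simp only [hE, h1]
  refine Prod.ext ?_ (Prod.ext ?_ (funext fun i => ?_))
  · simp [ψ, Prod.fst_sum]
  · simp [ψ, Prod.fst_sum, Prod.snd_sum]
  · simp [ψ, Prod.snd_sum, Finset.sum_apply, Pi.single_apply]

theorem inequalities_of_mem_effCone [Infinite k] (hn : 1 ≤ n) {p : Fin (n + 2) → Pt k n (n + 1)}
    (hp : GeneralPosition p) {d₁ d₂ : ℝ} {r : Fin (n + 2) → ℝ}
    (h : realCombination p (d₁, d₂, r) ∈ effCone p) :
    (0 ≤ d₁ ∧ 0 ≤ d₂) ∧ (∀ i, r i ≤ d₁ + d₂) ∧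
      ∀ I : Finset (Fin (n + 2)), ∑ i ∈ I, r i ≤ n * d₁ + (n + 1) * d₂ := by
  obtain ⟨Ψ, hΨ, hΨ'⟩ := exists_coordinates hn hp
  suffices key : ∀ z ∈ effCone p, (0 ≤ (Ψ z).1 ∧ 0 ≤ (Ψ z).2.1) ∧
      (∀ i, (Ψ z).2.2 i ≤ (Ψ z).1 + (Ψ z).2.1) ∧
      ∀ I : Finset (Fin (n + 2)),
        ∑ i ∈ I, (Ψ z).2.2 i ≤ n * (Ψ z).1 + (n + 1) * (Ψ z).2.1 by
    simpa only [hΨ] using key _ h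
  intro z hz
  induction hz using Submodule.span_induction with
  | mem z hz =>
    obtain ⟨c, hc, rfl⟩ := hz
    obtain ⟨d, rfl⟩ := (combination_bijective hn hp).2 c
    have := inequalities_of_mem_effMonoid hn hp hc
    simp only [hΨ']
    exact_mod_cast this
  | zero => simp
  | add y z _ _ hy hz =>
    simp only [map_add, Prod.fst_add, Prod.snd_add, Pi.add_apply, Finset.sum_add_distrib]
    refine ⟨⟨add_nonneg hy.1.1 hz.1.1, add_nonneg hy.1.2 hz.1.2⟩, fun i => ?_, fun I => ?_⟩
    · linarith [hy.2.1 i, hz.2.1 i]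
    · linarith [hy.2.2 I, hz.2.2 I]
  | smul t z _ hz =>
    have e : Ψ (t • z) = (t : ℝ) • Ψ z := Ψ.map_smul (t : ℝ) z
    simp only [e, Prod.smul_fst, Prod.smul_snd, Pi.smul_apply, smul_eq_mul, ← Finset.mul_sum]
    have ht : (0 : ℝ) ≤ t := t.2
    refine ⟨⟨mul_nonneg ht hz.1.1, mul_nonneg ht hz.1.2⟩, fun i => ?_, fun I => ?_⟩
    · rw [← mul_add]
      exact mul_le_mul_of_nonneg_left (hz.2.1 i) ht
    · refine (mul_le_mul_of_nonneg_left (hz.2.2 I) ht).trans_eq ?_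
      ring

end
end
end BlowupProd

open scoped TensorProduct in
open BlowupProd in
theorem mainTheorem2 {k : Type*} [Field k] [IsAlgClosed k] [CharZero k] (n : ℕ) (hn : 1 ≤ n)
    (p : Fin (n + 2) → Pt k n (n + 1)) (hp : GeneralPosition p) :
    -- every divisor class is `d₁ H₁ + d₂ H₂ - ∑ mᵢ Eᵢ` for unique integers `d₁, d₂, mᵢ`
    (∀ c : ClassGrp p, ∃! d : ℤ × ℤ × (Fin (n + 2) → ℤ),
      c = d.1 • H₁ p + d.2.1 • H₂ p - ∑ i, d.2.2 i • E p i) ∧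
    -- generators of the monoid of effective divisor classes
    effMonoid p = AddSubmonoid.closure
      (Set.range (E p) ∪
        {c | ∃ I : Finset (Fin (n + 2)), I.card = n ∧ c = H₁ p - ∑ i ∈ I, E p i} ∪
        {c | ∃ I : Finset (Fin (n + 2)), I.card = n + 1 ∧ c = H₂ p - ∑ i ∈ I, E p i}) ∧
    -- inequalities defining the monoid of effective divisor classes
    (∀ (d₁ d₂ : ℤ) (m : Fin (n + 2) → ℤ),
      d₁ • H₁ p + d₂ • H₂ p - ∑ i, m i • E p i ∈ effMonoid p ↔
        (0 ≤ d₁ ∧ 0 ≤ d₂) ∧ (∀ i, m i ≤ d₁ + d₂) ∧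
        ∀ I : Finset (Fin (n + 2)), I.card = n + 1 ∨ I.card = n + 2 →
          ∑ i ∈ I, m i ≤ n * d₁ + (n + 1) * d₂) ∧
    -- inequalities defining the effective cone
    (∀ (d₁ d₂ : ℝ) (m : Fin (n + 2) → ℝ),
      d₁ ⊗ₜ[ℤ] H₁ p + d₂ ⊗ₜ[ℤ] H₂ p - ∑ i, m i ⊗ₜ[ℤ] E p i ∈ effCone p ↔
        (0 ≤ d₁ ∧ 0 ≤ d₂) ∧ (∀ i, m i ≤ d₁ + d₂) ∧
        ∀ I : Finset (Fin (n + 2)), I.card = n + 1 ∨ I.card = n + 2 →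
          ∑ i ∈ I, m i ≤ n * d₁ + (n + 1) * d₂) := by
  have : Infinite k := IsAlgClosed.instInfinite
  have hbij := combination_bijective hn hp
  refine ⟨fun c => ?_, le_antisymm (fun c hc => ?_) (generatedMonoid_le hn hp),
    fun d₁ d₂ m => ⟨fun h => ?_, fun h => ?_⟩, fun d₁ d₂ m => ⟨fun h => ?_, fun h => ?_⟩⟩
  · obtain ⟨d, hd, huniq⟩ := hbij.existsUnique c
    exact ⟨d, hd.symm, fun d' hd' => huniq d' hd'.symm⟩
  · obtain ⟨⟨d₁, d₂, m⟩, rfl⟩ := hbij.2 c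
    have h := inequalities_of_mem_effMonoid hn hp hc
    exact combination_mem_generatedMonoid h.1 h.2.1 fun I _ => h.2.2 I
  · have h := inequalities_of_mem_effMonoid hn hp h
    exact ⟨h.1, h.2.1, fun I _ => h.2.2 I⟩
  · exact generatedMonoid_le hn hp (combination_mem_generatedMonoid h.1 h.2.1 h.2.2)
  · have h := inequalities_of_mem_effCone hn hp h
    exact ⟨h.1, h.2.1, fun I _ => h.2.2 I⟩
  · exact realCombination_mem_effCone hn hp h.1 h.2.1 h.2.2
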